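/- **Setting.** Fix $T,\tau>0$, $d\in\mathbb N$ and a nonempty metric space $U$ with its Borel $\sigma$-algebra. Let $\mathcal D$ be the Banach space of bounded right-continuous functions $x:[-\tau,0]\to\mathbb R^d$ with norm $\sup_\theta|x(\theta)|$, let $H=L^2([-\tau,0];\mathbb R^d)$, and let $\mathcal U[t,T]$ be the set of measurable $u:[t,T]\to U$. For $t\in[0,T]$, $x\in\mathcal D$, $u\in\mathcal U[t,T]$ let $X=X^u(\cdot,t,x)$ be the solution, continuous on $[t,T]$, of $$X(s)=x(0)+\int_t^sF\big(\sigma,X(\sigma),(a,X_\sigma)_H,u(\sigma)\big)d\sigma+\int_t^sb(\sigma)X(\sigma-\tau)\,d\sigma,\quad s\in[t,T],\qquad X(s)=x(s-t),\ s\in[t-\tau,t],$$ where $X_\sigma(\theta)=X(\sigma+\theta)$, and put $$J(t,x,u)=\int_t^Tq(\sigma,X(\sigma),u(\sigma))\,d\sigma+\phi(X(T)),\qquad V(t,x)=\inf_{u\in\mathcal U[t,T]}J(t,x,u).$$ **Assumptions.** (A1) $F:[0,T]\times\mathbb R^d\times\mathbb R\times U\to\mathbb R^d$ is measurable and, for some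 $L>0$ and all $t,s\in[0,T]$, $\xi,\eta\in\mathbb R^d\times\mathbb R$, $u\in U$, $|F(t,\xi,u)|\le L(1+|\xi|)$ and $|F(t,\xi,u)-F(s,\eta,u)|\le L(|s-t|+|\xi-\eta|)$; $a\in W^{1,2}([-\tau,0];\mathbb R^d)$ with $a(-\tau)=0$; $b\in W^{1,2}([0,T];\mathbb R^{d\times d})$ is Lipschitz. (A2) $q:[0,T]\times\mathbb R^d\times U\to\mathbb R$ and $\phi:\mathbb R^d\to\mathbb R$ are measurable, and for some $L>0$ and some $\rho:[0,\infty)^2\to[0,\infty)$, nondecreasing in both arguments, with $\rho(0,R)=0$ and $\lim_{\delta\to0+}\rho(\delta,R)=0$ for each $R\geq0$, one has for all $t,s\in[0,T]$, $x,y\in\mathbb R^d$, $u\in U$: $|q(t,x,u)|+|\phi(x)|\le L(1+|x|)$ and $|q(t,x,u)-q(s,y,u)|+|\phi(x)-\phi(y)|\le L|x-y|+\rho(|s-t|,|x|\vee|y|)$. **The equation.** For $x\in\mathcal D$ and $h\ge0$ let $\widehat x_h\in\mathcal D$ be given by $\widehat x_h(\theta)=x(h+\theta)$ if $h+\theta<0$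 and $\widehat x_h(\theta)=x(0)$ otherwise, and put $\mathcal S(f)(x)=\lim_{h\to0+}\frac1h[f(\widehat x_h)-f(x)]$. For $v\in\mathbb R^d$ let $v1_0\in\mathcal D$ be the function equal to $v$ at $0$ and to $0$ on $[-\tau,0)$. The Hamilton–Jacobi–Bellman equation is $$\partial_tw(t,x)+\mathcal S(w)(t,x)+H(t,x,\nabla_xw(t,x))=0,\qquad w(T,x)=\phi(x(0)),\tag{HJB}$$ $$H(t,x,p)=\inf_{u\in U}\Big[\big\langle\big(F(t,x(0),(a,x)_H,u)+b(t)x(-\tau)\big)1_0,\,p\big\rangle+q(t,x(0),u)\Big],\quad p\in\mathcal D^*.$$ **Viscosity solutions.** Let $\Phi$ be the set of $\varphi\in C^1([0,T]\times\mathcal D)$ such that for each $t$ the limit defining $\mathcal S(\varphi(t,\cdot))(x)$ exists for all $x\in\mathcal D$, and such that $\varphi(t,x)=\varphi_0(t,x(0),x)$ for some $\varphi_0\in C^1([0,T]\times\mathbb R^d\times H)$. For $s\le t$ and $z,x\in\mathcal D$ let $(s,z)\otimes(t,x)=(t,\tilde x)$, where $\tilde x(\theta)=x(\theta)$ for $\theta\ge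 s-t$ and $\tilde x(\theta)=z(t-s+\theta)$ for $-\tau\leq\theta<s-t$. For bounded open $Q\subset\mathbb R^d$ let $\mathcal D_{\overline Q}$ be the set of $x\in\mathcal D$ with all values in $\overline Q$. A continuous $w:[0,T]\times\mathcal D\to\mathbb R$ is a *viscosity subsolution* (*supersolution*) of (HJB) if $w(T,x)\le\phi(x(0))$ (resp. $\geq$) for all $x\in\mathcal D$, and for every bounded open $Q\subset\mathbb R^d$, every $\varphi\in\Phi$ and every $(s,z)\in[0,T)\times\mathcal D_{\overline Q}$ with $z(0)\in Q$: $$\text{if }(w-\varphi)(s,z)=\sup_{(t,x)\in[s,T]\times\mathcal D_{\overline Q}}(w-\varphi)\big((s,z)\otimes(t,x)\big),\ \text{ then }\ \varphi_t(s,z)+\mathcal S(\varphi)(s,z)+H(s,z,\nabla_x\varphi(s,z))\ge0$$ $$\Big(\text{resp. if }(w+\varphi)(s,z)=\inf_{(t,x)\in[s,T]\times\mathcal D_{\overline Q}}(w+\varphi)\big((s,z)\otimes(t,x)\big),\ \text{ then }\ -\varphi_t(s,z)-\mathcal S(\varphi)(s,z)+H(s,z,-\nabla_x\varphi(s,z))\le0\Big).$$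 A *viscosity solution* is a function that is both. Let $\mathcal C$ be the class of $w:[0,T]\times\mathcal D\to\mathbb R$ for which there is $\Lambda>0$ with, for all $(t,x),(s,y)\in[0,T]\times\mathcal D$, $|w(t,x)|\le\Lambda(1+|x(0)|+|x|_H)$ and $$|w(t,x)-w(s,y)|\le\Lambda(1+|x(0)|+|x|_H+|y(0)|+|y|_H)\Big(|x(0)-y(0)|+|s-t|^{1/2}+\sup_{l\in[-\tau,0]}\Big|\int_l^0(x(\theta)-y(\theta))\,d\theta\Big|\Big).$$ **Theorem.** Under (A1) and (A2), the infimum defining $V$ is finite on $[0,T]\times\mathcal D$, $V$ belongs to $\mathcal C$, $V$ is a viscosity solution of (HJB), and every viscosity solution of (HJB) that belongs to $\mathcal C$ equals $V$ on $[0,T]\times\mathcal D$. -/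

import Mathlib

open Set Filter Topology MeasureTheory
open scoped ENNReal

noncomputable section

namespace DelayHJB

/-- The state space `R^d` with its Euclidean norm. -/
abbrev E (d : ℕ) : Type := EuclideanSpace ℝ (Fin d)

/-! ### The space of bounded right-continuous paths -/

/-- The Banach space `𝒟` of bounded right-continuous functions `[-τ, 0] → R^d` with the supremum
norm, as a subspace of the bounded functions `ℓ^∞([-τ, 0]; R^d)`. No left limits are required, and
there is no condition at the right end point `0`. -/
def pathSubmodule (d : ℕ) (τ : ℝ) : Submodule ℝ (lp (fun _ : Icc (-τ) (0 : ℝ) => E d) ∞) where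
  carrier := {f | ∀ θ, ContinuousWithinAt (fun η : Icc (-τ) (0 : ℝ) => f η) (Ici θ) θ}
  zero_mem' := fun _ => continuousWithinAt_const
  add_mem' := fun hf hg θ => (hf θ).add (hg θ)
  smul_mem' := fun c _ hf θ => (hf θ).const_smul c

/-- The Banach space `𝒟`, as a type. -/
abbrev PathSpace (d : ℕ) (τ : ℝ) : Type := pathSubmodule d τ

variable {d : ℕ} {τ : ℝ}

theorem neg_le_zero' [hτ : Fact (0 < τ)] : -τ ≤ (0 : ℝ) := by linarith [hτ.out]

/-- The values of a path, as a function on the whole line. On `[-τ, 0]` this is the path itself; to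
the right of `0` it is frozen at its value at `0`, to the left of `-τ` at its value at `-τ`. -/
def PathSpace.ev [Fact (0 < τ)] (x : PathSpace d τ) : ℝ → E d :=
  IccExtend (neg_le_zero' (τ := τ)) (fun η => (x : lp (fun _ : Icc (-τ) (0 : ℝ) => E d) ∞) η)

theorem PathSpace.ev_of_mem [Fact (0 < τ)] (x : PathSpace d τ) {θ : ℝ} (h : θ ∈ Icc (-τ) 0) :
    x.ev θ = (x : lp (fun _ : Icc (-τ) (0 : ℝ) => E d) ∞) ⟨θ, h⟩ :=
  IccExtend_of_mem _ _ h

theorem PathSpace.norm_ev_le [Fact (0 < τ)] (x : PathSpace d τ) (θ : ℝ) : ‖x.ev θ‖ ≤ ‖x‖ :=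
  lp.norm_apply_le_norm ENNReal.top_ne_zero _ _

theorem PathSpace.ev_rightCont [Fact (0 < τ)] (x : PathSpace d τ) (θ : ℝ) :
    ContinuousWithinAt x.ev (Ici θ) θ := by
  have h := x.2 (projIcc (-τ) 0 neg_le_zero' θ)
  exact h.comp (continuous_projIcc.continuousWithinAt)
    (fun η hη => mem_Ici.2 (monotone_projIcc _ (mem_Ici.1 hη)))

/-- The path that has the values of a given bounded right-continuous function on the line. -/
def PathSpace.mk' (f : ℝ → E d) (hb : ∃ C, ∀ θ, ‖f θ‖ ≤ C)
    (hc : ∀ θ, ContinuousWithinAt f (Ici θ) θ) : PathSpace d τ :=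
  ⟨⟨fun η => f η, memℓp_infty (by
      obtain ⟨C, hC⟩ := hb
      exact ⟨C, by rintro _ ⟨η, rfl⟩; exact hC η⟩)⟩,
    fun θ => (hc θ).comp continuous_subtype_val.continuousWithinAt (fun _ hη => hη)⟩

theorem PathSpace.ev_mk' [Fact (0 < τ)] (f : ℝ → E d) (hb : ∃ C, ∀ θ, ‖f θ‖ ≤ C)
    (hc : ∀ θ, ContinuousWithinAt f (Ici θ) θ) {θ : ℝ} (h : θ ∈ Icc (-τ) 0) :
    (PathSpace.mk' f hb hc : PathSpace d τ).ev θ = f θ :=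
  PathSpace.ev_of_mem _ h

/-- Right-continuous functions are Borel measurable. -/
theorem measurable_of_rightCont (f : ℝ → E d) (hc : ∀ θ, ContinuousWithinAt f (Ici θ) θ) :
    Measurable f := by
  have hg : ∀ n : ℕ, Measurable fun θ : ℝ => f ((⌊((n : ℝ) + 1) * θ⌋ + 1 : ℝ) / ((n : ℝ) + 1)) := by
    intro n
    exact (measurable_from_top (f := fun k : ℤ => f ((k + 1 : ℝ) / ((n : ℝ) + 1)))).comp
      (Int.measurable_floor.comp (measurable_const.mul measurable_id))
  refine measurable_of_tendsto_metrizable hg (tendsto_pi_nhds.2 fun θ => ?_)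
  have hlow : ∀ n : ℕ, θ ≤ (⌊((n : ℝ) + 1) * θ⌋ + 1 : ℝ) / ((n : ℝ) + 1) := by
    intro n
    have hn : (0 : ℝ) < (n : ℝ) + 1 := by positivity
    rw [le_div_iff₀ hn]
    linarith [Int.lt_floor_add_one (((n : ℝ) + 1) * θ)]
  have hup : ∀ n : ℕ, (⌊((n : ℝ) + 1) * θ⌋ + 1 : ℝ) / ((n : ℝ) + 1) ≤ θ + 1 / ((n : ℝ) + 1) := by
    intro n
    have hn : (0 : ℝ) < (n : ℝ) + 1 := by positivity
    have h1 : (θ + 1 / ((n : ℝ) + 1)) * ((n : ℝ) + 1) = ((n : ℝ) + 1) * θ + 1 := by field_simp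
    rw [div_le_iff₀ hn, h1]
    linarith [Int.floor_le (((n : ℝ) + 1) * θ)]
  refine (hc θ).tendsto.comp (tendsto_nhdsWithin_iff.2 ⟨?_, Eventually.of_forall hlow⟩)
  refine tendsto_of_tendsto_of_tendsto_of_le_of_le tendsto_const_nhds ?_ hlow hup
  simpa using (tendsto_const_nhds (x := θ)).add (tendsto_one_div_add_atTop_nhds_zero_nat (𝕜 := ℝ))

/-- The Hilbert space `H = L²([-τ, 0]; R^d)`. -/
abbrev HSpace (d : ℕ) (τ : ℝ) : Type := Lp (E d) 2 (volume.restrict (Icc (-τ) (0 : ℝ)))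

theorem PathSpace.memLp [Fact (0 < τ)] (x : PathSpace d τ) :
    MemLp x.ev 2 (volume.restrict (Icc (-τ) (0 : ℝ))) :=
  MemLp.of_bound (measurable_of_rightCont _ x.ev_rightCont).aestronglyMeasurable ‖x‖
    (Eventually.of_forall x.norm_ev_le)

/-- The natural map `𝒟 → H`. -/
def PathSpace.toH [Fact (0 < τ)] (x : PathSpace d τ) : HSpace d τ := x.memLp.toLp x.ev

/-- The path `v 1_{0}`, equal to `v` at `0` and to `0` on `[-τ, 0)`. -/
def jump (v : E d) : PathSpace d τ :=
  PathSpace.mk' (fun θ => if 0 ≤ θ then v else 0)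
    ⟨‖v‖, fun θ => by split_ifs <;> simp⟩ (by
      intro θ
      by_cases h : 0 ≤ θ
      · exact (continuousWithinAt_const (b := v)).congr
          (fun η hη => if_pos (h.trans hη)) (if_pos h)
      · have h0 : (fun η : ℝ => if 0 ≤ η then v else (0 : E d)) =ᶠ[𝓝 θ] fun _ => 0 := by
          filter_upwards [Iio_mem_nhds (not_le.1 h)] with η hη
          exact if_neg (not_le.2 hη)
        exact (continuousAt_const.congr h0.symm).continuousWithinAt)

/-- The path `x̂_h : θ ↦ x̂(h + θ)` (for `h ≥ 0`), where `x̂` extends `x` to `[-τ, ∞)` by the constant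
`x(0)`. -/
def flatShift [Fact (0 < τ)] (h : ℝ) (x : PathSpace d τ) : PathSpace d τ :=
  PathSpace.mk' (fun θ => x.ev (h + θ)) ⟨‖x‖, fun θ => x.norm_ev_le _⟩
    (fun θ => ((x.ev_rightCont (h + θ)).comp (continuous_const.add continuous_id).continuousWithinAt
      (fun η hη => by simpa using hη)))

/-- The path component of `(t, ω) ⊗ (t', ω')`, where `t ≤ t'`: in absolute time it follows `ω`
strictly before time `t` and `ω'` from time `t` on. The time component of `(t, ω) ⊗ (t', ω')` is
`t'`. -/
def concat [Fact (0 < τ)] (t : ℝ) (ω : PathSpace d τ) (t' : ℝ) (ω' : PathSpace d τ) :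
    PathSpace d τ :=
  PathSpace.mk' (fun θ => if t - t' ≤ θ then ω'.ev θ else ω.ev (t' - t + θ))
    ⟨max ‖ω'‖ ‖ω‖, fun θ => by
      split_ifs
      · exact (ω'.norm_ev_le _).trans (le_max_left _ _)
      · exact (ω.norm_ev_le _).trans (le_max_right _ _)⟩ (by
      intro θ
      by_cases h : t - t' ≤ θ
      · exact (ω'.ev_rightCont θ).congr (fun η hη => if_pos (h.trans hη)) (if_pos h)
      · have h0 : (fun η : ℝ => if t - t' ≤ η then ω'.ev η else ω.ev (t' - t + η))
            =ᶠ[𝓝[Ici θ] θ] fun η => ω.ev (t' - t + η) := by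
          filter_upwards [mem_nhdsWithin_of_mem_nhds (Iio_mem_nhds (not_le.1 h))] with η hη
          exact if_neg (not_le.2 hη)
        refine ContinuousWithinAt.congr_of_eventuallyEq ?_ h0 (if_neg h)
        exact (ω.ev_rightCont (t' - t + θ)).comp
          (continuous_const.add continuous_id).continuousWithinAt (fun η hη => by simpa using hη))

/-- `𝒟_A`: the paths with all values in `A ⊆ R^d`. -/
def pathsIn [Fact (0 < τ)] (A : Set (E d)) : Set (PathSpace d τ) :=
  {ω | ∀ θ ∈ Icc (-τ) (0 : ℝ), ω.ev θ ∈ A}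

/-! ### The control problem and its hypotheses -/

/-- The coefficients of the state equation and of the cost. The space `R^{d × d}` is taken as the
space of linear maps of `R^d`. -/
structure Coefficients (d : ℕ) (U : Type*) where
  F : ℝ → E d → ℝ → U → E d
  a : ℝ → E d
  b : ℝ → E d →L[ℝ] E d
  q : ℝ → E d → U → ℝ
  φ : E d → ℝ

/-- `f ∈ W^{1,2}([α, β])`, for the continuous representative: `f` is the integral of a square
integrable derivative. -/
def IsW12 {G : Type*} [NormedAddCommGroup G] [NormedSpace ℝ G] (α β : ℝ) (f : ℝ → G) : Prop :=
  ∃ g : ℝ → G, MemLp g 2 (volume.restrict (Icc α β)) ∧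
    ∀ θ ∈ Icc α β, f θ = f α + ∫ s in α..θ, g s

/-- The assumptions on the coefficients of the state equation. The norm of a pair
`(x, r) ∈ R^d × R` is the Euclidean one. -/
structure StateHyp {U : Type*} [MeasurableSpace U] (P : Coefficients d U) (τ T : ℝ) : Prop where
  F_meas : Measurable fun p : Icc (0 : ℝ) T × E d × ℝ × U => P.F p.1 p.2.1 p.2.2.1 p.2.2.2
  F_bound : ∃ L > 0, ∀ t ∈ Icc 0 T, ∀ s ∈ Icc 0 T, ∀ (x y : E d) (r k : ℝ) (u : U),
    ‖P.F t x r u‖ ≤ L * (1 + ‖WithLp.toLp 2 (x, r)‖) ∧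
    ‖P.F t x r u - P.F s y k u‖ ≤ L * (|s - t| + ‖WithLp.toLp 2 (x - y, r - k)‖)
  a_W12 : IsW12 (-τ) 0 P.a
  a_left : P.a (-τ) = 0
  b_W12 : IsW12 0 T P.b
  b_lip : ∃ L > 0, ∀ t ∈ Icc 0 T, ∀ s ∈ Icc 0 T, ‖P.b s - P.b t‖ ≤ L * |s - t|

/-- A local modulus of continuity `ρ(δ, R)`, `δ, R ≥ 0`: nonnegative, nondecreasing in both
arguments, vanishing at `δ = 0`, and tending to `0` as `δ → 0` for each fixed `R`. -/
structure IsLocalModulus (ρ : ℝ → ℝ → ℝ) : Prop where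
  nonneg : ∀ δ ≥ 0, ∀ R ≥ 0, 0 ≤ ρ δ R
  mono : ∀ δ ≥ 0, ∀ R ≥ 0, ∀ δ' ≥ δ, ∀ R' ≥ R, ρ δ R ≤ ρ δ' R'
  zero : ∀ R ≥ 0, ρ 0 R = 0
  tendsto : ∀ R ≥ 0, Tendsto (fun δ => ρ δ R) (𝓝[>] 0) (𝓝 0)

/-- The assumptions on the running cost `q` and the terminal cost `φ`. -/
structure CostHyp {U : Type*} [MeasurableSpace U] (P : Coefficients d U) (T : ℝ) : Prop where
  q_meas : Measurable fun p : Icc (0 : ℝ) T × E d × U => P.q p.1 p.2.1 p.2.2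
  φ_meas : Measurable P.φ
  growth : ∃ L > 0, ∀ t ∈ Icc 0 T, ∀ (x : E d) (u : U), |P.q t x u| + |P.φ x| ≤ L * (1 + ‖x‖)
  cont : ∃ L > 0, ∃ ρ, IsLocalModulus ρ ∧
    ∀ t ∈ Icc 0 T, ∀ s ∈ Icc 0 T, ∀ (x y : E d) (u : U),
      |P.q t x u - P.q s y u| + |P.φ x - P.φ y| ≤ L * ‖x - y‖ + ρ |s - t| (max ‖x‖ ‖y‖)

section Problem

variable {U : Type*} (P : Coefficients d U)

/-- `(a, f)_H` for a function `f` on `[-τ, 0]`. -/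
def delayInner (τ : ℝ) (a f : ℝ → E d) : ℝ := ∫ θ in (-τ)..0, inner ℝ (a θ) (f θ)

/-- The admissible controls `𝒰[t, T]`: functions that are measurable on `[t, T]`. Their values
outside `[t, T]` play no role. -/
def controls [MeasurableSpace U] (t T : ℝ) : Set (ℝ → U) :=
  {u | Measurable ((Icc t T).domRestrict u)}

/-- `X` is the trajectory that starts at time `t` from the path `x` under the control `u`: it is
continuous on `[t, T]`, has the past `x`, and solves the integrated state equation on `[t, T]`. -/
structure IsTrajectory [Fact (0 < τ)] (T t : ℝ) (x : PathSpace d τ) (u : ℝ → U) (X : ℝ → E d) :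
    Prop where
  cont : ContinuousOn X (Icc t T)
  past : ∀ s ∈ Icc (t - τ) t, X s = x.ev (s - t)
  eqn : ∀ s ∈ Icc t T, X s = x.ev 0
    + (∫ σ in t..s, P.F σ (X σ) (delayInner τ P.a fun θ => X (σ + θ)) (u σ))
    + ∫ σ in t..s, P.b σ (X (σ - τ))

/-- The cost of a control `u` with trajectory `X` on `[t, T]`. -/
def cost (T t : ℝ) (u : ℝ → U) (X : ℝ → E d) : ℝ :=
  (∫ σ in t..T, P.q σ (X σ) (u σ)) + P.φ (X T)

/-- All values `J(t, x, u)` of the cost functional, `u ∈ 𝒰[t, T]`. -/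
def costs [MeasurableSpace U] [Fact (0 < τ)] (T t : ℝ) (x : PathSpace d τ) : Set ℝ :=
  {c | ∃ u ∈ controls t T, ∃ X, IsTrajectory P T t x u X ∧ c = cost P T t u X}

/-- The value function `V(t, x) = inf_u J(t, x, u)`. -/
def valueFunction [MeasurableSpace U] [Fact (0 < τ)] (T t : ℝ) (x : PathSpace d τ) : ℝ :=
  sInf (costs P T t x)

/-- The Hamiltonian `H(t, x, p)`, with `p` in the dual of `𝒟`. -/
def hamiltonian [Fact (0 < τ)] (t : ℝ) (x : PathSpace d τ) (p : PathSpace d τ →L[ℝ] ℝ) : ℝ :=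
  ⨅ u : U, (p (jump (P.F t (x.ev 0) (delayInner τ P.a x.ev) u + P.b t (x.ev (-τ))))
    + P.q t (x.ev 0) u)

end Problem

/-! ### Test functions and viscosity solutions -/

/-- `f` lies in the domain of the weak generator `𝒮`: the limit defining `𝒮(f)(x)` exists in `R`
for every path `x`. -/
def InDomS [Fact (0 < τ)] (f : PathSpace d τ → ℝ) : Prop :=
  ∀ x, ∃ l : ℝ, Tendsto (fun h : ℝ => (f (flatShift h x) - f x) / h) (𝓝[>] 0) (𝓝 l)

/-- `𝒮(f)(x) = lim_{h → 0+} (f(x̂_h) - f(x)) / h`. -/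
def genS [Fact (0 < τ)] (f : PathSpace d τ → ℝ) (x : PathSpace d τ) : ℝ :=
  limUnder (𝓝[>] (0 : ℝ)) fun h : ℝ => (f (flatShift h x) - f x) / h

/-- The class `Φ` of test functions on `[0, T] × 𝒟`. -/
structure IsTest [Fact (0 < τ)] (T : ℝ) (ψ : ℝ → PathSpace d τ → ℝ) : Prop where
  c1 : ContDiffOn ℝ 1 (fun p : ℝ × PathSpace d τ => ψ p.1 p.2) (Icc 0 T ×ˢ univ)
  domS : ∀ t ∈ Icc 0 T, InDomS (ψ t)
  factor : ∃ ψ₀ : ℝ → E d → HSpace d τ → ℝ,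
    ContDiffOn ℝ 1 (fun p : ℝ × E d × HSpace d τ => ψ₀ p.1 p.2.1 p.2.2) (Icc 0 T ×ˢ univ) ∧
    ∀ t ∈ Icc 0 T, ∀ x, ψ t x = ψ₀ t (x.ev 0) x.toH

/-- The time derivative on `[0, T]`, one-sided at the end points. -/
def dt (T : ℝ) (ψ : ℝ → PathSpace d τ → ℝ) (s : ℝ) (z : PathSpace d τ) : ℝ :=
  derivWithin (fun t => ψ t z) (Icc 0 T) s

/-- The values of `f((s, z) ⊗ (t, x))` for `(t, x) ∈ [s, T] × 𝒟_A`. -/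
def valuesAfter [Fact (0 < τ)] (T : ℝ) (A : Set (E d)) (f : ℝ → PathSpace d τ → ℝ) (s : ℝ)
    (z : PathSpace d τ) : Set ℝ :=
  {r | ∃ t ∈ Icc s T, ∃ x ∈ pathsIn A, r = f t (concat s z t x)}

section Viscosity

variable {U : Type*} (P : Coefficients d U) [Fact (0 < τ)] (T : ℝ) (w : ℝ → PathSpace d τ → ℝ)

/-- Viscosity subsolutions of the Hamilton-Jacobi-Bellman equation. -/
structure IsSubsolution : Prop where
  cont : ContinuousOn (fun p : ℝ × PathSpace d τ => w p.1 p.2) (Icc 0 T ×ˢ univ)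
  terminal : ∀ x, w T x ≤ P.φ (x.ev 0)
  test : ∀ Q : Set (E d), IsOpen Q → Bornology.IsBounded Q → ∀ ψ, IsTest T ψ →
    ∀ s ∈ Ico 0 T, ∀ z ∈ pathsIn (closure Q), z.ev 0 ∈ Q →
      IsLUB (valuesAfter T (closure Q) (fun t x => w t x - ψ t x) s z) (w s z - ψ s z) →
      0 ≤ dt T ψ s z + genS (ψ s) z + hamiltonian P s z (fderiv ℝ (ψ s) z)

/-- Viscosity supersolutions of the Hamilton-Jacobi-Bellman equation. -/
structure IsSupersolution : Prop where
  cont : ContinuousOn (fun p : ℝ × PathSpace d τ => w p.1 p.2) (Icc 0 T ×ˢ univ)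
  terminal : ∀ x, P.φ (x.ev 0) ≤ w T x
  test : ∀ Q : Set (E d), IsOpen Q → Bornology.IsBounded Q → ∀ ψ, IsTest T ψ →
    ∀ s ∈ Ico 0 T, ∀ z ∈ pathsIn (closure Q), z.ev 0 ∈ Q →
      IsGLB (valuesAfter T (closure Q) (fun t x => w t x + ψ t x) s z) (w s z + ψ s z) →
      - dt T ψ s z - genS (ψ s) z + hamiltonian P s z (-fderiv ℝ (ψ s) z) ≤ 0

/-- Viscosity solutions of the Hamilton-Jacobi-Bellman equation. -/
def IsViscositySolution : Prop := IsSubsolution P T w ∧ IsSupersolution P T w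

/-- The class of functions on `[0, T] × 𝒟` in which uniqueness is claimed: at most linear growth in
`|x(0)| + |x|_H`, and the stated local continuity in time and in a weak norm of the path. -/
def InUniquenessClass : Prop :=
  ∃ Λ > 0, ∀ t ∈ Icc 0 T, ∀ s ∈ Icc 0 T, ∀ x y : PathSpace d τ,
    |w t x| ≤ Λ * (1 + ‖x.ev 0‖ + ‖x.toH‖) ∧
    |w t x - w s y| ≤ Λ * (1 + ‖x.ev 0‖ + ‖x.toH‖ + ‖y.ev 0‖ + ‖y.toH‖) *
      (‖x.ev 0 - y.ev 0‖ + √|s - t|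
        + ⨆ l : Icc (-τ) (0 : ℝ), ‖∫ θ in (l : ℝ)..0, (x.ev θ - y.ev θ)‖)

end Viscosity

end DelayHJB

end

open Set Filter Topology MeasureTheory
open scoped ENNReal

noncomputable section

namespace DelayHJB

/-! ### Bounded right-continuous functions on the line -/

/-! The value function solves the equation by dynamic programming, and uniqueness follows from a
comparison principle. The difficulty is that the estimates have to be made in a weak norm, for which
the point delay `x(-τ)` is not continuous.

Existence. Both `a` and `b` are primitives of square integrable functions, so integration by parts
(`IsW12.weak_bound`) bounds the delay terms by primitives of the path. With Gronwall, two
trajectories under the same control stay close if the initial paths are close at `0` and in the weak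
distance (`trajectory_difference`); this puts the value function into the class
(`valueFunction_mem_class`). A test function factors smoothly through `ℝ × ℝ^d × H`, and in `H` a
trajectory leaves the flat continuation of its past only at the rate `h^{3/2}`. So the time
derivative, the generator and the derivative in `x(0)` make up a first-order expansion along
trajectories, uniformly in the control (`IsTest.expansion`, `trajectory_expansion`). With `dpp_le`
and `dpp_ge` it gives the two viscosity inequalities.

Comparison. For a subsolution `w₁` and a supersolution `w₂` the variables are doubled, with the
penalty `|x(0) - y(0) + B ∫ (x - y)|² + |∫_·^0 (x - y)|_H²`. Along the flat continuation the
integral over `[-τ, 0]` has derivative `x(0) - x(-τ)`, so the first square produces `-B (x(-τ) -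
y(-τ))`, which cancels the uncontrolled part `b (x(-τ) - y(-τ))` of the velocities. The second
square produces `-|∫_{-τ}^0 (x - y)|²` (`two_inner_primitive`), which absorbs cross terms. Since
`a(-τ) = 0`, the difference of the distributed delays is bounded by the `H` norm of the primitive
alone. Hence these terms are a multiple of the penalty plus a small error (`penalty_terms_le`). Here
`B` is a `C¹` approximation of the Lipschitz function `b` with the same constants
(`exists_smooth_approx`), because test functions have to be `C¹` in time. A growth function that
decays along the dynamics (`exists_growth_decay`) localizes the argument and supplies the strict
inequality that is contradicted at the end (`comparison`).

Maxima. The paths in a ball are not compact, but a viscosity inequality compares a point only with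
its own continuations. A chain of continuations determines the limit path before the limiting time;
only the end value in `ℝ^d` is left open, and there compactness is available. A greedy choice along
such chains (`exists_maximal_of_chains`) yields a pair that is exactly maximal among its own
continuations and nearly maximal among all continuations of the starting point
(`exists_maximal_doubled`). Exact maximality gives the viscosity inequalities, near-maximality the
smallness of the penalty. -/

/-- Bounded right-continuous functions on the whole line. -/
structure IsRC {d : ℕ} (f : ℝ → E d) : Prop where
  bdd : ∃ C, ∀ r, ‖f r‖ ≤ C
  rc : ∀ r, ContinuousWithinAt f (Ici r) r

section Basics

variable {d : ℕ} {τ : ℝ}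

theorem IsRC.measurable {f : ℝ → E d} (hf : IsRC f) : Measurable f :=
  measurable_of_rightCont f hf.rc

theorem IsRC.intervalIntegrable {f : ℝ → E d} (hf : IsRC f) (a b : ℝ) :
    IntervalIntegrable f volume a b := by
  obtain ⟨C, hC⟩ := hf.bdd
  refine (intervalIntegrable_const (c := C)).mono_fun
    hf.measurable.aestronglyMeasurable (Eventually.of_forall fun r => ?_)
  exact (hC r).trans (le_abs_self C)

theorem IsRC.sq_intervalIntegrable {f : ℝ → E d} (hf : IsRC f) (a b : ℝ) :
    IntervalIntegrable (fun r => ‖f r‖ ^ 2) volume a b := by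
  obtain ⟨C, hC⟩ := hf.bdd
  refine (intervalIntegrable_const (c := C ^ 2)).mono_fun
    (hf.measurable.norm.pow_const 2).aestronglyMeasurable (Eventually.of_forall fun r => ?_)
  have := hC r
  have h0 := norm_nonneg (f r)
  simp only [norm_pow, norm_norm]
  rw [Real.norm_eq_abs, sq_abs]
  exact pow_le_pow_left₀ h0 this 2

theorem IsRC.sub {f g : ℝ → E d} (hf : IsRC f) (hg : IsRC g) : IsRC (fun r => f r - g r) := by
  obtain ⟨C, hC⟩ := hf.bdd
  obtain ⟨D, hD⟩ := hg.bdd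
  exact ⟨⟨C + D, fun r => (norm_sub_le _ _).trans (add_le_add (hC r) (hD r))⟩,
    fun r => (hf.rc r).sub (hg.rc r)⟩

theorem IsRC.comp_add {f : ℝ → E d} (hf : IsRC f) (s : ℝ) : IsRC (fun θ => f (s + θ)) := by
  obtain ⟨C, hC⟩ := hf.bdd
  refine ⟨⟨C, fun r => hC _⟩, fun θ => (hf.rc (s + θ)).comp
    (continuous_const.add continuous_id).continuousWithinAt (fun η hη => by simpa using hη)⟩

theorem IsRC.comp_sub {f : ℝ → E d} (hf : IsRC f) (s : ℝ) : IsRC (fun θ => f (θ - s)) := by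
  simpa [sub_eq_neg_add] using hf.comp_add (-s)

theorem isRC_ev [Fact (0 < τ)] (x : PathSpace d τ) : IsRC x.ev :=
  ⟨⟨‖x‖, x.norm_ev_le⟩, x.ev_rightCont⟩

theorem ev_sub [Fact (0 < τ)] (x y : PathSpace d τ) (θ : ℝ) :
    (x - y).ev θ = x.ev θ - y.ev θ := rfl

theorem ev_add [Fact (0 < τ)] (x y : PathSpace d τ) (θ : ℝ) :
    (x + y).ev θ = x.ev θ + y.ev θ := rfl

theorem ev_smul [Fact (0 < τ)] (c : ℝ) (x : PathSpace d τ) (θ : ℝ) :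
    (c • x).ev θ = c • x.ev θ := rfl

theorem ev_of_le [hτ : Fact (0 < τ)] (x : PathSpace d τ) {θ : ℝ} (h : 0 ≤ θ) :
    x.ev θ = x.ev 0 := by
  rw [PathSpace.ev, IccExtend_of_right_le _ _ h, IccExtend_of_right_le _ _ le_rfl]

theorem path_ext [Fact (0 < τ)] {x y : PathSpace d τ}
    (h : ∀ θ ∈ Icc (-τ) 0, x.ev θ = y.ev θ) : x = y := by
  apply Subtype.ext
  apply lp.ext
  funext η
  have := h η.1 η.2
  rwa [x.ev_of_mem η.2, y.ev_of_mem η.2] at this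

theorem mem_left [hτ : Fact (0 < τ)] : -τ ∈ Icc (-τ) (0 : ℝ) := ⟨le_rfl, neg_le_zero'⟩

theorem mem_zero [hτ : Fact (0 < τ)] : (0 : ℝ) ∈ Icc (-τ) (0 : ℝ) := ⟨neg_le_zero', le_rfl⟩

/-- The path `θ ↦ X(s + θ)`. -/
def seg (X : ℝ → E d) (s : ℝ) : PathSpace d τ :=
  open Classical in
  -- The zero path is a junk value; the evaluation lemmas ask for a bounded right-continuous `X`,
  -- which `IsTrajectory.exists_rc` provides.
  if h : IsRC X then PathSpace.mk' (fun θ => X (s + θ)) (h.comp_add s).bdd (h.comp_add s).rc else 0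

theorem seg_ev [Fact (0 < τ)] {X : ℝ → E d} (hX : IsRC X) (s : ℝ) {θ : ℝ} (h : θ ∈ Icc (-τ) 0) :
    (seg X s : PathSpace d τ).ev θ = X (s + θ) := by
  rw [seg, dif_pos hX, PathSpace.ev_mk' _ _ _ h]

theorem seg_ev_zero [Fact (0 < τ)] {X : ℝ → E d} (hX : IsRC X) (s : ℝ) :
    (seg X s : PathSpace d τ).ev 0 = X s := by
  rw [seg_ev hX s mem_zero, add_zero]

theorem flatShift_ev [Fact (0 < τ)] (h : ℝ) (x : PathSpace d τ) {θ : ℝ} (hθ : θ ∈ Icc (-τ) 0) :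
    (flatShift h x).ev θ = x.ev (h + θ) :=
  PathSpace.ev_mk' _ _ _ hθ

theorem jump_ev [Fact (0 < τ)] (v : E d) {θ : ℝ} (hθ : θ ∈ Icc (-τ) 0) :
    (jump v : PathSpace d τ).ev θ = if 0 ≤ θ then v else 0 :=
  PathSpace.ev_mk' _ _ _ hθ

theorem concat_ev [Fact (0 < τ)] (t : ℝ) (x : PathSpace d τ) (t' : ℝ) (y : PathSpace d τ) {θ : ℝ}
    (hθ : θ ∈ Icc (-τ) 0) :
    (concat t x t' y).ev θ = if t - t' ≤ θ then y.ev θ else x.ev (t' - t + θ) :=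
  PathSpace.ev_mk' _ _ _ hθ

/-! ### The norm of `H` -/

/-- The Cauchy-Schwarz inequality against the constant function. -/
theorem sq_integral_le {g : ℝ → ℝ} {a b : ℝ} (hab : a ≤ b) (hg : IntervalIntegrable g volume a b)
    (hg2 : IntervalIntegrable (fun r => g r ^ 2) volume a b) :
    (∫ r in a..b, g r) ^ 2 ≤ (b - a) * ∫ r in a..b, g r ^ 2 := by
  rcases hab.eq_or_lt with rfl | hab
  · simp
  have hpos : 0 < b - a := sub_pos.2 hab
  -- `m` is the mean of `g`; the claim is that the variance is nonnegative.
  set m := (∫ r in a..b, g r) / (b - a) with hm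
  have h0 : 0 ≤ ∫ r in a..b, (g r - m) ^ 2 :=
    intervalIntegral.integral_nonneg hab.le fun _ _ => sq_nonneg _
  have h1 : ∫ r in a..b, (g r - m) ^ 2
      = (∫ r in a..b, g r ^ 2) - 2 * m * (∫ r in a..b, g r) + (b - a) * m ^ 2 := by
    have : (fun r => (g r - m) ^ 2) = fun r => g r ^ 2 - (2 * m) * g r + m ^ 2 := by
      funext r; ring
    rw [this, intervalIntegral.integral_add (hg2.sub (hg.const_mul _)) intervalIntegrable_const,
      intervalIntegral.integral_sub hg2 (hg.const_mul _), intervalIntegral.integral_const_mul,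
      intervalIntegral.integral_const, smul_eq_mul]
  have hI : (∫ r in a..b, g r) = m * (b - a) := by rw [hm]; field_simp
  rw [h1, hI] at h0
  rw [hI]
  nlinarith

theorem sqrt_integral_bound {f : ℝ → E d} (hf : IsRC f) {a b : ℝ} (hab : a ≤ b) :
    ∫ r in a..b, ‖f r‖ ≤ √(b - a) * √(∫ r in a..b, ‖f r‖ ^ 2) := by
  rw [← Real.sqrt_mul (sub_nonneg.2 hab)]
  exact Real.le_sqrt_of_sq_le
    (sq_integral_le hab (hf.intervalIntegrable a b).norm (hf.sq_intervalIntegrable a b))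

theorem norm_toH_sq [hτ : Fact (0 < τ)] (x : PathSpace d τ) :
    ‖x.toH‖ ^ 2 = ∫ θ in (-τ)..0, ‖x.ev θ‖ ^ 2 := by
  rw [← real_inner_self_eq_norm_sq, L2.inner_def, intervalIntegral.integral_of_le neg_le_zero',
    ← integral_Icc_eq_integral_Ioc]
  refine integral_congr_ae ?_
  filter_upwards [x.memLp.coeFn_toLp] with θ hθ
  rw [PathSpace.toH, hθ, real_inner_self_eq_norm_sq]

theorem integral_sq_mono {f : ℝ → E d} (hf : IsRC f) {a b p q : ℝ} (h1 : a ≤ p) (h2 : p ≤ q)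
    (h3 : q ≤ b) : ∫ r in p..q, ‖f r‖ ^ 2 ≤ ∫ r in a..b, ‖f r‖ ^ 2 :=
  intervalIntegral.integral_mono_interval h1 h2 h3 (Eventually.of_forall fun _ => sq_nonneg _)
    (hf.sq_intervalIntegrable a b)

theorem integral_norm_le_toH [hτ : Fact (0 < τ)] (x : PathSpace d τ) {p q : ℝ} (h1 : -τ ≤ p)
    (h2 : p ≤ q) (h3 : q ≤ 0) : ∫ θ in p..q, ‖x.ev θ‖ ≤ √(q - p) * ‖x.toH‖ := by
  refine (sqrt_integral_bound (isRC_ev x) h2).trans ?_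
  gcongr
  refine Real.sqrt_le_iff.2 ⟨norm_nonneg _, ?_⟩
  rw [norm_toH_sq]
  exact integral_sq_mono (isRC_ev x) h1 h2 h3

theorem norm_integral_le_toH [hτ : Fact (0 < τ)] (x : PathSpace d τ) {p q : ℝ} (h1 : -τ ≤ p)
    (h2 : p ≤ q) (h3 : q ≤ 0) : ‖∫ θ in p..q, x.ev θ‖ ≤ √(q - p) * ‖x.toH‖ :=
  (intervalIntegral.norm_integral_le_integral_norm h2).trans (integral_norm_le_toH x h1 h2 h3)

theorem norm_toH_le [hτ : Fact (0 < τ)] (x : PathSpace d τ) {R : ℝ}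
    (hR : ∀ θ ∈ Icc (-τ) 0, ‖x.ev θ‖ ≤ R) : ‖x.toH‖ ≤ √τ * R := by
  have hR0 : 0 ≤ R := (norm_nonneg _).trans (hR 0 mem_zero)
  have hτ0 := hτ.out.le
  refine abs_le_of_sq_le_sq' ?_ (by positivity) |>.2
  rw [norm_toH_sq, mul_pow, Real.sq_sqrt hτ0]
  have : ∫ θ in (-τ)..0, ‖x.ev θ‖ ^ 2 ≤ ∫ θ in (-τ)..0, R ^ 2 :=
    intervalIntegral.integral_mono_on neg_le_zero' ((isRC_ev x).sq_intervalIntegrable _ _)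
      intervalIntegrable_const fun θ hθ => pow_le_pow_left₀ (norm_nonneg _) (hR θ hθ) 2
  simpa using this

theorem norm_toH_le_norm [hτ : Fact (0 < τ)] (x : PathSpace d τ) : ‖x.toH‖ ≤ √τ * ‖x‖ :=
  norm_toH_le x fun θ _ => x.norm_ev_le θ

theorem toH_add [Fact (0 < τ)] (x y : PathSpace d τ) : (x + y).toH = x.toH + y.toH :=
  MemLp.toLp_add x.memLp y.memLp

theorem toH_sub [Fact (0 < τ)] (x y : PathSpace d τ) : (x - y).toH = x.toH - y.toH :=
  MemLp.toLp_sub x.memLp y.memLp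

theorem toH_smul [Fact (0 < τ)] (c : ℝ) (x : PathSpace d τ) : (c • x).toH = c • x.toH :=
  MemLp.toLp_const_smul c x.memLp

/-- The natural map `𝒟 → H` as a continuous linear map. -/
def toHL [Fact (0 < τ)] : PathSpace d τ →L[ℝ] HSpace d τ :=
  LinearMap.mkContinuous ⟨⟨PathSpace.toH, toH_add⟩, toH_smul⟩ (√τ) norm_toH_le_norm

theorem toHL_apply [Fact (0 < τ)] (x : PathSpace d τ) : toHL x = x.toH := rfl

/-- Evaluation at a time, as a continuous linear map. -/
def evL [Fact (0 < τ)] (θ : ℝ) : PathSpace d τ →L[ℝ] E d :=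
  LinearMap.mkContinuous ⟨⟨fun x => x.ev θ, fun x y => ev_add x y θ⟩, fun c x => ev_smul c x θ⟩ 1
    fun x => by simpa using x.norm_ev_le θ

theorem evL_apply [Fact (0 < τ)] (θ : ℝ) (x : PathSpace d τ) : evL θ x = x.ev θ := rfl

theorem jump_ev_zero [Fact (0 < τ)] (v : E d) : (jump v : PathSpace d τ).ev 0 = v := by
  rw [jump_ev v mem_zero, if_pos le_rfl]

/-- A single time is a null set. This is why the derivative of a test function in the direction of a
jump sees only the variable `x(0)`. -/
theorem jump_toH [Fact (0 < τ)] (v : E d) : (jump v : PathSpace d τ).toH = 0 := by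
  have h : ‖(jump v : PathSpace d τ).toH‖ ^ 2 = 0 := by
    rw [norm_toH_sq, intervalIntegral.integral_of_le neg_le_zero', ← integral_Icc_eq_integral_Ioc,
      integral_Icc_eq_integral_Ico]
    rw [setIntegral_congr_fun (g := fun _ => (0 : ℝ)) measurableSet_Ico]
    · simp
    · intro θ hθ
      simp only
      rw [jump_ev v ⟨hθ.1, hθ.2.le⟩, if_neg (not_le.2 hθ.2)]
      simp
  exact norm_eq_zero.1 (pow_eq_zero_iff two_ne_zero |>.1 h)

/-! ### The weak distance of paths -/

/-- The weak distance `sup_l |∫_l^0 (x - y)|`. -/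
def weakDist [Fact (0 < τ)] (x y : PathSpace d τ) : ℝ :=
  ⨆ l : Icc (-τ) (0 : ℝ), ‖∫ θ in (l : ℝ)..0, (x.ev θ - y.ev θ)‖

theorem weakDist_le [hτ : Fact (0 < τ)] {x y : PathSpace d τ} {C : ℝ}
    (h : ∀ l ∈ Icc (-τ) 0, ‖∫ θ in l..0, (x.ev θ - y.ev θ)‖ ≤ C) : weakDist x y ≤ C := by
  have : Nonempty (Icc (-τ) (0 : ℝ)) := ⟨⟨0, mem_zero⟩⟩
  exact ciSup_le fun l => h l l.2

theorem le_weakDist [hτ : Fact (0 < τ)] (x y : PathSpace d τ) {l : ℝ} (hl : l ∈ Icc (-τ) 0) :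
    ‖∫ θ in l..0, (x.ev θ - y.ev θ)‖ ≤ weakDist x y := by
  refine le_ciSup (f := fun l : Icc (-τ) (0 : ℝ) => ‖∫ θ in (l : ℝ)..0, (x.ev θ - y.ev θ)‖)
    ⟨√τ * ‖(x - y).toH‖, ?_⟩ ⟨l, hl⟩
  rintro _ ⟨l, rfl⟩
  refine (norm_integral_le_toH (x - y) l.2.1 l.2.2 le_rfl).trans ?_
  gcongr
  linarith [l.2.1]

theorem weakDist_nonneg [hτ : Fact (0 < τ)] (x y : PathSpace d τ) : 0 ≤ weakDist x y :=
  (norm_nonneg _).trans (le_weakDist x y mem_zero)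

theorem weakDist_comm [hτ : Fact (0 < τ)] (x y : PathSpace d τ) : weakDist x y = weakDist y x := by
  unfold weakDist
  congr 1
  funext l
  rw [← norm_neg, ← intervalIntegral.integral_neg]
  simp

theorem weakDist_le_norm [hτ : Fact (0 < τ)] (x y : PathSpace d τ) :
    weakDist x y ≤ τ * ‖x - y‖ := by
  refine weakDist_le fun l hl => ?_
  refine (intervalIntegral.norm_integral_le_of_norm_le_const
    (C := ‖x - y‖) fun θ _ => (x - y).norm_ev_le θ).trans ?_
  rw [mul_comm, zero_sub, abs_neg, abs_of_nonpos hl.2]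
  gcongr
  linarith [hl.1]

/-- A path and a continuation of it after a time `h` are weakly close. -/
theorem weakDist_continuation [hτ : Fact (0 < τ)] {x x' : PathSpace d τ} {h : ℝ} (hh : 0 ≤ h)
    (hc : ∀ θ ∈ Icc (-τ) 0, θ < -h → x'.ev θ = x.ev (θ + h)) :
    weakDist x' x ≤ √h * (‖x.toH‖ + ‖x'.toH‖) := by
  refine weakDist_le fun l hl => ?_
  have ix := (isRC_ev x).intervalIntegrable
  have ix' := (isRC_ev x').intervalIntegrable
  rw [intervalIntegral.integral_sub (ix' _ _) (ix _ _)]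
  by_cases hlh : -h ≤ l
  · have hb : ∀ y : PathSpace d τ, ‖∫ θ in l..0, y.ev θ‖ ≤ √h * ‖y.toH‖ := fun y =>
      (norm_integral_le_toH y hl.1 hl.2 le_rfl).trans (by gcongr; linarith)
    calc _ ≤ _ := norm_sub_le _ _
      _ ≤ _ := by linarith [hb x, hb x']
  · push Not at hlh
    have e1 : ∫ θ in l..(-h), x'.ev θ = ∫ θ in (l + h)..0, x.ev θ := by
      have : ∫ θ in l..(-h), x'.ev θ = ∫ θ in l..(-h), x.ev (θ + h) := by
        rw [intervalIntegral.integral_of_le hlh.le, intervalIntegral.integral_of_le hlh.le,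
          integral_Ioc_eq_integral_Ioo, integral_Ioc_eq_integral_Ioo]
        refine setIntegral_congr_fun measurableSet_Ioo fun θ hθ => ?_
        exact hc θ ⟨hl.1.trans hθ.1.le, by linarith [hθ.2]⟩ hθ.2
      rw [this, intervalIntegral.integral_comp_add_right (fun θ => x.ev θ)]
      simp
    -- The common part of the two paths cancels. What is left are integrals over two intervals of
    -- length `h`, and Cauchy-Schwarz bounds each by `√h` times a norm in `H`.
    have e2 : (∫ θ in l..0, x'.ev θ) - ∫ θ in l..0, x.ev θ
        = (∫ θ in (-h)..0, x'.ev θ) - ∫ θ in l..(l + h), x.ev θ := by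
      rw [← intervalIntegral.integral_add_adjacent_intervals (ix' l (-h)) (ix' (-h) 0), e1,
        ← intervalIntegral.integral_add_adjacent_intervals (ix l (l + h)) (ix (l + h) 0)]
      abel
    rw [e2]
    have b1 : ‖∫ θ in (-h)..0, x'.ev θ‖ ≤ √h * ‖x'.toH‖ := by
      simpa using norm_integral_le_toH x' (p := -h) (q := 0) (by linarith [hl.1]) (by linarith)
        le_rfl
    have b2 : ‖∫ θ in l..(l + h), x.ev θ‖ ≤ √h * ‖x.toH‖ := by
      simpa using norm_integral_le_toH x (p := l) (q := l + h) hl.1 (by linarith) (by linarith)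
    calc _ ≤ _ := norm_sub_le _ _
      _ ≤ _ := by linarith

/-- The two windows share all but an interval of length `h` each. The weak distance does not control
the norm of `H`, so the growth function needs this separate bound along continuations. -/
theorem abs_norm_toH_sq_sub_le [hτ : Fact (0 < τ)] {x x' : PathSpace d τ} {h R : ℝ} (hh : 0 ≤ h)
    (hc : ∀ θ ∈ Icc (-τ) 0, θ < -h → x'.ev θ = x.ev (θ + h))
    (hx : ∀ θ ∈ Icc (-τ) 0, ‖x.ev θ‖ ≤ R) (hx' : ∀ θ ∈ Icc (-τ) 0, ‖x'.ev θ‖ ≤ R) :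
    |‖x'.toH‖ ^ 2 - ‖x.toH‖ ^ 2| ≤ h * R ^ 2 := by
  have ix := (isRC_ev x).sq_intervalIntegrable
  have ix' := (isRC_ev x').sq_intervalIntegrable
  have key : ∀ y : PathSpace d τ, (∀ θ ∈ Icc (-τ) 0, ‖y.ev θ‖ ≤ R) → ∀ p q, -τ ≤ p → p ≤ q → q ≤ 0 →
      0 ≤ ∫ θ in p..q, ‖y.ev θ‖ ^ 2 ∧ ∫ θ in p..q, ‖y.ev θ‖ ^ 2 ≤ (q - p) * R ^ 2 := by
    intro y hy p q h1 h2 h3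
    refine ⟨intervalIntegral.integral_nonneg h2 fun _ _ => sq_nonneg _, ?_⟩
    have : ∫ θ in p..q, ‖y.ev θ‖ ^ 2 ≤ ∫ θ in p..q, R ^ 2 :=
      intervalIntegral.integral_mono_on h2 ((isRC_ev y).sq_intervalIntegrable _ _)
        intervalIntegrable_const fun θ hθ => pow_le_pow_left₀ (norm_nonneg _)
          (hy θ ⟨h1.trans hθ.1, hθ.2.trans h3⟩) 2
    simpa using this
  rw [norm_toH_sq, norm_toH_sq]
  by_cases hlh : τ ≤ h
  · have k1 := key x hx (-τ) 0 le_rfl neg_le_zero' le_rfl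
    have k2 := key x' hx' (-τ) 0 le_rfl neg_le_zero' le_rfl
    have : (0 - -τ) * R ^ 2 ≤ h * R ^ 2 := by gcongr; linarith
    rw [abs_le]; constructor <;> linarith
  · push Not at hlh
    have e1 : ∫ θ in (-τ)..(-h), ‖x'.ev θ‖ ^ 2 = ∫ θ in (-τ + h)..0, ‖x.ev θ‖ ^ 2 := by
      have : ∫ θ in (-τ)..(-h), ‖x'.ev θ‖ ^ 2 = ∫ θ in (-τ)..(-h), ‖x.ev (θ + h)‖ ^ 2 := by
        rw [intervalIntegral.integral_of_le (by linarith),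
          intervalIntegral.integral_of_le (by linarith),
          integral_Ioc_eq_integral_Ioo, integral_Ioc_eq_integral_Ioo]
        refine setIntegral_congr_fun measurableSet_Ioo fun θ hθ => ?_
        rw [hc θ ⟨hθ.1.le, by linarith [hθ.2]⟩ hθ.2]
      rw [this, intervalIntegral.integral_comp_add_right (fun θ => ‖x.ev θ‖ ^ 2), neg_add_cancel]
    have k1 := key x hx (-τ) (-τ + h) le_rfl (by linarith) (by linarith)
    have k2 := key x' hx' (-h) 0 (by linarith) (by linarith) le_rfl
    rw [← intervalIntegral.integral_add_adjacent_intervals (ix' (-τ) (-h)) (ix' (-h) 0), e1,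
        ← intervalIntegral.integral_add_adjacent_intervals (ix (-τ) (-τ + h)) (ix (-τ + h) 0)]
    have a1 : (-τ + h - -τ) * R ^ 2 = h * R ^ 2 := by ring
    have a2 : (0 - -h) * R ^ 2 = h * R ^ 2 := by ring
    rw [abs_le]; constructor <;> linarith

end Basics

/-! ### Gronwall's inequality and integration by parts against `W^{1,2}` kernels. -/

section ByParts

/-- The Gronwall inequality in integral form. -/
theorem gronwall_integral {g : ℝ → ℝ} {a b A M : ℝ} (hab : a ≤ b) (hg : ContinuousOn g (Icc a b))
    (h0 : ∀ s ∈ Icc a b, 0 ≤ g s) (hM : 0 ≤ M)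
    (h : ∀ s ∈ Icc a b, g s ≤ A + M * ∫ r in a..s, g r) :
    ∀ s ∈ Icc a b, g s ≤ A * Real.exp (M * (s - a)) := by
  -- The continuous extension makes the primitive differentiable everywhere, so the differential
  -- form of Gronwall applies to the right-hand side, which dominates `g`.
  set G : ℝ → ℝ := IccExtend hab ((Icc a b).domRestrict g) with hG
  have hGc : Continuous G := (continuousOn_iff_continuous_domRestrict.1 hg).Icc_extend'
  have hGg : ∀ s ∈ Icc a b, G s = g s := fun s hs => by
    rw [hG, IccExtend_of_mem _ _ hs]; rfl
  have hint : ∀ s ∈ Icc a b, ∫ r in a..s, G r = ∫ r in a..s, g r := fun s hs =>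
    intervalIntegral.integral_congr fun r hr => by
      rw [uIcc_of_le hs.1] at hr
      exact hGg r ⟨hr.1, hr.2.trans hs.2⟩
  have hder : ∀ s, HasDerivAt (fun s => A + M * ∫ r in a..s, G r) (M * G s) s := fun s =>
    ((hGc.integral_hasStrictDerivAt a s).hasDerivAt.const_mul M).const_add A
  have hA : ∀ s ∈ Icc a b, G s ≤ A + M * ∫ r in a..s, G r := fun s hs => by
    rw [hGg s hs, hint s hs]; exact h s hs
  have hnn : ∀ s ∈ Icc a b, 0 ≤ G s := fun s hs => by rw [hGg s hs]; exact h0 s hs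
  have key := norm_le_gronwallBound_of_norm_deriv_right_le (f := fun s => A + M * ∫ r in a..s, G r)
    (f' := fun s => M * G s) (δ := A) (K := M) (ε := 0) (a := a) (b := b)
    (fun s _ => (hder s).continuousAt.continuousWithinAt)
    (fun s _ => (hder s).hasDerivWithinAt)
    (by
      have h1 := hA a ⟨le_rfl, hab⟩
      have h2 := hnn a ⟨le_rfl, hab⟩
      simp only [intervalIntegral.integral_same, mul_zero, add_zero] at h1 ⊢
      rw [Real.norm_of_nonneg (h2.trans h1)])
    (fun s hs => by
      have hs' : s ∈ Icc a b := ⟨hs.1, hs.2.le⟩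
      have h1 := hA s hs'
      have h2 := hnn s hs'
      rw [Real.norm_of_nonneg (mul_nonneg hM h2), Real.norm_of_nonneg (h2.trans h1), add_zero]
      gcongr)
  intro s hs
  have h1 := key s hs
  rw [gronwallBound_ε0, Real.norm_of_nonneg ((hnn s hs).trans (hA s hs))] at h1
  rw [← hGg s hs]
  exact (hA s hs).trans h1

variable {G F : Type*} [NormedAddCommGroup G] [NormedSpace ℝ G] [CompleteSpace G]
  [NormedAddCommGroup F] [NormedSpace ℝ F] [CompleteSpace F]

/-- Fubini on the triangle `r ≤ σ`, justified by the integrable majorant `‖c' r‖ * ‖g σ‖`. -/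
theorem integral_triangle_swap {c' : ℝ → G →L[ℝ] F} {g : ℝ → G} {p q : ℝ} (hpq : p ≤ q)
    (hc' : IntervalIntegrable c' volume p q) (hg : IntervalIntegrable g volume p q) :
    ∫ σ in p..q, (∫ r in p..σ, c' r) (g σ) = ∫ r in p..q, c' r (∫ σ in r..q, g σ) := by
  rw [intervalIntegrable_iff_integrableOn_Ioc_of_le hpq] at hc' hg
  set μ := volume.restrict (Ioc p q) with hμ
  set S : Set (ℝ × ℝ) := {z | z.1 ≤ z.2} with hS
  have hSm : MeasurableSet S := measurableSet_le measurable_fst measurable_snd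
  have hint0 : Integrable (fun z : ℝ × ℝ => c' z.1 (g z.2)) (μ.prod μ) := by
    refine (hc'.norm.mul_prod hg.norm).mono' ?_ (Eventually.of_forall fun z => ?_)
    · exact (ContinuousLinearMap.id ℝ (G →L[ℝ] F)).aestronglyMeasurable_comp₂
        hc'.aestronglyMeasurable.comp_fst hg.aestronglyMeasurable.comp_snd
    · exact (c' z.1).le_opNorm _
  have hint : Integrable (Function.uncurry fun r σ => S.indicator (fun z => c' z.1 (g z.2)) (r, σ))
      (μ.prod μ) := hint0.indicator hSm
  have hswap := integral_integral_swap hint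
  rw [intervalIntegral.integral_of_le hpq, intervalIntegral.integral_of_le hpq]
  have e1 : ∀ σ ∈ Ioc p q, ∫ r, S.indicator (fun z => c' z.1 (g z.2)) (r, σ) ∂μ
      = (∫ r in p..σ, c' r) (g σ) := by
    intro σ hσ
    have : (fun r => S.indicator (fun z => c' z.1 (g z.2)) (r, σ))
        = (Iic σ).indicator fun r => c' r (g σ) := by
      funext r; simp [indicator, hS]
    rw [this, hμ, setIntegral_indicator measurableSet_Iic, Ioc_inter_Iic, min_eq_right hσ.2,
      intervalIntegral.integral_of_le hσ.1.le,
      ContinuousLinearMap.integral_apply (hc'.mono_set (Ioc_subset_Ioc_right hσ.2))]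
  have e2 : ∀ r ∈ Ioc p q, ∫ σ, S.indicator (fun z => c' z.1 (g z.2)) (r, σ) ∂μ
      = c' r (∫ σ in r..q, g σ) := by
    intro r hr
    have : (fun σ => S.indicator (fun z => c' z.1 (g z.2)) (r, σ))
        = (Ici r).indicator fun σ => c' r (g σ) := by
      funext σ; simp [indicator, hS]
    have hset : Ioc p q ∩ Ici r = Icc r q := by
      ext z; simp only [mem_inter_iff, mem_Ioc, mem_Ici, mem_Icc]
      exact ⟨fun h => ⟨h.2, h.1.2⟩, fun h => ⟨⟨hr.1.trans_le h.1, h.2⟩, h.1⟩⟩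
    rw [this, hμ, setIntegral_indicator measurableSet_Ici, hset, integral_Icc_eq_integral_Ioc,
      intervalIntegral.integral_of_le hr.2,
      ContinuousLinearMap.integral_comp_comm _ (hg.mono_set (Ioc_subset_Ioc_left hr.1.le))]
  rw [← setIntegral_congr_fun measurableSet_Ioc e1, ← setIntegral_congr_fun measurableSet_Ioc e2]
  exact hswap.symm

/-- Integration by parts against the primitive from the right end point. -/
theorem integral_by_parts {c c' : ℝ → G →L[ℝ] F} {g : ℝ → G} {p q : ℝ} (hpq : p ≤ q)
    (hc' : IntervalIntegrable c' volume p q) (hg : IntervalIntegrable g volume p q)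
    (hc : ∀ σ ∈ Icc p q, c σ = c p + ∫ r in p..σ, c' r) :
    ∫ σ in p..q, c σ (g σ) = c p (∫ σ in p..q, g σ) + ∫ r in p..q, c' r (∫ σ in r..q, g σ) := by
  rw [← integral_triangle_swap hpq hc' hg]
  have e : ∫ σ in p..q, c σ (g σ) = ∫ σ in p..q, (c p (g σ) + (∫ r in p..σ, c' r) (g σ)) := by
    refine intervalIntegral.integral_congr fun σ hσ => ?_
    rw [uIcc_of_le hpq] at hσ
    rw [hc σ hσ]; rfl
  have i1 : IntervalIntegrable (fun σ => c p (g σ)) volume p q :=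
    ⟨(c p).integrable_comp hg.1, (c p).integrable_comp hg.2⟩
  have hcont : ContinuousOn (fun σ => ∫ r in p..σ, c' r) (uIcc p q) :=
    intervalIntegral.continuousOn_primitive_interval
      (by
        rw [uIcc_of_le hpq, integrableOn_Icc_iff_integrableOn_Ioc]
        exact (intervalIntegrable_iff_integrableOn_Ioc_of_le hpq).1 hc')
  have i2 : IntervalIntegrable (fun σ => (∫ r in p..σ, c' r) (g σ)) volume p q := by
    rw [intervalIntegrable_iff_integrableOn_Ioc_of_le hpq] at hg ⊢
    rw [uIcc_of_le hpq] at hcont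
    obtain ⟨C, hC⟩ := isCompact_Icc.exists_bound_of_continuousOn hcont
    refine (hg.norm.const_mul C).mono' ?_ ?_
    · exact (ContinuousLinearMap.id ℝ (G →L[ℝ] F)).aestronglyMeasurable_comp₂
        ((hcont.mono Ioc_subset_Icc_self).aestronglyMeasurable measurableSet_Ioc)
        hg.aestronglyMeasurable
    · refine (ae_restrict_iff' measurableSet_Ioc).2 (Eventually.of_forall fun σ hσ => ?_)
      exact (ContinuousLinearMap.le_opNorm _ _).trans
        (mul_le_mul_of_nonneg_right (hC σ (Ioc_subset_Icc_self hσ)) (norm_nonneg _))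
  rw [e, intervalIntegral.integral_add i1 i2,
    ContinuousLinearMap.intervalIntegral_comp_comm _ hg]

theorem IsW12.intervalIntegrable {α β : ℝ} {g : ℝ → G}
    (hg : MemLp g 2 (volume.restrict (Icc α β))) {p q : ℝ} (h1 : α ≤ p) (h2 : p ≤ q) (h3 : q ≤ β) :
    IntervalIntegrable g volume p q := by
  rw [intervalIntegrable_iff_integrableOn_Ioc_of_le h2]
  have : IntegrableOn g (Icc α β) := hg.integrable (by norm_num)
  exact this.mono_set fun r hr => ⟨h1.trans hr.1.le, hr.2.trans h3⟩

theorem IsW12.continuousOn {α β : ℝ} (hαβ : α ≤ β) {c : ℝ → G} (hc : IsW12 α β c) :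
    ContinuousOn c (Icc α β) := by
  obtain ⟨c', h1, h2⟩ := hc
  have : ContinuousOn (fun θ => c α + ∫ s in α..θ, c' s) (Icc α β) := by
    refine continuousOn_const.add ?_
    have := intervalIntegral.continuousOn_primitive_interval (f := c') (μ := volume) (a := α) (b := β)
      (by rw [uIcc_of_le hαβ]; exact h1.integrable (by norm_num))
    rwa [uIcc_of_le hαβ] at this
  exact this.congr h2

/-- After integration by parts only primitives of `g` occur, so the constant is the supremum of `c`
plus the `L¹` norm of its derivative. This is what makes both delay terms continuous for the weak
distance. -/
theorem IsW12.weak_bound {α β : ℝ} (hαβ : α ≤ β) {c : ℝ → G →L[ℝ] F} (hc : IsW12 α β c) :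
    ∃ C ≥ 0, ∀ p q, α ≤ p → p ≤ q → q ≤ β → ∀ (g : ℝ → G) (M : ℝ), IntervalIntegrable g volume p q →
      (∀ r ∈ Icc p q, ‖∫ σ in r..q, g σ‖ ≤ M) → ‖∫ σ in p..q, c σ (g σ)‖ ≤ C * M := by
  obtain ⟨B, hB⟩ := isCompact_Icc.exists_bound_of_continuousOn (hc.continuousOn hαβ)
  have hB0 : 0 ≤ B := (norm_nonneg _).trans (hB α ⟨le_rfl, hαβ⟩)
  obtain ⟨c', h1, h2⟩ := hc
  have hi := (IsW12.intervalIntegrable h1 le_rfl hαβ le_rfl).norm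
  have hI0 : 0 ≤ ∫ r in α..β, ‖c' r‖ := intervalIntegral.integral_nonneg hαβ fun _ _ => norm_nonneg _
  refine ⟨B + ∫ r in α..β, ‖c' r‖, by positivity, fun p q hp hpq hq g M hg hM => ?_⟩
  have hM0 : 0 ≤ M := (norm_nonneg _).trans (hM p ⟨le_rfl, hpq⟩)
  have ip := IsW12.intervalIntegrable h1 hp hpq hq
  rw [integral_by_parts hpq ip hg (fun σ hσ => by
    rw [h2 σ ⟨hp.trans hσ.1, hσ.2.trans hq⟩, h2 p ⟨hp, hpq.trans hq⟩, add_assoc,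
      intervalIntegral.integral_add_adjacent_intervals
        (IsW12.intervalIntegrable h1 le_rfl hp (hpq.trans hq))
        (IsW12.intervalIntegrable h1 hp hσ.1 (hσ.2.trans hq))])]
  have b1 : ‖c p (∫ σ in p..q, g σ)‖ ≤ B * M :=
    ((c p).le_opNorm _).trans (mul_le_mul (hB p ⟨hp, hpq.trans hq⟩) (hM p ⟨le_rfl, hpq⟩)
      (norm_nonneg _) hB0)
  have b2 : ‖∫ r in p..q, c' r (∫ σ in r..q, g σ)‖ ≤ (∫ r in α..β, ‖c' r‖) * M := by
    calc _ ≤ ∫ r in p..q, ‖c' r‖ * M := by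
          refine intervalIntegral.norm_integral_le_of_norm_le hpq
            (Eventually.of_forall fun r hr => ?_) (ip.norm.mul_const M)
          exact ((c' r).le_opNorm _).trans
            (mul_le_mul_of_nonneg_left (hM r (Ioc_subset_Icc_self hr)) (norm_nonneg _))
      _ = (∫ r in p..q, ‖c' r‖) * M := intervalIntegral.integral_mul_const _ _
      _ ≤ _ := by
          gcongr
          exact intervalIntegral.integral_mono_interval hp hpq hq
            (Eventually.of_forall fun r => norm_nonneg _) hi
  calc _ ≤ _ := norm_add_le _ _
    _ ≤ _ := by linarith

theorem IsW12.clm_comp {α β : ℝ} (hαβ : α ≤ β) {c : ℝ → G} (hc : IsW12 α β c) (L : G →L[ℝ] F) :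
    IsW12 α β fun θ => L (c θ) := by
  obtain ⟨c', h1, h2⟩ := hc
  refine ⟨fun θ => L (c' θ), L.comp_memLp' h1, fun θ hθ => ?_⟩
  simp only
  rw [h2 θ hθ, map_add, L.intervalIntegral_comp_comm
    (IsW12.intervalIntegrable h1 le_rfl hθ.1 hθ.2)]

theorem integral_mul_le_sqrt {f g : ℝ → ℝ} {p q : ℝ} (hpq : p ≤ q)
    (hf0 : ∀ r, 0 ≤ f r) (hg0 : ∀ r, 0 ≤ g r) (hf : MemLp f 2 (volume.restrict (Ioc p q)))
    (hg : MemLp g 2 (volume.restrict (Ioc p q))) :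
    ∫ r in p..q, f r * g r ≤ √(∫ r in p..q, f r ^ 2) * √(∫ r in p..q, g r ^ 2) := by
  have := integral_mul_le_Lp_mul_Lq_of_nonneg (μ := volume.restrict (Ioc p q))
    (Real.HolderConjugate.two_two) (Eventually.of_forall hf0) (Eventually.of_forall hg0)
    (by simpa using hf) (by simpa using hg)
  simp only [intervalIntegral.integral_of_le hpq, Real.sqrt_eq_rpow]
  simpa using this

/-- If `c(p) = 0` then `∫ c g` is controlled by the `L²` norm of the primitive of `g`. -/
theorem IsW12.volterra_bound {α β : ℝ} (hαβ : α ≤ β) {c : ℝ → G →L[ℝ] F} (hc : IsW12 α β c)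
    (h0 : c α = 0) :
    ∃ C ≥ 0, ∀ g : ℝ → G, IntervalIntegrable g volume α β →
      ‖∫ σ in α..β, c σ (g σ)‖ ≤ C * √(∫ r in α..β, ‖∫ σ in r..β, g σ‖ ^ 2) := by
  obtain ⟨c', h1, h2⟩ := hc
  -- Since `c α = 0` there is no boundary term, and Hölder leaves only the `L²` norm of the
  -- primitive instead of its supremum. Comparison depends on this gain.
  refine ⟨√(∫ r in α..β, ‖c' r‖ ^ 2), Real.sqrt_nonneg _, fun g hg => ?_⟩
  have ip := IsW12.intervalIntegrable h1 le_rfl hαβ le_rfl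
  rw [integral_by_parts hαβ ip hg h2, h0]
  simp only [zero_apply, zero_add]
  have hcont : ContinuousOn (fun r => ‖∫ σ in r..β, g σ‖) (Icc α β) := by
    have := intervalIntegral.continuousOn_primitive_interval_left (f := g) (μ := volume)
      (a := α) (b := β) (by
        rw [uIcc_of_le hαβ, integrableOn_Icc_iff_integrableOn_Ioc]
        exact (intervalIntegrable_iff_integrableOn_Ioc_of_le hαβ).1 hg)
    rw [uIcc_of_le hαβ] at this
    exact this.norm
  obtain ⟨B, hB⟩ := isCompact_Icc.exists_bound_of_continuousOn hcont
  have m1 : MemLp (fun r => ‖c' r‖) 2 (volume.restrict (Ioc α β)) :=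
    (h1.mono_measure (Measure.restrict_mono Ioc_subset_Icc_self le_rfl)).norm
  have m2 : MemLp (fun r => ‖∫ σ in r..β, g σ‖) 2 (volume.restrict (Ioc α β)) :=
    MemLp.of_bound ((hcont.mono Ioc_subset_Icc_self).aestronglyMeasurable measurableSet_Ioc) B
      ((ae_restrict_iff' measurableSet_Ioc).2
        (Eventually.of_forall fun r hr => hB r (Ioc_subset_Icc_self hr)))
  refine le_trans ?_ (integral_mul_le_sqrt hαβ (fun _ => norm_nonneg _) (fun _ => norm_nonneg _)
    m1 m2)
  refine intervalIntegral.norm_integral_le_of_norm_le hαβ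
    (Eventually.of_forall fun r _ => (c' r).le_opNorm _) ?_
  rw [intervalIntegrable_iff_integrableOn_Ioc_of_le hαβ]
  exact m1.integrable_mul m2

end ByParts

/-! ### One constant for all the hypotheses on the coefficients. -/

section Bounds

variable {d : ℕ} {τ T : ℝ} {U : Type*}

/-- Everything about the coefficients except measurability and the modulus of continuity of `q` in
time, with a single constant. -/
structure CoefBound (P : Coefficients d U) (τ T K : ℝ) : Prop where
  one_le : 1 ≤ K
  F_growth : ∀ t ∈ Icc 0 T, ∀ (x : E d) (r : ℝ) (u : U), ‖P.F t x r u‖ ≤ K * (1 + ‖x‖ + |r|)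
  F_lip : ∀ t ∈ Icc 0 T, ∀ s ∈ Icc 0 T, ∀ (x y : E d) (r k : ℝ) (u : U),
    ‖P.F t x r u - P.F s y k u‖ ≤ K * (|s - t| + ‖x - y‖ + |r - k|)
  a_le : ∀ θ ∈ Icc (-τ) 0, ‖P.a θ‖ ≤ K
  a_cont : ContinuousOn P.a (Icc (-τ) 0)
  a_weak : ∀ (g : ℝ → E d) (M : ℝ), IntervalIntegrable g volume (-τ) 0 →
    (∀ r ∈ Icc (-τ) 0, ‖∫ σ in r..0, g σ‖ ≤ M) → |delayInner τ P.a g| ≤ K * M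
  a_volterra : ∀ g : ℝ → E d, IntervalIntegrable g volume (-τ) 0 →
    |delayInner τ P.a g| ≤ K * √(∫ r in (-τ)..0, ‖∫ σ in r..0, g σ‖ ^ 2)
  b_le : ∀ t ∈ Icc 0 T, ‖P.b t‖ ≤ K
  b_lip : ∀ t ∈ Icc 0 T, ∀ s ∈ Icc 0 T, ‖P.b s - P.b t‖ ≤ K * |s - t|
  b_weak : ∀ p q, 0 ≤ p → p ≤ q → q ≤ T → ∀ (g : ℝ → E d) (M : ℝ), IntervalIntegrable g volume p q →
      (∀ r ∈ Icc p q, ‖∫ σ in r..q, g σ‖ ≤ M) → ‖∫ σ in p..q, P.b σ (g σ)‖ ≤ K * M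
  q_growth : ∀ t ∈ Icc 0 T, ∀ (x : E d) (u : U), |P.q t x u| ≤ K * (1 + ‖x‖)
  φ_growth : ∀ x : E d, |P.φ x| ≤ K * (1 + ‖x‖)
  q_lip : ∀ t ∈ Icc 0 T, ∀ (x y : E d) (u : U), |P.q t x u - P.q t y u| ≤ K * ‖x - y‖
  φ_lip : ∀ x y : E d, |P.φ x - P.φ y| ≤ K * ‖x - y‖

theorem norm_toLp_pair_le {V : Type*} [NormedAddCommGroup V] (x : V) (r : ℝ) :
    ‖WithLp.toLp 2 (x, r)‖ ≤ ‖x‖ + |r| := by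
  rw [WithLp.prod_norm_eq_of_L2]
  refine Real.sqrt_le_iff.2 ⟨by positivity, ?_⟩
  have : (0 : ℝ) ≤ 2 * ‖x‖ * |r| := by positivity
  have e : ‖(WithLp.toLp 2 (x, r)).fst‖ ^ 2 + ‖(WithLp.toLp 2 (x, r)).snd‖ ^ 2
      = ‖x‖ ^ 2 + |r| ^ 2 := rfl
  rw [e]
  nlinarith

theorem exists_coefBound [MeasurableSpace U] [Nonempty U] [hτ : Fact (0 < τ)] (hT : 0 < T)
    {P : Coefficients d U} (h1 : StateHyp P τ T) (h2 : CostHyp P T) : ∃ K, CoefBound P τ T K := by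
  obtain ⟨L, hL, hF⟩ := h1.F_bound
  obtain ⟨Lb, hLb, hb⟩ := h1.b_lip
  obtain ⟨Lg, hLg, hq⟩ := h2.growth
  obtain ⟨Lc, hLc, ρ, hρ, hqc⟩ := h2.cont
  obtain ⟨u₀⟩ := ‹Nonempty U›
  have ac := h1.a_W12.continuousOn neg_le_zero'
  obtain ⟨Ka, hKa⟩ := isCompact_Icc.exists_bound_of_continuousOn ac
  have hKa0 : 0 ≤ Ka := (norm_nonneg _).trans (hKa 0 mem_zero)
  obtain ⟨Kb, hKb⟩ := isCompact_Icc.exists_bound_of_continuousOn (h1.b_W12.continuousOn hT.le)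
  have hKb0 : 0 ≤ Kb := (norm_nonneg _).trans (hKb 0 ⟨le_rfl, hT.le⟩)
  have aW : IsW12 (-τ) 0 fun θ => (innerSL ℝ (P.a θ) : E d →L[ℝ] ℝ) :=
    h1.a_W12.clm_comp neg_le_zero' (innerSL ℝ)
  obtain ⟨Kw, hKw0, hKw⟩ := aW.weak_bound neg_le_zero'
  obtain ⟨Kv, hKv0, hKv⟩ := aW.volterra_bound neg_le_zero' (by simp [h1.a_left])
  obtain ⟨Kc, hKc0, hKc⟩ := h1.b_W12.weak_bound hT.le
  have h0T : (0 : ℝ) ∈ Icc 0 T := ⟨le_rfl, hT.le⟩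
  have up : ∀ {k z : ℝ}, k ≤ 1 + L + Lb + Lg + Lc + Ka + Kb + Kw + Kv + Kc → 0 ≤ z →
      k * z ≤ (1 + L + Lb + Lg + Lc + Ka + Kb + Kw + Kv + Kc) * z :=
    fun h hz => mul_le_mul_of_nonneg_right h hz
  refine ⟨1 + L + Lb + Lg + Lc + Ka + Kb + Kw + Kv + Kc, ?_, ?_, ?_, ?_, ac, ?_, ?_, ?_, ?_, ?_, ?_,
    ?_, ?_, ?_⟩
  · linarith
  · intro t ht x r u
    refine (hF t ht t ht x x r r u).1.trans (le_trans ?_ (up (k := L) (by linarith) (by positivity)))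
    exact mul_le_mul_of_nonneg_left (by linarith [norm_toLp_pair_le x r]) hL.le
  · intro t ht s hs x y r k u
    refine (hF t ht s hs x y r k u).2.trans
      (le_trans ?_ (up (k := L) (by linarith) (by positivity)))
    exact mul_le_mul_of_nonneg_left (by linarith [norm_toLp_pair_le (x - y) (r - k)]) hL.le
  · intro θ hθ; linarith [hKa θ hθ]
  · intro g M hg hM
    have hM0 : 0 ≤ M := (norm_nonneg _).trans (hM 0 mem_zero)
    exact (hKw _ _ le_rfl neg_le_zero' le_rfl g M hg hM).trans (up (by linarith) hM0)
  · intro g hg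
    exact (hKv g hg).trans (up (by linarith) (Real.sqrt_nonneg _))
  · intro t ht; linarith [hKb t ht]
  · intro t ht s hs
    exact (hb t ht s hs).trans (up (by linarith) (abs_nonneg _))
  · intro p q hp hpq hq g M hg hM
    have hM0 : 0 ≤ M := (norm_nonneg _).trans (hM q ⟨hpq, le_rfl⟩)
    exact (hKc p q hp hpq hq g M hg hM).trans (up (by linarith) hM0)
  · intro t ht x u
    refine le_trans ?_ (up (k := Lg) (by linarith) (by positivity))
    have := hq t ht x u
    have := abs_nonneg (P.φ x)
    linarith
  · intro x
    refine le_trans ?_ (up (k := Lg) (by linarith) (by positivity))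
    -- Bounds on `φ` alone are read off at time `0` and a fixed control value, dropping the
    -- nonnegative contribution of `q`.
    have := hq 0 h0T x u₀
    have := abs_nonneg (P.q 0 x u₀)
    linarith
  · intro t ht x y u
    refine le_trans ?_ (up (k := Lc) (by linarith) (by positivity))
    -- At equal times the modulus vanishes and only its Lipschitz companion survives.
    have := hqc t ht t ht x y u
    rw [sub_self, abs_zero, hρ.zero _ (le_max_of_le_left (norm_nonneg _)), add_zero] at this
    have := abs_nonneg (P.φ x - P.φ y)
    linarith
  · intro x y
    refine le_trans ?_ (up (k := Lc) (by linarith) (by positivity))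
    have := hqc 0 h0T 0 h0T x y u₀
    rw [sub_self, abs_zero, hρ.zero _ (le_max_of_le_left (norm_nonneg _)), add_zero] at this
    have := abs_nonneg (P.q 0 x u₀ - P.q 0 y u₀)
    linarith

end Bounds

/-! ### Closure properties of right-continuous functions. -/

section RC

variable {d : ℕ}

theorem IsRC.of_continuous {f : ℝ → E d} (hb : ∃ C, ∀ r, ‖f r‖ ≤ C) (hf : Continuous f) : IsRC f :=
  ⟨hb, fun _ => hf.continuousWithinAt⟩

theorem IsRC.ite {f g : ℝ → E d} (hf : IsRC f) (hg : IsRC g) (t : ℝ) :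
    IsRC fun r => if r < t then f r else g r := by
  obtain ⟨C, hC⟩ := hf.bdd
  obtain ⟨D, hD⟩ := hg.bdd
  refine ⟨⟨max C D, fun r => ?_⟩, fun r => ?_⟩
  · split_ifs
    exacts [(hC r).trans (le_max_left _ _), (hD r).trans (le_max_right _ _)]
  · by_cases h : r < t
    · refine ContinuousWithinAt.congr_of_eventuallyEq (hf.rc r) ?_ (if_pos h)
      filter_upwards [mem_nhdsWithin_of_mem_nhds (Iio_mem_nhds h)] with η hη
      exact if_pos hη
    · exact (hg.rc r).congr (fun η hη => if_neg (not_lt.2 ((not_lt.1 h).trans hη))) (if_neg h)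

end RC

/-! ### Measurability along trajectories and existence of solutions of the state equation. -/

section Trajectories

variable {d : ℕ} {τ T K : ℝ} [hτ : Fact (0 < τ)] {U : Type*} {P : Coefficients d U}

/-- The controlled part of the drift along a function. -/
def drift (P : Coefficients d U) (τ : ℝ) (u : ℝ → U) (X : ℝ → E d) (σ : ℝ) : E d :=
  P.F σ (X σ) (delayInner τ P.a fun θ => X (σ + θ)) (u σ)

theorem inner_integrable (hP : CoefBound P τ T K) {g : ℝ → E d}
    (hg : IntervalIntegrable g volume (-τ) 0) :
    IntervalIntegrable (fun θ => inner ℝ (P.a θ) (g θ)) volume (-τ) 0 := by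
  have hle : -τ ≤ (0 : ℝ) := neg_le_zero'
  rw [intervalIntegrable_iff_integrableOn_Ioc_of_le hle] at hg ⊢
  refine (hg.norm.const_mul K).mono' ?_ ?_
  · exact ((hP.a_cont.mono Ioc_subset_Icc_self).aestronglyMeasurable measurableSet_Ioc).inner
      hg.aestronglyMeasurable
  · refine (ae_restrict_iff' measurableSet_Ioc).2 (Eventually.of_forall fun θ hθ => ?_)
    exact (norm_inner_le_norm (𝕜 := ℝ) (P.a θ) (g θ)).trans
      (mul_le_mul_of_nonneg_right (hP.a_le θ (Ioc_subset_Icc_self hθ)) (norm_nonneg _))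

theorem delayInner_sub (hP : CoefBound P τ T K) {g h : ℝ → E d}
    (hg : IntervalIntegrable g volume (-τ) 0) (hh : IntervalIntegrable h volume (-τ) 0) :
    delayInner τ P.a g - delayInner τ P.a h = delayInner τ P.a fun θ => g θ - h θ := by
  unfold delayInner
  rw [← intervalIntegral.integral_sub (inner_integrable hP hg) (inner_integrable hP hh)]
  simp only [inner_sub_right]

theorem abs_delayInner_le (hP : CoefBound P τ T K) {g : ℝ → E d}
    (hg : IntervalIntegrable g volume (-τ) 0) :
    |delayInner τ P.a g| ≤ K * ∫ θ in (-τ)..0, ‖g θ‖ := by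
  rw [← intervalIntegral.integral_const_mul]
  change ‖∫ θ in (-τ)..0, (inner ℝ (P.a θ) (g θ) : ℝ)‖ ≤ _
  refine intervalIntegral.norm_integral_le_of_norm_le neg_le_zero'
    (Eventually.of_forall fun θ hθ => ?_) (hg.norm.const_mul K)
  exact (norm_inner_le_norm (𝕜 := ℝ) (P.a θ) (g θ)).trans
    (mul_le_mul_of_nonneg_right (hP.a_le θ (Ioc_subset_Icc_self hθ)) (norm_nonneg _))

theorem abs_delayInner_shift_le (hP : CoefBound P τ T K) {X : ℝ → E d} (hX : IsRC X) (σ : ℝ) :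
    |delayInner τ P.a fun θ => X (σ + θ)| ≤ K * ∫ r in (σ - τ)..σ, ‖X r‖ := by
  refine (abs_delayInner_le hP ((hX.comp_add σ).intervalIntegrable _ _)).trans_eq ?_
  rw [intervalIntegral.integral_comp_add_left (fun r => ‖X r‖)]
  simp [sub_eq_add_neg]

theorem delayInner_congr {g h : ℝ → E d} (a : ℝ → E d) (H : ∀ θ ∈ Icc (-τ) 0, g θ = h θ) :
    delayInner τ a g = delayInner τ a h := by
  refine intervalIntegral.integral_congr fun θ hθ => ?_
  rw [uIcc_of_le neg_le_zero'] at hθ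
  simp only [H θ hθ]

theorem measurable_delayInner (hP : CoefBound P τ T K) {X : ℝ → E d} (hX : IsRC X) :
    Measurable fun σ => delayInner τ P.a fun θ => X (σ + θ) := by
  have hle : -τ ≤ (0 : ℝ) := neg_le_zero'
  set A : ℝ → E d := IccExtend hle ((Icc (-τ) 0).domRestrict P.a) with hA
  have hAc : Continuous A := (continuousOn_iff_continuous_domRestrict.1 hP.a_cont).Icc_extend'
  have e : (fun σ => delayInner τ P.a fun θ => X (σ + θ))
      = fun σ => ∫ θ in Ioc (-τ) 0, (inner ℝ (A θ) (X (σ + θ)) : ℝ) := by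
    funext σ
    rw [delayInner, intervalIntegral.integral_of_le hle]
    refine setIntegral_congr_fun measurableSet_Ioc fun θ hθ => ?_
    simp only [hA, IccExtend_of_mem _ _ (Ioc_subset_Icc_self hθ), Set.domRestrict_apply]
  rw [e]
  have hm : StronglyMeasurable fun z : ℝ × ℝ => (inner ℝ (A z.2) (X (z.1 + z.2)) : ℝ) := by
    refine Measurable.stronglyMeasurable ?_
    exact (hAc.measurable.comp measurable_snd).inner
      (hX.measurable.comp (measurable_fst.add measurable_snd))
  exact (hm.integral_prod_right (ν := volume.restrict (Ioc (-τ) 0))).measurable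

theorem IsRC.norm_integral_le {X : ℝ → E d} {C : ℝ} (hC : ∀ r, ‖X r‖ ≤ C) {p q : ℝ} (h : p ≤ q) :
    ∫ r in p..q, ‖X r‖ ≤ C * (q - p) := by
  have := intervalIntegral.norm_integral_le_of_norm_le_const (f := fun r => ‖X r‖) (C := C) (a := p)
    (b := q) (fun r _ => by simpa using hC r)
  rw [abs_of_nonneg (sub_nonneg.2 h)] at this
  exact (le_abs_self _).trans this

variable [MeasurableSpace U]

theorem controls_mono {t p q s : ℝ} {u : ℝ → U} (hu : u ∈ controls t s) (h1 : t ≤ p)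
    (h2 : q ≤ s) : u ∈ controls p q := by
  have : Measurable fun σ : Icc p q => (⟨σ, h1.trans σ.2.1, σ.2.2.trans h2⟩ : Icc t s) :=
    measurable_subtype_coe.subtype_mk
  exact (Measurable.comp (g := (Icc t s).domRestrict u) hu this)

theorem drift_integrable (hstate : StateHyp P τ T) (hP : CoefBound P τ T K) {t p q s : ℝ}
    {u : ℝ → U} (hu : u ∈ controls t s) {X : ℝ → E d} (hX : IsRC X) (h0 : 0 ≤ t) (hsT : s ≤ T)
    (h1 : t ≤ p) (h2 : p ≤ q) (h3 : q ≤ s) : IntervalIntegrable (drift P τ u X) volume p q := by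
  have hu' := controls_mono hu h1 h3
  rw [intervalIntegrable_iff_integrableOn_Icc_of_le h2]
  have hmem : ∀ σ ∈ Icc p q, σ ∈ Icc 0 T := fun σ hσ =>
    ⟨h0.trans (h1.trans hσ.1), (hσ.2.trans h3).trans hsT⟩
  have hm : Measurable fun σ : Icc p q => drift P τ u X σ := by
    have := hstate.F_meas.comp (f := fun σ : Icc p q => ((⟨σ, hmem σ σ.2⟩ : Icc (0 : ℝ) T), X σ,
      (delayInner τ P.a fun θ => X (σ + θ)), u σ))
      ((measurable_subtype_coe.subtype_mk).prodMk
        ((hX.measurable.comp measurable_subtype_coe).prodMk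
          (((measurable_delayInner hP hX).comp measurable_subtype_coe).prodMk hu')))
    exact this
  obtain ⟨C, hC⟩ := hX.bdd
  have hK := hP.one_le
  have hC0 : 0 ≤ C := (norm_nonneg _).trans (hC 0)
  have hτ0 := hτ.out
  refine Integrable.of_bound
    (aemeasurable_restrict_of_measurable_subtype measurableSet_Icc hm).aestronglyMeasurable
    (K * (1 + C + K * (C * τ))) ?_
  refine (ae_restrict_iff' measurableSet_Icc).2 (Eventually.of_forall fun σ hσ => ?_)
  refine (hP.F_growth σ (hmem σ hσ) _ _ _).trans ?_
  have h1 := hC σ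
  have h2 : |delayInner τ P.a fun θ => X (σ + θ)| ≤ K * (C * τ) := by
    refine (abs_delayInner_shift_le hP hX σ).trans ?_
    have := IsRC.norm_integral_le hC (p := σ - τ) (q := σ) (by linarith)
    rw [sub_sub_cancel] at this
    gcongr
  gcongr

theorem cost_integrable (hcost : CostHyp P T) (hP : CoefBound P τ T K) {t p q s : ℝ}
    {u : ℝ → U} (hu : u ∈ controls t s) {X : ℝ → E d} (hX : IsRC X) (h0 : 0 ≤ t) (hsT : s ≤ T)
    (h1 : t ≤ p) (h2 : p ≤ q) (h3 : q ≤ s) :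
    IntervalIntegrable (fun σ => P.q σ (X σ) (u σ)) volume p q := by
  have hu' := controls_mono hu h1 h3
  rw [intervalIntegrable_iff_integrableOn_Icc_of_le h2]
  have hmem : ∀ σ ∈ Icc p q, σ ∈ Icc 0 T := fun σ hσ =>
    ⟨h0.trans (h1.trans hσ.1), (hσ.2.trans h3).trans hsT⟩
  have hm : Measurable fun σ : Icc p q => P.q σ (X σ) (u σ) := by
    have := hcost.q_meas.comp (f := fun σ : Icc p q => ((⟨σ, hmem σ σ.2⟩ : Icc (0 : ℝ) T), X σ,
      u σ)) ((measurable_subtype_coe.subtype_mk).prodMk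
        ((hX.measurable.comp measurable_subtype_coe).prodMk hu'))
    exact this
  obtain ⟨C, hC⟩ := hX.bdd
  have hK := hP.one_le
  refine Integrable.of_bound
    (aemeasurable_restrict_of_measurable_subtype measurableSet_Icc hm).aestronglyMeasurable
    (K * (1 + C)) ?_
  refine (ae_restrict_iff' measurableSet_Icc).2 (Eventually.of_forall fun σ hσ => ?_)
  refine (hP.q_growth σ (hmem σ hσ) _ _).trans ?_
  have h1 := hC σ
  gcongr

omit [MeasurableSpace U] in
theorem CoefBound.b_cont (hP : CoefBound P τ T K) : ContinuousOn P.b (Icc 0 T) := by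
  have hK : 0 ≤ K := zero_le_one.trans hP.one_le
  refine LipschitzOnWith.continuousOn (K := ⟨K, hK⟩) (LipschitzOnWith.of_dist_le_mul ?_)
  intro x hx y hy
  rw [dist_eq_norm, dist_eq_norm]
  exact hP.b_lip y hy x hx

omit [MeasurableSpace U] in
theorem delay_integrable (hP : CoefBound P τ T K) {p q : ℝ} {X : ℝ → E d} (hX : IsRC X)
    (h0 : 0 ≤ p) (h2 : p ≤ q) (h3 : q ≤ T) :
    IntervalIntegrable (fun σ => P.b σ (X (σ - τ))) volume p q := by
  rw [intervalIntegrable_iff_integrableOn_Icc_of_le h2]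
  obtain ⟨C, hC⟩ := hX.bdd
  have hK := hP.one_le
  refine Integrable.of_bound ?_ (K * C) ?_
  · exact (ContinuousLinearMap.id ℝ (E d →L[ℝ] E d)).aestronglyMeasurable_comp₂
      ((hP.b_cont.mono (Icc_subset_Icc h0 h3)).aestronglyMeasurable measurableSet_Icc)
      (hX.comp_sub τ).measurable.aestronglyMeasurable
  · refine (ae_restrict_iff' measurableSet_Icc).2 (Eventually.of_forall fun σ hσ => ?_)
    refine ((P.b σ).le_opNorm _).trans ?_
    have h1 := hC (σ - τ)
    have h2 := hP.b_le σ ⟨h0.trans hσ.1, hσ.2.trans h3⟩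
    gcongr

omit [MeasurableSpace U] in
theorem IsTrajectory.congr {t s : ℝ} {x : PathSpace d τ} {u : ℝ → U} {X Y : ℝ → E d}
    (h : IsTrajectory P s t x u X) (hXY : ∀ r ∈ Icc (t - τ) s, Y r = X r) (hts : t ≤ s) :
    IsTrajectory P s t x u Y := by
  have hτ0 := hτ.out
  refine ⟨h.cont.congr fun r hr => hXY r ⟨by linarith [hr.1], hr.2⟩, fun r hr => ?_, fun r hr => ?_⟩
  · rw [hXY r ⟨hr.1, hr.2.trans hts⟩, h.past r hr]
  · rw [hXY r ⟨by linarith [hr.1], hr.2⟩, h.eqn r hr]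
    congr 1
    · congr 1
      refine intervalIntegral.integral_congr fun σ hσ => ?_
      rw [uIcc_of_le hr.1] at hσ
      rw [hXY σ ⟨by linarith [hσ.1], hσ.2.trans hr.2⟩, delayInner_congr P.a fun θ hθ =>
        hXY (σ + θ) ⟨by linarith [hσ.1, hθ.1], by linarith [hσ.2, hθ.2, hr.2]⟩]
    · refine intervalIntegral.integral_congr fun σ hσ => ?_
      rw [uIcc_of_le hr.1] at hσ
      rw [hXY (σ - τ) ⟨by linarith [hσ.1], by linarith [hσ.2, hr.2]⟩]

omit [MeasurableSpace U] in
/-- A trajectory can be taken bounded and right-continuous on the whole line. -/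
theorem IsTrajectory.exists_rc {t s : ℝ} {x : PathSpace d τ} {u : ℝ → U} {X : ℝ → E d}
    (h : IsTrajectory P s t x u X) (hts : t ≤ s) :
    ∃ Y, IsRC Y ∧ IsTrajectory P s t x u Y ∧ ∀ r ∈ Icc t s, Y r = X r := by
  have hc : Continuous (IccExtend hts ((Icc t s).domRestrict X)) :=
    (continuousOn_iff_continuous_domRestrict.1 h.cont).Icc_extend'
  obtain ⟨C, hC⟩ := isCompact_Icc.exists_bound_of_continuousOn h.cont
  have hrc : IsRC (IccExtend hts ((Icc t s).domRestrict X)) :=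
    IsRC.of_continuous ⟨C, fun r => hC _ (projIcc t s hts r).2⟩ hc
  have e : ∀ r ∈ Icc (t - τ) s, (if r < t then x.ev (r - t)
      else IccExtend hts ((Icc t s).domRestrict X) r) = X r := by
    intro r hr
    split_ifs with hrt
    · exact (h.past r ⟨hr.1, hrt.le⟩).symm
    · exact IccExtend_of_mem hts _ ⟨not_lt.1 hrt, hr.2⟩
  exact ⟨_, ((isRC_ev x).comp_sub t).ite hrc t, h.congr e hts,
    fun r hr => e r ⟨by linarith [hr.1, hτ.out], hr.2⟩⟩

/-- The mapping whose fixed points are the trajectories, without its continuity. -/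
def stateMap (P : Coefficients d U) (t : ℝ) (x : PathSpace d τ) (u : ℝ → U) (X : ℝ → E d)
    (s : ℝ) : E d :=
  x.ev 0 + (∫ σ in t..s, drift P τ u X σ) + ∫ σ in t..s, P.b σ (X (σ - τ))

theorem continuousOn_stateMap (hstate : StateHyp P τ T) (hP : CoefBound P τ T K) {t s : ℝ}
    (h0 : 0 ≤ t) (hts : t ≤ s) (hsT : s ≤ T) (x : PathSpace d τ) {u : ℝ → U}
    (hu : u ∈ controls t s) {X : ℝ → E d} (hX : IsRC X) :
    ContinuousOn (stateMap P t x u X) (Icc t s) := by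
  have key : ∀ f : ℝ → E d, IntervalIntegrable f volume t s →
      ContinuousOn (fun r => ∫ σ in t..r, f σ) (Icc t s) := by
    intro f hf
    have := intervalIntegral.continuousOn_primitive_interval (f := f) (μ := volume) (a := t) (b := s)
      (by
        rw [uIcc_of_le hts, integrableOn_Icc_iff_integrableOn_Ioc]
        exact (intervalIntegrable_iff_integrableOn_Ioc_of_le hts).1 hf)
    rwa [uIcc_of_le hts] at this
  exact (continuousOn_const.add (key _ (drift_integrable hstate hP hu hX h0 hsT le_rfl hts
    le_rfl))).add (key _ (delay_integrable hP hX h0 hts hsT))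

theorem integral_exp_le {l t s : ℝ} (hl : 0 < l) :
    ∫ σ in t..s, Real.exp (l * (σ - t)) ≤ Real.exp (l * (s - t)) / l := by
  have h : ∀ σ : ℝ, HasDerivAt (fun σ => Real.exp (l * (σ - t)) / l) (Real.exp (l * (σ - t))) σ := by
    intro σ
    refine ((((hasDerivAt_id σ).sub_const t).const_mul l).exp.div_const l).congr_deriv ?_
    rw [mul_one, mul_div_cancel_right₀ _ hl.ne']
    rfl
  rw [intervalIntegral.integral_eq_sub_of_hasDerivAt (fun σ _ => h σ)
    ((Continuous.intervalIntegrable (by fun_prop)) _ _)]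
  have : 0 ≤ Real.exp (l * (t - t)) / l := by positivity
  linarith

/-- Existence of trajectories, by the contraction principle for a weighted supremum norm. -/
theorem exists_trajectory (hstate : StateHyp P τ T) (hP : CoefBound P τ T K) {t s : ℝ}
    (h0 : 0 ≤ t) (hts : t ≤ s) (hsT : s ≤ T) (x : PathSpace d τ) {u : ℝ → U}
    (hu : u ∈ controls t s) : ∃ X, IsRC X ∧ IsTrajectory P s t x u X := by
  have hτ0 := hτ.out
  have hK := hP.one_le
  -- `K * (2 + K * τ)` bounds the integrand's Lipschitz constant for the running supremum; an
  -- exponential weight with twice this rate makes the contraction factor `1/2`.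
  set l : ℝ := 2 * (K * (2 + K * τ)) with hl
  have hM : 0 < K * (2 + K * τ) := by positivity
  have hlpos : 0 < l := by positivity
  let pr : ℝ → Icc t s := projIcc t s hts
  have hprc : Continuous pr := continuous_projIcc
  -- The unknown `Z` is the trajectory divided by the weight, so the weighted norm becomes the
  -- ordinary norm of continuous functions. The lift restores the weight, prepends the past and
  -- freezes the values beyond `s`.
  let lift : C(Icc t s, E d) → ℝ → E d := fun Z r =>
    if r < t then x.ev (r - t) else Real.exp (l * ((pr r : ℝ) - t)) • Z (pr r)
  have hexp : ∀ r, Real.exp (l * ((pr r : ℝ) - t)) ≤ Real.exp (l * (s - t)) := fun r =>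
    Real.exp_le_exp.2 (by have := (pr r).2.2; gcongr)
  have hlift : ∀ Z, IsRC (lift Z) := by
    intro Z
    refine ((isRC_ev x).comp_sub t).ite (IsRC.of_continuous
      ⟨Real.exp (l * (s - t)) * ‖Z‖, fun r => ?_⟩ (by fun_prop)) t
    rw [norm_smul, Real.norm_of_nonneg (Real.exp_pos _).le]
    exact mul_le_mul (hexp r) (Z.norm_coe_le_norm _) (norm_nonneg _) (Real.exp_pos _).le
  have hpr : ∀ r ∈ Icc t s, (pr r : ℝ) = r := fun r hr => by
    simp only [pr]; rw [projIcc_of_mem hts hr]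
  let Φ : C(Icc t s, E d) → C(Icc t s, E d) := fun Z =>
    ⟨fun r => Real.exp (-(l * ((r : ℝ) - t))) • stateMap P t x u (lift Z) r, by
      have := continuousOn_iff_continuous_domRestrict.1
        (continuousOn_stateMap hstate hP h0 hts hsT x hu (hlift Z))
      have h2 : Continuous fun r : Icc t s => stateMap P t x u (lift Z) r := this
      fun_prop⟩
  have hcontr : ContractingWith (1 / 2) Φ := by
    refine ⟨by
      rw [← NNReal.coe_lt_coe]; norm_num, LipschitzWith.of_dist_le_mul fun Z W => ?_⟩
    rw [ContinuousMap.dist_le (by positivity)]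
    intro r
    set δ := dist Z W with hδ
    have hδ0 : 0 ≤ δ := dist_nonneg
    have hD : ∀ c, ∀ σ, c ≤ σ → σ ∈ Icc t s → ‖lift Z c - lift W c‖ ≤ Real.exp (l * (σ - t)) * δ := by
      intro c σ hcσ hσ
      by_cases hc : c < t
      · simp only [lift, if_pos hc, sub_self, norm_zero]; positivity
      · simp only [lift, if_neg hc]
        rw [← smul_sub, norm_smul, Real.norm_of_nonneg (Real.exp_pos _).le,
          hpr c ⟨not_lt.1 hc, hcσ.trans hσ.2⟩, ← dist_eq_norm]
        refine mul_le_mul (Real.exp_le_exp.2 (by gcongr)) (ContinuousMap.dist_apply_le_dist _)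
          dist_nonneg (Real.exp_pos _).le
    have i1 := fun Z => drift_integrable hstate hP hu (hlift Z) h0 hsT le_rfl r.2.1 r.2.2
    have i2 := fun Z => delay_integrable hP (hlift Z) h0 r.2.1 (r.2.2.trans hsT)
    have hexpi : IntervalIntegrable (fun σ => Real.exp (l * (σ - t))) volume t r :=
      Continuous.intervalIntegrable (by fun_prop) _ _
    have hdiff : ‖stateMap P t x u (lift Z) r - stateMap P t x u (lift W) r‖
        ≤ Real.exp (l * (r - t)) * (δ / 2) := by
      have e : stateMap P t x u (lift Z) r - stateMap P t x u (lift W) r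
          = ∫ σ in t..(r : ℝ), ((drift P τ u (lift Z) σ - drift P τ u (lift W) σ)
            + (P.b σ (lift Z (σ - τ)) - P.b σ (lift W (σ - τ)))) := by
        rw [intervalIntegral.integral_add ((i1 Z).sub (i1 W)) ((i2 Z).sub (i2 W)),
          intervalIntegral.integral_sub (i1 Z) (i1 W), intervalIntegral.integral_sub (i2 Z) (i2 W)]
        simp only [stateMap]
        abel
      rw [e]
      calc _ ≤ ∫ σ in t..(r : ℝ), (K * (2 + K * τ) * δ) * Real.exp (l * (σ - t)) := by
            refine intervalIntegral.norm_integral_le_of_norm_le r.2.1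
              (Eventually.of_forall fun σ hσ => ?_) (hexpi.const_mul _)
            have hσs : σ ∈ Icc t s := ⟨hσ.1.le, hσ.2.trans r.2.2⟩
            have hσT : σ ∈ Icc 0 T := ⟨h0.trans hσs.1, hσs.2.trans hsT⟩
            set e := Real.exp (l * (σ - t)) with he
            have b1 : ‖lift Z σ - lift W σ‖ ≤ e * δ := hD σ σ le_rfl hσs
            have b2 : ‖lift Z (σ - τ) - lift W (σ - τ)‖ ≤ e * δ := hD _ σ (by linarith) hσs
            have b3 : |(delayInner τ P.a fun θ => lift Z (σ + θ))
                - delayInner τ P.a fun θ => lift W (σ + θ)| ≤ K * (τ * (e * δ)) := by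
              rw [delayInner_sub hP (((hlift Z).comp_add σ).intervalIntegrable _ _)
                (((hlift W).comp_add σ).intervalIntegrable _ _)]
              refine (abs_delayInner_le hP (((hlift Z).sub (hlift W)).comp_add σ
                |>.intervalIntegrable _ _)).trans ?_
              gcongr
              have : ∫ θ in (-τ)..0, ‖lift Z (σ + θ) - lift W (σ + θ)‖ ≤ ∫ θ in (-τ)..0, e * δ :=
                intervalIntegral.integral_mono_on neg_le_zero'
                  ((((hlift Z).sub (hlift W)).comp_add σ).intervalIntegrable _ _).norm
                  intervalIntegrable_const fun θ hθ => hD _ σ (by linarith [hθ.2]) hσs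
              simpa [mul_left_comm] using this
            have c1 : ‖drift P τ u (lift Z) σ - drift P τ u (lift W) σ‖
                ≤ K * (0 + e * δ + K * (τ * (e * δ))) := by
              refine (hP.F_lip σ hσT σ hσT _ _ _ _ _).trans ?_
              rw [sub_self, abs_zero]
              gcongr
            have c2 : ‖P.b σ (lift Z (σ - τ)) - P.b σ (lift W (σ - τ))‖ ≤ K * (e * δ) := by
              rw [← map_sub]
              refine ((P.b σ).le_opNorm _).trans ?_
              have := hP.b_le σ hσT
              gcongr
            calc _ ≤ _ := norm_add_le _ _
              _ ≤ _ := add_le_add c1 c2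
              _ = _ := by ring
        _ = (K * (2 + K * τ) * δ) * ∫ σ in t..(r : ℝ), Real.exp (l * (σ - t)) :=
            intervalIntegral.integral_const_mul _ _
        _ ≤ (K * (2 + K * τ) * δ) * (Real.exp (l * (r - t)) / l) := by
            gcongr
            exact integral_exp_le hlpos
        _ = _ := by rw [hl]; field_simp
    have : dist (Φ Z r) (Φ W r) = Real.exp (-(l * ((r : ℝ) - t))) *
        ‖stateMap P t x u (lift Z) r - stateMap P t x u (lift W) r‖ := by
      rw [dist_eq_norm]
      simp only [Φ, ContinuousMap.coe_mk]
      rw [← smul_sub, norm_smul, Real.norm_of_nonneg (Real.exp_pos _).le]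
    rw [this]
    calc _ ≤ Real.exp (-(l * ((r : ℝ) - t))) * (Real.exp (l * (r - t)) * (δ / 2)) := by gcongr
      _ = δ / 2 := by rw [← mul_assoc, ← Real.exp_add]; simp
      _ = _ := by norm_num; ring
  obtain ⟨Z, hZ⟩ : ∃ Z, Φ Z = Z := ⟨_, hcontr.fixedPoint_isFixedPt⟩
  have hfix : ∀ r ∈ Icc t s, lift Z r = stateMap P t x u (lift Z) r := by
    intro r hr
    have h1 : lift Z r = Real.exp (l * (r - t)) • Z ⟨r, hr⟩ := by
      simp only [lift, if_neg (not_lt.2 hr.1), hpr r hr]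
      rw [show pr r = ⟨r, hr⟩ from projIcc_of_mem hts hr]
    have h2 : Z ⟨r, hr⟩ = Real.exp (-(l * (r - t))) • stateMap P t x u (lift Z) r := by
      conv_lhs => rw [← hZ]
      rfl
    rw [h1, h2, smul_smul, ← Real.exp_add]
    simp
  refine ⟨lift Z, hlift Z, ?_, ?_, ?_⟩
  · exact (continuousOn_stateMap hstate hP h0 hts hsT x hu (hlift Z)).congr hfix
  · intro r hr
    rcases hr.2.eq_or_lt with rfl | hrt
    · rw [hfix r ⟨le_rfl, hts⟩]
      simp [stateMap]
    · simp only [lift, if_pos hrt]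
  · intro r hr
    exact hfix r hr

end Trajectories

/-! ### A priori bounds and continuous dependence of trajectories. -/

section Estimates

variable {d : ℕ} {τ T K : ℝ} [hτ : Fact (0 < τ)] {U : Type*} {P : Coefficients d U}

/-- `1 + |x(0)| + |x|_H`. -/
def size (x : PathSpace d τ) : ℝ := 1 + ‖x.ev 0‖ + ‖x.toH‖

theorem one_le_size (x : PathSpace d τ) : 1 ≤ size x := by
  unfold size; linarith [norm_nonneg (x.ev 0), norm_nonneg x.toH]

theorem norm_ev_zero_le_size (x : PathSpace d τ) : ‖x.ev 0‖ ≤ size x := by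
  unfold size; linarith [norm_nonneg (x.ev 0), norm_nonneg x.toH]

theorem norm_toH_le_size (x : PathSpace d τ) : ‖x.toH‖ ≤ size x := by
  unfold size; linarith [norm_nonneg (x.ev 0), norm_nonneg x.toH]

theorem seg_toH_sq {X : ℝ → E d} (hX : IsRC X) (s : ℝ) :
    ‖(seg X s : PathSpace d τ).toH‖ ^ 2 = ∫ r in (s - τ)..s, ‖X r‖ ^ 2 := by
  rw [norm_toH_sq]
  have : ∫ θ in (-τ)..0, ‖(seg X s : PathSpace d τ).ev θ‖ ^ 2 = ∫ θ in (-τ)..0, ‖X (s + θ)‖ ^ 2 := by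
    refine intervalIntegral.integral_congr fun θ hθ => ?_
    rw [uIcc_of_le neg_le_zero'] at hθ
    simp only [seg_ev hX s hθ]
  rw [this, intervalIntegral.integral_comp_add_left (fun r => ‖X r‖ ^ 2)]
  simp [sub_eq_add_neg]

theorem seg_integral_le {X : ℝ → E d} (hX : IsRC X) (s : ℝ) :
    ∫ r in (s - τ)..s, ‖X r‖ ≤ √τ * ‖(seg X s : PathSpace d τ).toH‖ := by
  have := sqrt_integral_bound hX (a := s - τ) (b := s) (by linarith [hτ.out])
  rwa [← seg_toH_sq hX s, Real.sqrt_sq (norm_nonneg _), sub_sub_cancel] at this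

theorem IsTrajectory.seg_start {t s : ℝ} {x : PathSpace d τ} {u : ℝ → U} {X : ℝ → E d}
    (h : IsTrajectory P s t x u X) (hX : IsRC X) : seg X t = x := by
  refine path_ext fun θ hθ => ?_
  rw [seg_ev hX t hθ, h.past (t + θ) ⟨by linarith [hθ.1], by linarith [hθ.2]⟩]
  congr 1; ring

variable [MeasurableSpace U]

/-- Gronwall applies because the past enters the growth bound only through its `L¹` norm, hence
through the norm of `H`. The last bound has the rate `√(r - t)` rather than `r - t`: the delayed
values lie in the past, where only an `L²` bound is available. This is the origin of the square root
in time in the uniqueness class. -/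
theorem trajectory_bounds (hT : 0 < T) (hP : CoefBound P τ T K) :
    ∃ C ≥ 1, ∀ (t s : ℝ) (x : PathSpace d τ) (u : ℝ → U) (X : ℝ → E d), 0 ≤ t → t ≤ s → s ≤ T →
      u ∈ controls t s → IsRC X → IsTrajectory P s t x u X → ∀ r ∈ Icc t s,
        ‖X r‖ ≤ C * size x ∧ |delayInner τ P.a fun θ => X (r + θ)| ≤ C * size x ∧
        ‖(seg X r : PathSpace d τ).toH‖ ≤ C * size x ∧
        ‖X r - x.ev 0‖ ≤ C * size x * √(r - t) := by
  have hτ0 := hτ.out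
  have hK := hP.one_le
  have hK0 : 0 < K := by linarith
  set M := K * (2 + K * T) with hM
  have hM0 : 0 < M := by positivity
  set C1 := (1 + K * T + M * √τ) * Real.exp (M * T) with hC1
  have hC10 : 0 < C1 := by positivity
  set C2 := 1 + √T * C1 with hC2
  have hC20 : 0 < C2 := by positivity
  set C3 := K * (√τ * C2) with hC3
  have hC30 : 0 < C3 := by positivity
  set C4 := √T * (K * (1 + C1 + C3)) + K * C2 with hC4
  have hC40 : 0 < C4 := by positivity
  refine ⟨1 + C1 + C2 + C3 + C4, by linarith, fun t s x u X h0 hts hsT hu hX htr => ?_⟩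
  have hn := one_le_size x
  set n := size x with hn'
  have hseg : seg X t = x := htr.seg_start hX
  have hiX := hX.intervalIntegrable
  have hp : ∫ r in (t - τ)..t, ‖X r‖ ≤ √τ * n := by
    have := seg_integral_le (τ := τ) hX t
    rw [hseg] at this
    exact this.trans (by gcongr; exact norm_toH_le_size x)
  have hp2 : ∫ r in (t - τ)..t, ‖X r‖ ^ 2 ≤ n ^ 2 := by
    have := seg_toH_sq (τ := τ) hX t
    rw [hseg] at this
    rw [← this]
    gcongr
    exact norm_toH_le_size x
  have hI : ∀ r, ∫ σ in (t - τ)..r, ‖X σ‖ = (∫ σ in (t - τ)..t, ‖X σ‖) + ∫ σ in t..r, ‖X σ‖ :=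
    fun r => (intervalIntegral.integral_add_adjacent_intervals (hiX _ _).norm (hiX _ _).norm).symm
  have hinn : ∀ p q : ℝ, p ≤ q → 0 ≤ ∫ σ in p..q, ‖X σ‖ := fun p q h =>
    intervalIntegral.integral_nonneg h fun _ _ => norm_nonneg _
  have hmono : ∀ p q a b : ℝ, a ≤ p → p ≤ q → q ≤ b → ∫ σ in p..q, ‖X σ‖ ≤ ∫ σ in a..b, ‖X σ‖ :=
    fun p q a b h1 h2 h3 => intervalIntegral.integral_mono_interval h1 h2 h3
      (Eventually.of_forall fun _ => norm_nonneg _) (hiX _ _).norm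
  have hmemT : ∀ r ∈ Icc t s, r ∈ Icc 0 T := fun r hr => ⟨h0.trans hr.1, hr.2.trans hsT⟩
  have hdelay : ∀ r ∈ Icc t s, ‖∫ σ in t..r, P.b σ (X (σ - τ))‖
      ≤ K * ∫ σ in (t - τ)..(r - τ), ‖X σ‖ := by
    intro r hr
    have e : ∫ σ in (t - τ)..(r - τ), ‖X σ‖ = ∫ σ in t..r, ‖X (σ - τ)‖ := by
      rw [intervalIntegral.integral_comp_sub_right (fun σ => ‖X σ‖)]
    rw [e, ← intervalIntegral.integral_const_mul]
    refine intervalIntegral.norm_integral_le_of_norm_le hr.1 (Eventually.of_forall fun σ hσ => ?_)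
      (((hX.comp_sub τ).intervalIntegrable _ _).norm.const_mul K)
    exact ((P.b σ).le_opNorm _).trans (mul_le_mul_of_nonneg_right
      (hP.b_le σ (hmemT σ ⟨hσ.1.le, hσ.2.trans hr.2⟩)) (norm_nonneg _))
  have hgrow : ∀ r ∈ Icc t s, ‖X r‖ ≤ C1 * n := by
    have key := gronwall_integral (g := fun r => ‖X r‖) (A := (1 + K * T + M * √τ) * n) (M := M)
      hts htr.cont.norm (fun _ _ => norm_nonneg _) hM0.le (fun r hr => ?_)
    · intro r hr
      refine (key r hr).trans ?_
      rw [hC1, mul_right_comm]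
      have : r - t ≤ T := by linarith [hr.2]
      gcongr
    · have hIr : 0 ≤ ∫ σ in (t - τ)..r, ‖X σ‖ := hinn _ _ (by linarith [hr.1])
      have hrt : r - t ≤ T := by linarith [hr.2]
      have hrt0 : 0 ≤ r - t := by linarith [hr.1]
      have b1 : ‖∫ σ in t..r, drift P τ u X σ‖
          ≤ K * (T + (∫ σ in t..r, ‖X σ‖) + T * (K * ∫ σ in (t - τ)..r, ‖X σ‖)) := by
        calc _ ≤ ∫ σ in t..r, K * (1 + ‖X σ‖ + K * ∫ σ in (t - τ)..r, ‖X σ‖) := by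
              refine intervalIntegral.norm_integral_le_of_norm_le hr.1
                (Eventually.of_forall fun σ hσ => ?_)
                (((intervalIntegrable_const.add (hiX _ _).norm).add
                  intervalIntegrable_const).const_mul K)
              refine (hP.F_growth σ (hmemT σ ⟨hσ.1.le, hσ.2.trans hr.2⟩) _ _ _).trans ?_
              have := abs_delayInner_shift_le hP hX σ
              have h2 := hmono (σ - τ) σ (t - τ) r (by linarith [hσ.1]) (by linarith) hσ.2
              have h3 : K * ∫ σ in (σ - τ)..σ, ‖X σ‖ ≤ K * ∫ σ in (t - τ)..r, ‖X σ‖ := by gcongr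
              gcongr
              linarith
          _ = K * ((r - t) + (∫ σ in t..r, ‖X σ‖)
                + (r - t) * (K * ∫ σ in (t - τ)..r, ‖X σ‖)) := by
              rw [intervalIntegral.integral_const_mul, intervalIntegral.integral_add
                (intervalIntegrable_const.add (hiX _ _).norm) intervalIntegrable_const,
                intervalIntegral.integral_add intervalIntegrable_const (hiX _ _).norm]
              simp only [intervalIntegral.integral_const, smul_eq_mul, mul_one]
          _ ≤ _ := by gcongr
      have b2 := (hdelay r hr).trans (mul_le_mul_of_nonneg_left
        (hmono (t - τ) (r - τ) (t - τ) r le_rfl (by linarith [hr.1]) (by linarith)) hK0.le)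
      have b3 : ‖X r‖ ≤ ‖x.ev 0‖ + ‖∫ σ in t..r, drift P τ u X σ‖
          + ‖∫ σ in t..r, P.b σ (X (σ - τ))‖ := by
        rw [htr.eqn r hr]
        exact norm_add₃_le
      have h5 := norm_ev_zero_le_size x
      have hJ := hinn _ _ hr.1
      have hI' := hI r
      set J := ∫ σ in t..r, ‖X σ‖
      set I := ∫ σ in (t - τ)..r, ‖X σ‖
      have hIn : I ≤ √τ * n + J := by linarith
      have hJI : J ≤ I := by
        have := hinn (t - τ) t (by linarith)
        linarith
      have : ‖X r‖ ≤ n + K * T + M * I := by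
        have e : K * (T + J + T * (K * I)) ≤ K * (T + I + T * (K * I)) := by gcongr
        rw [hM]
        linarith
      calc ‖X r‖ ≤ n + K * T + M * I := this
        _ ≤ n + K * T * n + M * (√τ * n + J) := by
            have : K * T ≤ K * T * n := le_mul_of_one_le_right (by positivity) hn
            gcongr
        _ = _ := by ring
  have hsq : ∀ r ∈ Icc t s, ∫ σ in (t - τ)..r, ‖X σ‖ ^ 2 ≤ (C2 * n) ^ 2 := by
    intro r hr
    rw [← intervalIntegral.integral_add_adjacent_intervals (hX.sq_intervalIntegrable (t - τ) t)
      (hX.sq_intervalIntegrable t r)]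
    have : ∫ σ in t..r, ‖X σ‖ ^ 2 ≤ ∫ σ in t..r, (C1 * n) ^ 2 :=
      intervalIntegral.integral_mono_on hr.1 (hX.sq_intervalIntegrable t r)
        intervalIntegrable_const fun σ hσ =>
          pow_le_pow_left₀ (norm_nonneg _) (hgrow σ ⟨hσ.1, hσ.2.trans hr.2⟩) 2
    rw [intervalIntegral.integral_const, smul_eq_mul] at this
    have h2 : (r - t) * (C1 * n) ^ 2 ≤ T * (C1 * n) ^ 2 := by
      gcongr; linarith [hr.2]
    have h3 : √T ^ 2 = T := Real.sq_sqrt hT.le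
    have h4 : (C2 * n) ^ 2 = n ^ 2 + 2 * √T * C1 * n ^ 2 + √T ^ 2 * (C1 * n) ^ 2 := by
      rw [hC2]; ring
    have h5 : 0 ≤ 2 * √T * C1 * n ^ 2 := by positivity
    rw [h4, h3]
    linarith
  have hseg2 : ∀ r ∈ Icc t s, ‖(seg X r : PathSpace d τ).toH‖ ≤ C2 * n := by
    intro r hr
    refine abs_le_of_sq_le_sq' ?_ (by positivity) |>.2
    rw [seg_toH_sq hX]
    exact (integral_sq_mono hX (by linarith [hr.1]) (by linarith) le_rfl).trans (hsq r hr)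
  have hinner : ∀ r ∈ Icc t s, |delayInner τ P.a fun θ => X (r + θ)| ≤ C3 * n := by
    intro r hr
    calc _ ≤ _ := abs_delayInner_shift_le hP hX r
      _ ≤ K * (√τ * (C2 * n)) := by
          gcongr
          exact (seg_integral_le hX r).trans (by gcongr; exact hseg2 r hr)
      _ = _ := by rw [hC3]; ring
  intro r hr
  have hrt0 : 0 ≤ r - t := by linarith [hr.1]
  refine ⟨(hgrow r hr).trans (by gcongr; linarith), (hinner r hr).trans (by gcongr; linarith),
    (hseg2 r hr).trans (by gcongr; linarith), ?_⟩
  have c1 : ‖∫ σ in t..r, drift P τ u X σ‖ ≤ √T * (K * (1 + C1 + C3)) * n * √(r - t) := by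
    have := intervalIntegral.norm_integral_le_of_norm_le_const (f := drift P τ u X) (a := t) (b := r)
      (C := K * (1 + C1 + C3) * n) (fun σ hσ => by
        rw [uIoc_of_le hr.1] at hσ
        have hσ' : σ ∈ Icc t s := ⟨hσ.1.le, hσ.2.trans hr.2⟩
        refine (hP.F_growth σ (hmemT σ hσ') _ _ _).trans ?_
        have h1 := hgrow σ hσ'
        have h2 := hinner σ hσ'
        rw [mul_assoc]
        gcongr
        linarith)
    refine this.trans ?_
    rw [abs_of_nonneg hrt0]
    have : r - t ≤ √T * √(r - t) := by
      calc r - t = √(r - t) * √(r - t) := (Real.mul_self_sqrt hrt0).symm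
        _ ≤ _ := by gcongr; linarith [hr.2]
    calc _ ≤ K * (1 + C1 + C3) * n * (√T * √(r - t)) := by gcongr
      _ = _ := by ring
  have c2 : ‖∫ σ in t..r, P.b σ (X (σ - τ))‖ ≤ K * C2 * n * √(r - t) := by
    refine (hdelay r hr).trans ?_
    have h1 := sqrt_integral_bound hX (a := t - τ) (b := r - τ) (by linarith)
    have h2 : √(∫ σ in (t - τ)..(r - τ), ‖X σ‖ ^ 2) ≤ C2 * n := by
      refine Real.sqrt_le_iff.2 ⟨by positivity, ?_⟩
      exact (integral_sq_mono hX le_rfl (by linarith) (by linarith)).trans (hsq r hr)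
    rw [sub_sub_sub_cancel_right] at h1
    calc _ ≤ K * (√(r - t) * (C2 * n)) := by gcongr; exact h1.trans (by gcongr)
      _ = _ := by ring
  have c3 : ‖X r - x.ev 0‖ ≤ ‖∫ σ in t..r, drift P τ u X σ‖
      + ‖∫ σ in t..r, P.b σ (X (σ - τ))‖ := by
    have : X r - x.ev 0 = (∫ σ in t..r, drift P τ u X σ) + ∫ σ in t..r, P.b σ (X (σ - τ)) := by
      rw [htr.eqn r hr, add_assoc, add_sub_cancel_left]; rfl
    rw [this]
    exact norm_add_le _ _
  calc _ ≤ C4 * n * √(r - t) := by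
        rw [hC4, add_mul, add_mul]
        exact c3.trans (add_le_add c1 c2)
    _ ≤ _ := by gcongr; linarith

/-- By `a_weak` and `b_weak` the difference of the two solutions enters the delay terms only through
its primitives. On the past these are bounded by the weak distance, afterwards by the running
integral of the difference, and Gronwall closes the estimate. -/
theorem trajectory_difference (hT : 0 < T) (hstate : StateHyp P τ T) (hP : CoefBound P τ T K) :
    ∃ C ≥ 1, ∀ (t s : ℝ) (x y : PathSpace d τ) (u : ℝ → U) (X Y : ℝ → E d), 0 ≤ t → t ≤ s → s ≤ T →
      u ∈ controls t s → IsRC X → IsRC Y → IsTrajectory P s t x u X → IsTrajectory P s t y u Y →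
      ∀ r ∈ Icc t s, ‖X r - Y r‖ ≤ C * (‖x.ev 0 - y.ev 0‖ + weakDist x y) := by
  have hτ0 := hτ.out
  have hK := hP.one_le
  have hK0 : 0 < K := by linarith
  set M := 3 * K + 2 * K ^ 2 * T with hM
  have hM0 : 0 < M := by positivity
  have hexp : 1 ≤ Real.exp (M * T) := Real.one_le_exp (by positivity)
  refine ⟨(1 + M) * Real.exp (M * T), by nlinarith, fun t s x y u X Y h0 hts hsT hu hX hY hx hy => ?_⟩
  set D : ℝ → E d := fun r => X r - Y r with hD
  have hDrc : IsRC D := hX.sub hY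
  have hiD := hDrc.intervalIntegrable
  set W := weakDist x y with hW
  have hW0 : 0 ≤ W := weakDist_nonneg x y
  have hmemT : ∀ r ∈ Icc t s, r ∈ Icc 0 T := fun r hr => ⟨h0.trans hr.1, hr.2.trans hsT⟩
  have hJnn : ∀ r ∈ Icc t s, 0 ≤ ∫ σ in t..r, ‖D σ‖ := fun r hr =>
    intervalIntegral.integral_nonneg hr.1 fun _ _ => norm_nonneg _
  have hΓ : ∀ r ∈ Icc t s, ∀ z ∈ Icc (t - τ) r, ‖∫ σ in t..z, D σ‖ ≤ W + ∫ σ in t..r, ‖D σ‖ := by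
    intro r hr z hz
    rcases le_total z t with hzt | hzt
    · have e : ∫ σ in z..t, D σ = ∫ θ in (z - t)..0, (x.ev θ - y.ev θ) := by
        have : ∫ σ in z..t, D σ = ∫ σ in z..t, (x.ev (σ - t) - y.ev (σ - t)) := by
          refine intervalIntegral.integral_congr fun σ hσ => ?_
          rw [uIcc_of_le hzt] at hσ
          simp only [hD, hx.past σ ⟨hz.1.trans hσ.1, hσ.2⟩, hy.past σ ⟨hz.1.trans hσ.1, hσ.2⟩]
        rw [this, intervalIntegral.integral_comp_sub_right (fun θ => x.ev θ - y.ev θ), sub_self]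
      rw [intervalIntegral.integral_symm, norm_neg, e]
      have := le_weakDist x y (l := z - t) ⟨by linarith [hz.1], by linarith⟩
      linarith [hJnn r hr]
    · have h1 := intervalIntegral.norm_integral_le_integral_norm (f := D) (μ := volume) hzt
      have h2 : ∫ σ in t..z, ‖D σ‖ ≤ ∫ σ in t..r, ‖D σ‖ :=
        intervalIntegral.integral_mono_interval le_rfl hzt hz.2
          (Eventually.of_forall fun _ => norm_nonneg _) (hiD _ _).norm
      linarith
  -- An integral between two arbitrary times is a difference of two integrals from `t`, whence the
  -- factor `2`.
  have hΓ2 : ∀ r ∈ Icc t s, ∀ z ∈ Icc (t - τ) r, ∀ z' ∈ Icc (t - τ) r,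
      ‖∫ σ in z..z', D σ‖ ≤ 2 * (W + ∫ σ in t..r, ‖D σ‖) := by
    intro r hr z hz z' hz'
    rw [← intervalIntegral.integral_interval_sub_left (hiD t z') (hiD t z)]
    calc _ ≤ _ := norm_sub_le _ _
      _ ≤ _ := by linarith [hΓ r hr z hz, hΓ r hr z' hz']
  have key := gronwall_integral (g := fun r => ‖D r‖) (A := (1 + M) * (‖x.ev 0 - y.ev 0‖ + W))
    (M := M) hts (hx.cont.sub hy.cont).norm (fun _ _ => norm_nonneg _) hM0.le (fun r hr => ?_)
  · intro r hr
    refine (key r hr).trans ?_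
    rw [mul_right_comm]
    have : r - t ≤ T := by linarith [hr.2]
    gcongr
  · have i1 := drift_integrable hstate hP hu hX h0 hsT le_rfl hr.1 hr.2
    have i2 := drift_integrable hstate hP hu hY h0 hsT le_rfl hr.1 hr.2
    have j1 := delay_integrable hP hX h0 hr.1 (hr.2.trans hsT)
    have j2 := delay_integrable hP hY h0 hr.1 (hr.2.trans hsT)
    have e : D r = (x.ev 0 - y.ev 0) + (∫ σ in t..r, (drift P τ u X σ - drift P τ u Y σ))
        + ∫ σ in t..r, P.b σ (D (σ - τ)) := by
      have e3 : (fun σ => P.b σ (D (σ - τ))) = fun σ => P.b σ (X (σ - τ)) - P.b σ (Y (σ - τ)) := by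
        funext σ; rw [hD, ← map_sub]
      rw [e3, intervalIntegral.integral_sub i1 i2, intervalIntegral.integral_sub j1 j2]
      simp only [hD]
      rw [hx.eqn r hr, hy.eqn r hr]
      simp only [drift]
      abel
    have hJ := hJnn r hr
    have hrt : r - t ≤ T := by linarith [hr.2]
    have hrt0 : 0 ≤ r - t := by linarith [hr.1]
    set J := ∫ σ in t..r, ‖D σ‖ with hJdef
    have b1 : ‖∫ σ in t..r, (drift P τ u X σ - drift P τ u Y σ)‖
        ≤ K * J + T * (K * (K * (2 * (W + J)))) := by
      calc _ ≤ ∫ σ in t..r, (K * ‖D σ‖ + K * (K * (2 * (W + J)))) := by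
            refine intervalIntegral.norm_integral_le_of_norm_le hr.1
              (Eventually.of_forall fun σ hσ => ?_)
              (((hiD _ _).norm.const_mul K).add intervalIntegrable_const)
            have hσ' : σ ∈ Icc t s := ⟨hσ.1.le, hσ.2.trans hr.2⟩
            refine (hP.F_lip σ (hmemT σ hσ') σ (hmemT σ hσ') _ _ _ _ _).trans ?_
            rw [delayInner_sub hP ((hX.comp_add σ).intervalIntegrable _ _)
                ((hY.comp_add σ).intervalIntegrable _ _), sub_self, abs_zero, zero_add, mul_add]
            gcongr
            refine hP.a_weak _ _ ((hDrc.comp_add σ).intervalIntegrable _ _) fun z hz => ?_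
            have e4 : ∫ θ in z..0, (X (σ + θ) - Y (σ + θ)) = ∫ ρ in (σ + z)..σ, D ρ := by
              rw [intervalIntegral.integral_comp_add_left (fun ρ => X ρ - Y ρ)]
              simp [hD]
            rw [e4]
            exact hΓ2 r hr _ ⟨by linarith [hz.1, hσ.1], by linarith [hz.2, hσ.2]⟩ _
              ⟨by linarith [hσ.1], hσ.2⟩
        _ = K * J + (r - t) * (K * (K * (2 * (W + J)))) := by
            rw [intervalIntegral.integral_add ((hiD _ _).norm.const_mul K) intervalIntegrable_const,
              intervalIntegral.integral_const_mul]
            simp only [intervalIntegral.integral_const, smul_eq_mul, ← hJdef]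
        _ ≤ _ := by gcongr
    have b2 : ‖∫ σ in t..r, P.b σ (D (σ - τ))‖ ≤ K * (2 * (W + J)) := by
      refine hP.b_weak t r h0 hr.1 (hr.2.trans hsT) _ _
        ((hDrc.comp_sub τ).intervalIntegrable _ _) fun z hz => ?_
      rw [intervalIntegral.integral_comp_sub_right D]
      exact hΓ2 r hr _ ⟨by linarith [hz.1], by linarith [hz.2]⟩ _ ⟨by linarith [hr.1], by linarith⟩
    change ‖D r‖ ≤ _
    have b3 : ‖D r‖ ≤ ‖x.ev 0 - y.ev 0‖ + ‖∫ σ in t..r, (drift P τ u X σ - drift P τ u Y σ)‖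
        + ‖∫ σ in t..r, P.b σ (D (σ - τ))‖ := by
      rw [e]; exact norm_add₃_le
    have hδ := norm_nonneg (x.ev 0 - y.ev 0)
    have e5 : (1 + M) * (‖x.ev 0 - y.ev 0‖ + W) + M * J
        - (‖x.ev 0 - y.ev 0‖ + (K * J + T * (K * (K * (2 * (W + J))))) + K * (2 * (W + J)))
        = M * ‖x.ev 0 - y.ev 0‖ + W + K * W := by
      rw [hM]; ring
    have e6 : 0 ≤ M * ‖x.ev 0 - y.ev 0‖ + W + K * W := by positivity
    linarith

end Estimates

/-! ### Dynamic programming and regularity of the value function. -/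

section Value

variable {d : ℕ} {τ T K : ℝ} [hτ : Fact (0 < τ)] {U : Type*} {P : Coefficients d U}

theorem IsTrajectory.mono {t r s : ℝ} {x : PathSpace d τ} {u : ℝ → U} {X : ℝ → E d}
    (h : IsTrajectory P s t x u X) (hrs : r ≤ s) : IsTrajectory P r t x u X :=
  ⟨h.cont.mono (Icc_subset_Icc_right hrs), h.past, fun z hz => h.eqn z ⟨hz.1, hz.2.trans hrs⟩⟩

/-- The delay causes no conflict at time `r` because the second trajectory starts from the whole
segment of the first. This is the pasting step of dynamic programming. -/
theorem IsTrajectory.glue {t r s : ℝ} {x : PathSpace d τ} {u v : ℝ → U} {X Y : ℝ → E d}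
    (htr : t ≤ r) (hX : IsRC X) (hx : IsTrajectory P r t x u X)
    (hy : IsTrajectory P s r (seg X r : PathSpace d τ) v Y)
    (i1 : IntervalIntegrable (drift P τ u X) volume t r)
    (i2 : ∀ z ∈ Icc r s, IntervalIntegrable (drift P τ v Y) volume r z)
    (j1 : IntervalIntegrable (fun σ => P.b σ (X (σ - τ))) volume t r)
    (j2 : ∀ z ∈ Icc r s, IntervalIntegrable (fun σ => P.b σ (Y (σ - τ))) volume r z) :
    IsTrajectory P s t x (fun z => if z ≤ r then u z else v z)
      (fun z => if z ≤ r then X z else Y z) := by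
  have hτ0 := hτ.out
  -- On this window either trajectory describes the pasted one, so every delay term after `r` can be
  -- written with `Y` alone.
  have hXY : ∀ z ∈ Icc (r - τ) r, Y z = X z := fun z hz => by
    rw [hy.past z hz, seg_ev hX r ⟨by linarith [hz.1], by linarith [hz.2]⟩]
    congr 1; ring
  set w : ℝ → U := fun z => if z ≤ r then u z else v z with hw
  set Z : ℝ → E d := fun z => if z ≤ r then X z else Y z with hZ
  have hZX : ∀ z ≤ r, Z z = X z := fun z hz => if_pos hz
  have hZY : ∀ z, r - τ ≤ z → Z z = Y z := fun z hz => by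
    by_cases h : z ≤ r
    · rw [hZX z h, hXY z ⟨hz, h⟩]
    · exact if_neg h
  have d1 : ∀ σ ≤ r, drift P τ w Z σ = drift P τ u X σ := by
    intro σ hσ
    unfold drift
    rw [hZX σ hσ, delayInner_congr P.a fun θ hθ => hZX (σ + θ) (by linarith [hθ.2])]
    simp only [hw, if_pos hσ]
  have d2 : ∀ σ, r < σ → drift P τ w Z σ = drift P τ v Y σ := by
    intro σ hσ
    unfold drift
    rw [hZY σ (by linarith), delayInner_congr P.a fun θ hθ => hZY (σ + θ) (by linarith [hθ.1])]
    simp only [hw, if_neg (not_le.2 hσ)]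
  have e1 : ∀ z, t ≤ z → z ≤ r → ∫ σ in t..z, drift P τ w Z σ = ∫ σ in t..z, drift P τ u X σ :=
    fun z h1 h2 => intervalIntegral.integral_congr fun σ hσ => by
      rw [uIcc_of_le h1] at hσ
      exact d1 σ (hσ.2.trans h2)
  have e2 : ∀ z, r ≤ z → ∫ σ in r..z, drift P τ w Z σ = ∫ σ in r..z, drift P τ v Y σ := by
    intro z hz
    rw [intervalIntegral.integral_of_le hz, intervalIntegral.integral_of_le hz]
    exact setIntegral_congr_fun measurableSet_Ioc fun σ hσ => d2 σ hσ.1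
  have e3 : ∀ z, t ≤ z → z ≤ r →
      ∫ σ in t..z, P.b σ (Z (σ - τ)) = ∫ σ in t..z, P.b σ (X (σ - τ)) :=
    fun z h1 h2 => intervalIntegral.integral_congr fun σ hσ => by
      rw [uIcc_of_le h1] at hσ
      simp only [hZX (σ - τ) (by linarith [hσ.2])]
  have e4 : ∀ z, r ≤ z → ∫ σ in r..z, P.b σ (Z (σ - τ)) = ∫ σ in r..z, P.b σ (Y (σ - τ)) :=
    fun z h1 => intervalIntegral.integral_congr fun σ hσ => by
      rw [uIcc_of_le h1] at hσ
      simp only [hZY (σ - τ) (by linarith [hσ.1])]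
  have k1 : IntervalIntegrable (drift P τ w Z) volume t r := i1.congr fun σ hσ => by
    rw [uIoc_of_le htr] at hσ; exact (d1 σ hσ.2).symm
  have k2 : ∀ z ∈ Icc r s, IntervalIntegrable (drift P τ w Z) volume r z := fun z hz =>
    (i2 z hz).congr fun σ hσ => by
      rw [uIoc_of_le hz.1] at hσ; exact (d2 σ hσ.1).symm
  have l1 : IntervalIntegrable (fun σ => P.b σ (Z (σ - τ))) volume t r := j1.congr fun σ hσ => by
    rw [uIoc_of_le htr] at hσ; simp only [hZX (σ - τ) (by linarith [hσ.2])]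
  have l2 : ∀ z ∈ Icc r s, IntervalIntegrable (fun σ => P.b σ (Z (σ - τ))) volume r z :=
    fun z hz => (j2 z hz).congr fun σ hσ => by
      rw [uIoc_of_le hz.1] at hσ; simp only [hZY (σ - τ) (by linarith [hσ.1])]
  refine ⟨?_, fun z hz => ?_, fun z hz => ?_⟩
  · have c1 : ContinuousOn Z (Icc t r) := hx.cont.congr fun z hz => hZX z hz.2
    have c2 : ContinuousOn Z (Icc r s) := hy.cont.congr fun z hz => hZY z (by linarith [hz.1])
    rcases le_total r s with hrs | hrs
    · rw [← Icc_union_Icc_eq_Icc htr hrs]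
      exact c1.union_of_isClosed c2 isClosed_Icc isClosed_Icc
    · exact c1.mono (Icc_subset_Icc_right hrs)
  · rw [hZX z (hz.2.trans htr), hx.past z hz]
  · change Z z = x.ev 0 + (∫ σ in t..z, drift P τ w Z σ) + ∫ σ in t..z, P.b σ (Z (σ - τ))
    rcases le_total z r with hzr | hzr
    · rw [e1 z hz.1 hzr, e3 z hz.1 hzr, hZX z hzr]
      exact hx.eqn z ⟨hz.1, hzr⟩
    · rw [← intervalIntegral.integral_add_adjacent_intervals k1 (k2 z ⟨hzr, hz.2⟩),
        ← intervalIntegral.integral_add_adjacent_intervals l1 (l2 z ⟨hzr, hz.2⟩),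
        e1 r htr le_rfl, e2 z hzr, e3 r htr le_rfl, e4 z hzr, hZY z (by linarith)]
      have h1 := hy.eqn z ⟨hzr, hz.2⟩
      have h2 := hx.eqn r ⟨htr, le_rfl⟩
      rw [seg_ev_zero hX, h2] at h1
      rw [h1]
      simp only [drift]
      abel

variable [MeasurableSpace U]

theorem controls_ite {t r s : ℝ} {u v : ℝ → U} (hu : u ∈ controls t r) (hv : v ∈ controls r s) :
    (fun z => if z ≤ r then u z else v z) ∈ controls t s := by
  change Measurable fun z : Icc t s => if (z : ℝ) ≤ r then u z else v z
  have hm : MeasurableSet {z : Icc t s | (z : ℝ) ≤ r} :=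
    measurableSet_le measurable_subtype_coe measurable_const
  refine measurable_of_restrict_of_restrict_compl hm ?_ ?_
  · have : (Set.domRestrict {z : Icc t s | (z : ℝ) ≤ r} fun z : Icc t s =>
        if (z : ℝ) ≤ r then u z else v z)
        = fun z => (Icc t r).domRestrict u ⟨z.1, z.1.2.1, z.2⟩ := by
      funext z; exact if_pos z.2
    rw [this]
    exact Measurable.comp (g := (Icc t r).domRestrict u) hu (measurable_subtype_coe.comp measurable_subtype_coe).subtype_mk
  · have : (Set.domRestrict {z : Icc t s | (z : ℝ) ≤ r}ᶜ fun z : Icc t s =>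
        if (z : ℝ) ≤ r then u z else v z)
        = fun z => (Icc r s).domRestrict v ⟨z.1, (not_le.1 z.2).le, z.1.2.2⟩ := by
      funext z; exact if_neg z.2
    rw [this]
    exact Measurable.comp (g := (Icc r s).domRestrict v) hv (measurable_subtype_coe.comp measurable_subtype_coe).subtype_mk

theorem IsTrajectory.restrict (hstate : StateHyp P τ T) (hP : CoefBound P τ T K) {t r s : ℝ}
    {x : PathSpace d τ} {u : ℝ → U} {X : ℝ → E d} (h0 : 0 ≤ t) (htr : t ≤ r) (hsT : s ≤ T)
    (hu : u ∈ controls t s) (hX : IsRC X) (h : IsTrajectory P s t x u X) :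
    IsTrajectory P s r (seg X r : PathSpace d τ) u X := by
  refine ⟨h.cont.mono (Icc_subset_Icc_left htr), fun z hz => ?_, fun z hz => ?_⟩
  · rw [seg_ev hX r ⟨by linarith [hz.1], by linarith [hz.2]⟩]
    congr 1; ring
  · have h1 := h.eqn z ⟨htr.trans hz.1, hz.2⟩
    have h2 := h.eqn r ⟨htr, hz.1.trans hz.2⟩
    have i1 := drift_integrable hstate hP hu hX h0 hsT le_rfl htr (hz.1.trans hz.2)
    have i2 := drift_integrable hstate hP hu hX h0 hsT htr hz.1 hz.2
    have j1 := delay_integrable hP hX h0 htr (hz.1.trans (hz.2.trans hsT))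
    have j2 := delay_integrable hP hX (h0.trans htr) hz.1 (hz.2.trans hsT)
    have e1 := intervalIntegral.integral_add_adjacent_intervals i1 i2
    have e2 := intervalIntegral.integral_add_adjacent_intervals j1 j2
    simp only [drift] at e1
    rw [← e1, ← e2] at h1
    rw [seg_ev_zero hX, h1, h2]
    abel

theorem exists_of_mem_costs {t : ℝ} {x : PathSpace d τ} {c : ℝ} (ht : t ≤ T)
    (hc : c ∈ costs P T t x) :
    ∃ u ∈ controls t T, ∃ X, IsRC X ∧ IsTrajectory P T t x u X ∧ c = cost P T t u X := by
  obtain ⟨u, hu, X, hX, rfl⟩ := hc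
  obtain ⟨Y, hY, hYt, hYX⟩ := hX.exists_rc ht
  refine ⟨u, hu, Y, hY, hYt, ?_⟩
  unfold cost
  rw [hYX T ⟨ht, le_rfl⟩]
  congr 1
  refine intervalIntegral.integral_congr fun σ hσ => ?_
  rw [uIcc_of_le ht] at hσ
  simp only [hYX σ hσ]

theorem const_mem_controls (u : U) (t s : ℝ) : (fun _ => u) ∈ controls t s := measurable_const

theorem costs_nonempty [Nonempty U] (hstate : StateHyp P τ T) (hP : CoefBound P τ T K) {t : ℝ}
    (ht : t ∈ Icc 0 T) (x : PathSpace d τ) : (costs P T t x).Nonempty := by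
  obtain ⟨u⟩ := ‹Nonempty U›
  obtain ⟨X, -, hX⟩ := exists_trajectory hstate hP ht.1 ht.2 le_rfl x (const_mem_controls u t T)
  exact ⟨_, _, const_mem_controls u t T, X, hX, rfl⟩

theorem abs_cost_le (hT : 0 < T) (hP : CoefBound P τ T K) :
    ∃ C > 0, ∀ t ∈ Icc 0 T, ∀ x : PathSpace d τ, ∀ c ∈ costs P T t x, |c| ≤ C * size x := by
  obtain ⟨C, hC, hb⟩ := trajectory_bounds hT hP
  have hK := hP.one_le
  refine ⟨K * (1 + C) * (T + 1), by positivity, fun t ht x c hc => ?_⟩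
  obtain ⟨u, hu, X, hX, htr, rfl⟩ := exists_of_mem_costs ht.2 hc
  have hb' := fun r hr => (hb t T x u X ht.1 ht.2 le_rfl hu hX htr r hr).1
  have hn := one_le_size x
  set n := size x
  have h1 : ‖∫ σ in t..T, P.q σ (X σ) (u σ)‖ ≤ K * (1 + C) * n * |T - t| := by
    refine intervalIntegral.norm_integral_le_of_norm_le_const fun σ hσ => ?_
    rw [uIoc_of_le ht.2] at hσ
    refine (hP.q_growth σ ⟨ht.1.trans hσ.1.le, hσ.2⟩ _ _).trans ?_
    rw [mul_assoc]
    gcongr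
    linarith [hb' σ ⟨hσ.1.le, hσ.2⟩]
  have h2 : |P.φ (X T)| ≤ K * (1 + C) * n := by
    refine (hP.φ_growth _).trans ?_
    rw [mul_assoc]
    gcongr
    linarith [hb' T ⟨ht.2, le_rfl⟩]
  rw [abs_of_nonneg (sub_nonneg.2 ht.2)] at h1
  have h3 : K * (1 + C) * n * (T - t) ≤ K * (1 + C) * n * T := by
    gcongr; linarith [ht.1]
  unfold cost
  calc _ ≤ _ := abs_add_le _ _
    _ ≤ K * (1 + C) * n * T + K * (1 + C) * n := add_le_add (h1.trans h3) h2
    _ = _ := by ring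

theorem isGLB_valueFunction [Nonempty U] (hT : 0 < T) (hstate : StateHyp P τ T)
    (hP : CoefBound P τ T K) {t : ℝ} (ht : t ∈ Icc 0 T) (x : PathSpace d τ) :
    IsGLB (costs P T t x) (valueFunction P T t x) := by
  obtain ⟨C, -, hC⟩ := abs_cost_le hT hP
  exact isGLB_csInf (costs_nonempty hstate hP ht x)
    ⟨-(C * size x), fun c hc => neg_le_of_abs_le (hC t ht x c hc)⟩

/-- An arbitrary control after time `r` may be pasted to `u`; the infimum over these continuations
is the value at the segment reached. -/
theorem dpp_le [Nonempty U] (hT : 0 < T) (hstate : StateHyp P τ T) (hcost : CostHyp P T)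
    (hP : CoefBound P τ T K) {t r : ℝ} {x : PathSpace d τ} {u : ℝ → U} {X : ℝ → E d} (h0 : 0 ≤ t)
    (htr : t ≤ r) (hrT : r ≤ T) (hu : u ∈ controls t r) (hX : IsRC X)
    (hx : IsTrajectory P r t x u X) :
    valueFunction P T t x
      ≤ (∫ σ in t..r, P.q σ (X σ) (u σ)) + valueFunction P T r (seg X r : PathSpace d τ) := by
  have hr : r ∈ Icc 0 T := ⟨h0.trans htr, hrT⟩
  rw [← sub_le_iff_le_add']
  refine le_csInf (costs_nonempty hstate hP hr _) fun c hc => ?_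
  obtain ⟨v, hv, Y, hY, hy, rfl⟩ := exists_of_mem_costs hrT hc
  rw [sub_le_iff_le_add']
  have hg := hx.glue htr hX hy (drift_integrable hstate hP hu hX h0 hrT le_rfl htr le_rfl)
    (fun z hz => drift_integrable hstate hP hv hY hr.1 le_rfl le_rfl hz.1 hz.2)
    (delay_integrable hP hX h0 htr hrT)
    (fun z hz => delay_integrable hP hY hr.1 hz.1 hz.2)
  refine (isGLB_valueFunction hT hstate hP ⟨h0, htr.trans hrT⟩ x).1
    ⟨_, controls_ite hu hv, _, hg, ?_⟩
  have hXY : Y r = X r := by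
    rw [hy.past r ⟨by linarith [hτ.out], le_rfl⟩, sub_self, seg_ev_zero hX]
  have hZY : ∀ z, r ≤ z → (if z ≤ r then X z else Y z) = Y z := by
    intro z hz
    split_ifs with h
    · rw [le_antisymm h hz, hXY]
    · rfl
  have k1 := cost_integrable hcost hP hu hX h0 hrT le_rfl htr le_rfl
  have k2 := cost_integrable hcost hP hv hY hr.1 le_rfl le_rfl hrT le_rfl
  have d1 : ∀ σ ≤ r, P.q σ (if σ ≤ r then X σ else Y σ) (if σ ≤ r then u σ else v σ)
      = P.q σ (X σ) (u σ) := fun σ hσ => by simp only [if_pos hσ]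
  have d2 : ∀ σ, r < σ → P.q σ (if σ ≤ r then X σ else Y σ) (if σ ≤ r then u σ else v σ)
      = P.q σ (Y σ) (v σ) := fun σ hσ => by simp only [if_neg (not_le.2 hσ)]
  unfold cost
  rw [← intervalIntegral.integral_add_adjacent_intervals
      (k1.congr (fun σ hσ => by rw [uIoc_of_le htr] at hσ; exact (d1 σ hσ.2).symm))
      (k2.congr (fun σ hσ => by rw [uIoc_of_le hrT] at hσ; exact (d2 σ hσ.1).symm))]
  beta_reduce
  rw [hZY T hrT, ← add_assoc]
  congr 2
  · refine intervalIntegral.integral_congr fun σ hσ => ?_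
    rw [uIcc_of_le htr] at hσ
    exact (d1 σ hσ.2).symm
  · rw [intervalIntegral.integral_of_le hrT, intervalIntegral.integral_of_le hrT]
    exact setIntegral_congr_fun measurableSet_Ioc fun σ hσ => (d2 σ hσ.1).symm

/-- One `η`-optimal control serves all intermediate times at once: its restriction to `[r, T]` is
admissible for the segment reached at `r`. -/
theorem dpp_ge [Nonempty U] (hT : 0 < T) (hstate : StateHyp P τ T) (hcost : CostHyp P T)
    (hP : CoefBound P τ T K) {t η : ℝ} (ht : t ∈ Icc 0 T) (x : PathSpace d τ) (hη : 0 < η) :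
    ∃ u ∈ controls t T, ∃ X, IsRC X ∧ IsTrajectory P T t x u X ∧ ∀ r ∈ Icc t T,
      (∫ σ in t..r, P.q σ (X σ) (u σ)) + valueFunction P T r (seg X r : PathSpace d τ)
        ≤ valueFunction P T t x + η := by
  obtain ⟨c, hc, hcη⟩ := exists_lt_of_csInf_lt (costs_nonempty hstate hP ht x)
    (lt_add_of_pos_right (sInf (costs P T t x)) hη)
  obtain ⟨u, hu, X, hX, hx, rfl⟩ := exists_of_mem_costs ht.2 hc
  refine ⟨u, hu, X, hX, hx, fun r hr => ?_⟩
  have hr0 : r ∈ Icc 0 T := ⟨ht.1.trans hr.1, hr.2⟩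
  have h1 := (isGLB_valueFunction hT hstate hP hr0 (seg X r)).1
    ⟨u, controls_mono hu hr.1 le_rfl, X, hx.restrict hstate hP ht.1 hr.1 le_rfl hu hX, rfl⟩
  have k1 := cost_integrable hcost hP hu hX ht.1 le_rfl le_rfl hr.1 hr.2
  have k2 := cost_integrable hcost hP hu hX ht.1 le_rfl hr.1 hr.2 le_rfl
  unfold cost at h1 hcη
  rw [← intervalIntegral.integral_add_adjacent_intervals k1 k2] at hcη
  unfold valueFunction at h1 ⊢
  linarith

/-- A nearly optimal control for one initial path is used for the other; the costs are Lipschitz in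
the state, and the states differ as in `trajectory_difference`. -/
theorem abs_valueFunction_sub_le [Nonempty U] (hT : 0 < T) (hstate : StateHyp P τ T)
    (hcost : CostHyp P T) (hP : CoefBound P τ T K) :
    ∃ C > 0, ∀ t ∈ Icc 0 T, ∀ x y : PathSpace d τ,
      |valueFunction P T t x - valueFunction P T t y| ≤ C * (‖x.ev 0 - y.ev 0‖ + weakDist x y) := by
  obtain ⟨C, hC, hd⟩ := trajectory_difference hT hstate hP
  have hK := hP.one_le
  have main : ∀ t ∈ Icc 0 T, ∀ x y : PathSpace d τ, valueFunction P T t x - valueFunction P T t y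
      ≤ K * C * (T + 1) * (‖x.ev 0 - y.ev 0‖ + weakDist x y) := by
    intro t ht x y
    rw [sub_le_comm]
    refine le_csInf (costs_nonempty hstate hP ht y) fun c hc => ?_
    obtain ⟨u, hu, Y, hY, hy, rfl⟩ := exists_of_mem_costs ht.2 hc
    obtain ⟨X, hX, hx⟩ := exists_trajectory hstate hP ht.1 ht.2 le_rfl x hu
    have h1 := (isGLB_valueFunction hT hstate hP ht x).1 ⟨u, hu, X, hx, rfl⟩
    have hb := hd t T x y u X Y ht.1 ht.2 le_rfl hu hX hY hx hy
    set δ := ‖x.ev 0 - y.ev 0‖ + weakDist x y with hδ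
    have hδ0 : 0 ≤ δ := add_nonneg (norm_nonneg _) (weakDist_nonneg x y)
    have k1 := cost_integrable hcost hP hu hX ht.1 le_rfl le_rfl ht.2 le_rfl
    have k2 := cost_integrable hcost hP hu hY ht.1 le_rfl le_rfl ht.2 le_rfl
    have c1 : ‖∫ σ in t..T, (P.q σ (X σ) (u σ) - P.q σ (Y σ) (u σ))‖ ≤ K * (C * δ) * |T - t| := by
      refine intervalIntegral.norm_integral_le_of_norm_le_const fun σ hσ => ?_
      rw [uIoc_of_le ht.2] at hσ
      refine (hP.q_lip σ ⟨ht.1.trans hσ.1.le, hσ.2⟩ _ _ _).trans ?_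
      gcongr
      exact hb σ ⟨hσ.1.le, hσ.2⟩
    have c2 : |P.φ (X T) - P.φ (Y T)| ≤ K * (C * δ) := by
      refine (hP.φ_lip _ _).trans ?_
      gcongr
      exact hb T ⟨ht.2, le_rfl⟩
    rw [intervalIntegral.integral_sub k1 k2, abs_of_nonneg (sub_nonneg.2 ht.2)] at c1
    have c3 : K * (C * δ) * (T - t) ≤ K * (C * δ) * T := by gcongr; linarith [ht.1]
    have c4 := (le_abs_self _).trans (c1.trans c3)
    have c5 := (le_abs_self _).trans c2
    unfold cost at h1 ⊢
    have : K * C * (T + 1) * δ = K * (C * δ) * T + K * (C * δ) := by ring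
    linarith
  refine ⟨K * C * (T + 1), by positivity, fun t ht x y => abs_sub_le_iff.2 ⟨main t ht x y, ?_⟩⟩
  have := main t ht y x
  rwa [norm_sub_rev, weakDist_comm] at this

/-- Dynamic programming compares the value at `(t, x)` with the value at the segment reached at `r`.
That segment continues `x`, so it is within `√(r - t)` of `x` both at `0` and in the weak distance,
uniformly in the control. -/
theorem abs_valueFunction_time_le [Nonempty U] (hT : 0 < T) (hstate : StateHyp P τ T)
    (hcost : CostHyp P T) (hP : CoefBound P τ T K) :
    ∃ C > 0, ∀ t ∈ Icc 0 T, ∀ r ∈ Icc t T, ∀ x : PathSpace d τ,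
      |valueFunction P T t x - valueFunction P T r x| ≤ C * size x * √(r - t) := by
  obtain ⟨C, hC, hb⟩ := trajectory_bounds hT hP
  obtain ⟨D, hD, hd⟩ := abs_valueFunction_sub_le hT hstate hcost hP
  have hK := hP.one_le
  have hτ0 := hτ.out
  refine ⟨K * (1 + C) * √T + D * (2 * C + 1), by positivity, fun t ht r hr x => ?_⟩
  have hr0 : r ∈ Icc 0 T := ⟨ht.1.trans hr.1, hr.2⟩
  have hn := one_le_size x
  have hrt0 : 0 ≤ r - t := by linarith [hr.1]
  have key : ∀ u ∈ controls t r, ∀ X, IsRC X → IsTrajectory P r t x u X →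
      |(∫ σ in t..r, P.q σ (X σ) (u σ)) + valueFunction P T r (seg X r : PathSpace d τ)
        - valueFunction P T r x|
      ≤ (K * (1 + C) * √T + D * (2 * C + 1)) * size x * √(r - t) := by
    intro u hu X hX hx
    have hb' := hb t r x u X ht.1 hr.1 hr.2 hu hX hx
    have h1 : ‖∫ σ in t..r, P.q σ (X σ) (u σ)‖ ≤ K * (1 + C) * size x * |r - t| := by
      refine intervalIntegral.norm_integral_le_of_norm_le_const fun σ hσ => ?_
      rw [uIoc_of_le hr.1] at hσ
      refine (hP.q_growth σ ⟨ht.1.trans hσ.1.le, hσ.2.trans hr.2⟩ _ _).trans ?_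
      rw [mul_assoc]
      gcongr
      linarith [(hb' σ ⟨hσ.1.le, hσ.2⟩).1]
    have h2 : |r - t| ≤ √T * √(r - t) := by
      rw [abs_of_nonneg hrt0]
      calc r - t = √(r - t) * √(r - t) := (Real.mul_self_sqrt hrt0).symm
        _ ≤ _ := by gcongr; linarith [hr.2, ht.1]
    have h3 := hd r hr0 (seg X r) x
    have hbr := hb' r ⟨hr.1, le_rfl⟩
    have h4 : weakDist (seg X r) x ≤ √(r - t) * (size x + C * size x) := by
      refine (weakDist_continuation hrt0 fun θ hθ hθr => ?_).trans ?_
      · rw [seg_ev hX r hθ, hx.past (r + θ) ⟨by linarith [hθ.1], by linarith⟩]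
        congr 1; ring
      · gcongr
        · exact norm_toH_le_size x
        · exact hbr.2.2.1
    rw [seg_ev_zero hX] at h3
    have h5 : |valueFunction P T r (seg X r : PathSpace d τ) - valueFunction P T r x|
        ≤ D * (2 * C + 1) * size x * √(r - t) := by
      refine h3.trans ?_
      calc _ ≤ D * (C * size x * √(r - t) + √(r - t) * (size x + C * size x)) := by
            gcongr
            exact hbr.2.2.2
        _ = _ := by ring
    have h6 : ‖∫ σ in t..r, P.q σ (X σ) (u σ)‖ ≤ K * (1 + C) * √T * size x * √(r - t) := by
      refine h1.trans ?_
      calc _ ≤ K * (1 + C) * size x * (√T * √(r - t)) := by gcongr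
        _ = _ := by ring
    rw [add_sub_assoc, add_mul, add_mul]
    exact (abs_add_le _ _).trans (add_le_add h6 h5)
  obtain ⟨u₀⟩ := ‹Nonempty U›
  obtain ⟨X, hX, hx⟩ := exists_trajectory hstate hP ht.1 hr.1 hr.2 x (const_mem_controls u₀ t r)
  have : Nonempty U := ⟨u₀⟩
  refine abs_sub_le_iff.2 ⟨?_, ?_⟩
  · have h1 := dpp_le hT hstate hcost hP ht.1 hr.1 hr.2 (const_mem_controls u₀ t r) hX hx
    have h2 := (le_abs_self _).trans (key _ (const_mem_controls u₀ t r) X hX hx)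
    linarith
  · refine le_of_forall_pos_le_add fun η hη => ?_
    obtain ⟨u, hu, X, hX, hx, hh⟩ := dpp_ge hT hstate hcost hP ht x hη
    have h1 := hh r hr
    have h2 := neg_le_of_abs_le (key u (controls_mono hu le_rfl hr.2) X hX (hx.mono hr.2))
    linarith

theorem valueFunction_mem_class [Nonempty U] (hT : 0 < T) (hstate : StateHyp P τ T)
    (hcost : CostHyp P T) (hP : CoefBound P τ T K) :
    InUniquenessClass T (valueFunction (τ := τ) P T) := by
  obtain ⟨A, hA, hA'⟩ := abs_cost_le (τ := τ) hT hP
  obtain ⟨B, hB, hB'⟩ := abs_valueFunction_sub_le hT hstate hcost hP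
  obtain ⟨C, hC, hC'⟩ := abs_valueFunction_time_le hT hstate hcost hP
  have key : ∀ t ∈ Icc 0 T, ∀ s ∈ Icc 0 T, t ≤ s → ∀ x y : PathSpace d τ,
      |valueFunction P T t x - valueFunction P T s y| ≤ (A + B + C) *
        (1 + ‖x.ev 0‖ + ‖x.toH‖ + ‖y.ev 0‖ + ‖y.toH‖) *
        (‖x.ev 0 - y.ev 0‖ + √|s - t| + weakDist x y) := by
    intro t ht s hs hts x y
    have h1 := hC' t ht s ⟨hts, hs.2⟩ x
    have h2 := hB' s hs x y
    rw [abs_of_nonneg (sub_nonneg.2 hts)]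
    set N := 1 + ‖x.ev 0‖ + ‖x.toH‖ + ‖y.ev 0‖ + ‖y.toH‖ with hN
    have hN1 : 1 ≤ N := by
      rw [hN]; linarith [norm_nonneg (x.ev 0), norm_nonneg x.toH, norm_nonneg (y.ev 0),
        norm_nonneg y.toH]
    have hsN : size x ≤ N := by
      rw [hN]; unfold size; linarith [norm_nonneg (y.ev 0), norm_nonneg y.toH]
    have hW := weakDist_nonneg x y
    set δ := ‖x.ev 0 - y.ev 0‖ with hδ
    have hδ0 : 0 ≤ δ := norm_nonneg _
    set W := weakDist x y with hWd
    set h := √(s - t) with hh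
    have hh0 : 0 ≤ h := Real.sqrt_nonneg _
    calc _ ≤ _ := abs_sub_le _ (valueFunction P T s x) _
      _ ≤ C * N * h + B * N * (δ + W) := by
          refine add_le_add (h1.trans (by gcongr)) (h2.trans ?_)
          have : B ≤ B * N := le_mul_of_one_le_right hB.le hN1
          gcongr
      _ ≤ (A + B + C) * N * h + (A + B + C) * N * (δ + W) := by
          gcongr <;> linarith
      _ = _ := by ring
  refine ⟨A + B + C, by positivity, fun t ht s hs x y => ⟨?_, ?_⟩⟩
  · obtain ⟨c, hc⟩ := costs_nonempty hstate hP ht x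
    have h1 := hA' t ht x
    have hg := isGLB_valueFunction hT hstate hP ht x
    have hn : 1 ≤ 1 + ‖x.ev 0‖ + ‖x.toH‖ := one_le_size x
    have h2 : |valueFunction P T t x| ≤ A * size x := abs_le.2
      ⟨hg.2 fun c hc => neg_le_of_abs_le (h1 c hc), (hg.1 hc).trans (le_of_abs_le (h1 c hc))⟩
    exact h2.trans (mul_le_mul_of_nonneg_right (by linarith) (zero_le_one.trans hn))
  · rcases le_total t s with h | h
    · exact key t ht s hs h x y
    · have := key s hs t ht h y x
      rw [abs_sub_comm, norm_sub_rev, abs_sub_comm s t]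
      rw [weakDist_comm] at this
      refine this.trans_eq ?_
      change _ = _ * (_ + weakDist x y)
      ring

theorem valueFunction_terminal [Nonempty U] (hT : 0 < T) (hstate : StateHyp P τ T)
    (hP : CoefBound P τ T K) (x : PathSpace d τ) : valueFunction P T T x = P.φ (x.ev 0) := by
  have hTT : T ∈ Icc 0 T := ⟨hT.le, le_rfl⟩
  have : costs P T T x = {P.φ (x.ev 0)} := by
    refine Subset.antisymm ?_ ?_
    · rintro c ⟨u, hu, X, hX, rfl⟩
      have := hX.past T ⟨by linarith [hτ.out], le_rfl⟩
      rw [sub_self] at this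
      simp [cost, this]
    · obtain ⟨c, hc⟩ := costs_nonempty hstate hP hTT x
      have h2 : c = P.φ (x.ev 0) := by
        obtain ⟨u, hu, X, hX, rfl⟩ := hc
        have := hX.past T ⟨by linarith [hτ.out], le_rfl⟩
        rw [sub_self] at this
        simp [cost, this]
      rw [h2] at hc
      exact singleton_subset_iff.2 hc
  rw [valueFunction, this, csInf_singleton]

theorem InUniquenessClass.continuousOn {w : ℝ → PathSpace d τ → ℝ} (hw : InUniquenessClass T w) :
    ContinuousOn (fun p : ℝ × PathSpace d τ => w p.1 p.2) (Icc 0 T ×ˢ univ) := by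
  obtain ⟨Λ, hΛ, h⟩ := hw
  rintro ⟨t, x⟩ ⟨ht, -⟩
  rw [ContinuousWithinAt, tendsto_iff_dist_tendsto_zero]
  have hlim : Tendsto (fun p : ℝ × PathSpace d τ => Λ * (1 + ‖p.2.ev 0‖ + ‖p.2.toH‖ + ‖x.ev 0‖
      + ‖x.toH‖) * (‖p.2 - x‖ + √|t - p.1| + τ * ‖p.2 - x‖)) (𝓝[Icc 0 T ×ˢ univ] (t, x)) (𝓝 0) := by
    have hc : Continuous fun p : ℝ × PathSpace d τ => Λ * (1 + ‖evL 0 p.2‖ + ‖toHL p.2‖ + ‖x.ev 0‖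
      + ‖x.toH‖) * (‖p.2 - x‖ + √|t - p.1| + τ * ‖p.2 - x‖) := by fun_prop
    have := (hc.tendsto (t, x)).mono_left (nhdsWithin_le_nhds (s := Icc 0 T ×ˢ univ))
    simpa only [sub_self, norm_zero, abs_zero, Real.sqrt_zero, mul_zero, add_zero, evL_apply,
      toHL_apply] using this
  refine squeeze_zero' (Eventually.of_forall fun _ => dist_nonneg) ?_ hlim
  filter_upwards [self_mem_nhdsWithin] with p hp
  rw [Real.dist_eq]
  refine (h p.1 hp.1 t ht p.2 x).2.trans ?_
  gcongr
  · exact (p.2 - x).norm_ev_le 0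
  · exact weakDist_le_norm p.2 x

end Value

/-! ### First-order expansion of test functions along continuations. -/

section Tests

variable {d : ℕ} {τ T : ℝ} [hτ : Fact (0 < τ)]

/-- Right-continuity gives pointwise convergence, and boundedness gives dominated convergence. -/
theorem flatShift_tendsto (z : PathSpace d τ) :
    Tendsto (fun h => ‖(flatShift h z).toH - z.toH‖) (𝓝[>] 0) (𝓝 0) := by
  have h2 : Tendsto (fun h => ∫ θ in (-τ)..0, ‖z.ev (h + θ) - z.ev θ‖ ^ 2) (𝓝[>] 0)
      (𝓝 (∫ θ in (-τ)..0, (0 : ℝ))) := by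
    refine intervalIntegral.tendsto_integral_filter_of_dominated_convergence
      (fun _ => (‖z‖ + ‖z‖) ^ 2) ?_ ?_ intervalIntegrable_const ?_
    · refine Eventually.of_forall fun h => ?_
      exact ((((isRC_ev z).comp_add h).sub (isRC_ev z)).measurable.norm.pow_const
        2).aestronglyMeasurable
    · refine Eventually.of_forall fun h => Eventually.of_forall fun θ _ => ?_
      rw [norm_pow, norm_norm]
      gcongr
      exact (norm_sub_le _ _).trans (add_le_add (z.norm_ev_le _) (z.norm_ev_le _))
    · refine Eventually.of_forall fun θ _ => ?_
      have h1 : Tendsto (fun h : ℝ => h + θ) (𝓝[>] 0) (𝓝[≥] θ) := by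
        refine tendsto_nhdsWithin_iff.2 ⟨?_, ?_⟩
        · have : Tendsto (fun h : ℝ => h + θ) (𝓝 0) (𝓝 (0 + θ)) :=
            (continuous_id.add continuous_const).tendsto 0
          rw [zero_add] at this
          exact this.mono_left nhdsWithin_le_nhds
        · filter_upwards [self_mem_nhdsWithin] with h hh
          exact le_add_of_nonneg_left (mem_Ioi.1 hh).le
      have h3 := ((z.ev_rightCont θ).tendsto.comp h1).sub_const (z.ev θ)
      have h4 := h3.norm.pow 2
      simpa using h4
  have h3 := h2.sqrt
  simp only [intervalIntegral.integral_zero, Real.sqrt_zero] at h3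
  refine h3.congr fun h => ?_
  rw [← toH_sub, ← Real.sqrt_sq (norm_nonneg (flatShift h z - z).toH), norm_toH_sq]
  congr 1
  refine intervalIntegral.integral_congr fun θ hθ => ?_
  rw [uIcc_of_le neg_le_zero'] at hθ
  simp only [ev_sub, flatShift_ev h z hθ]

/-- The two paths differ only on an interval of length `h`. Used with a bound of order `h` for the
values, this gives `h^{3/2}`, so the derivative in `H` does not contribute beyond the generator. -/
theorem norm_toH_sub_flatShift_le {z y : PathSpace d τ} {h C : ℝ} (hh : 0 ≤ h) (hhτ : h ≤ τ)
    (hc : ∀ θ ∈ Icc (-τ) 0, θ < -h → y.ev θ = z.ev (θ + h))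
    (hC : ∀ θ ∈ Icc (-τ) 0, -h ≤ θ → ‖y.ev θ - z.ev 0‖ ≤ C) :
    ‖y.toH - (flatShift h z).toH‖ ≤ √h * C := by
  have hC0 : 0 ≤ C := (norm_nonneg _).trans (hC 0 mem_zero (by linarith))
  rw [← toH_sub]
  refine abs_le_of_sq_le_sq' ?_ (by positivity) |>.2
  have hi := (isRC_ev (y - flatShift h z)).sq_intervalIntegrable
  rw [norm_toH_sq, ← intervalIntegral.integral_add_adjacent_intervals (hi (-τ) (-h)) (hi (-h) 0),
    mul_pow, Real.sq_sqrt hh]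
  have e1 : ∫ θ in (-τ)..(-h), ‖(y - flatShift h z).ev θ‖ ^ 2 = 0 := by
    rw [intervalIntegral.integral_of_le (by linarith), integral_Ioc_eq_integral_Ioo]
    refine setIntegral_eq_zero_of_forall_eq_zero fun θ hθ => ?_
    have hθ' : θ ∈ Icc (-τ) 0 := ⟨hθ.1.le, by linarith [hθ.2]⟩
    rw [ev_sub, hc θ hθ' hθ.2, flatShift_ev h z hθ', add_comm, sub_self]
    simp
  have e2 : ∫ θ in (-h)..0, ‖(y - flatShift h z).ev θ‖ ^ 2 ≤ ∫ θ in (-h)..0, C ^ 2 := by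
    refine intervalIntegral.integral_mono_on (by linarith) (hi _ _) intervalIntegrable_const
      fun θ hθ => ?_
    have hθ' : θ ∈ Icc (-τ) 0 := ⟨by linarith [hθ.1], hθ.2⟩
    rw [ev_sub, flatShift_ev h z hθ', ev_of_le z (by linarith [hθ.1])]
    exact pow_le_pow_left₀ (norm_nonneg _) (hC θ hθ' hθ.1) 2
  rw [e1, zero_add]
  simpa using e2

/-- A `C¹` function on a convex set is strictly differentiable, uniformly near a point. -/
theorem ContDiffOn.strict_bound {V : Type*} [NormedAddCommGroup V] [NormedSpace ℝ V] {f : V → ℝ}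
    {S : Set V} (hf : ContDiffOn ℝ 1 f S) (hS : UniqueDiffOn ℝ S) (hconv : Convex ℝ S) {p₀ : V}
    (hp : p₀ ∈ S) {ε : ℝ} (hε : 0 < ε) : ∃ δ > 0, ∀ p ∈ S ∩ Metric.ball p₀ δ,
      ∀ p' ∈ S ∩ Metric.ball p₀ δ, ‖f p - f p' - fderivWithin ℝ f S p₀ (p - p')‖ ≤ ε * ‖p - p'‖ := by
  have hc := (hf.continuousOn_fderivWithin hS le_rfl) p₀ hp
  obtain ⟨δ, hδ, h⟩ := Metric.mem_nhdsWithin_iff.1 (hc.eventually (Metric.ball_mem_nhds _ hε))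
  refine ⟨δ, hδ, fun p hp1 p' hp2 => ?_⟩
  refine Convex.norm_image_sub_le_of_norm_hasFDerivWithin_le' (s := S ∩ Metric.ball p₀ δ)
    (f' := fderivWithin ℝ f S) (fun q hq => ?_) (fun q hq => ?_)
    (hconv.inter (convex_ball p₀ δ)) hp2 hp1
  · exact ((hf.differentiableOn one_ne_zero q hq.1).hasFDerivWithinAt).mono inter_subset_left
  · have : fderivWithin ℝ f S q ∈ Metric.ball (fderivWithin ℝ f S p₀) ε := h ⟨hq.2, hq.1⟩
    exact (mem_ball_iff_norm.1 this).le

theorem norm_triple_le {A B C : Type*} [SeminormedAddCommGroup A] [SeminormedAddCommGroup B]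
    [SeminormedAddCommGroup C] {a : A} {b : B} {c : C} {r : ℝ} (h1 : ‖a‖ ≤ r) (h2 : ‖b‖ ≤ r)
    (h3 : ‖c‖ ≤ r) : ‖(a, b, c)‖ ≤ r := by
  rw [Prod.norm_mk, Prod.norm_mk]
  exact max_le h1 (max_le h2 h3)

/-- A test function is strictly differentiable in the variables `(t, x(0), x) ∈ ℝ × ℝ^d × H`. -/
theorem IsTest.strict {ψ : ℝ → PathSpace d τ → ℝ} (hψ : IsTest T ψ) {s : ℝ} (hs : s ∈ Ico 0 T)
    (z : PathSpace d τ) : ∃ (G : E d →L[ℝ] ℝ) (A : HSpace d τ →L[ℝ] ℝ),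
      (∀ v, fderiv ℝ (ψ s) z (jump v) = G v) ∧ ∀ ε > 0, ∃ δ > 0, ∀ t ∈ Icc 0 T,
        ∀ y y' : PathSpace d τ, |t - s| < δ → ‖y.ev 0 - z.ev 0‖ < δ → ‖y.toH - z.toH‖ < δ →
        ‖y'.ev 0 - z.ev 0‖ < δ → ‖y'.toH - z.toH‖ < δ →
        |ψ t y - ψ s y' - ((t - s) * dt T ψ s z + G (y.ev 0 - y'.ev 0) + A (y.toH - y'.toH))|
          ≤ ε * (|t - s| + ‖y.ev 0 - y'.ev 0‖ + ‖y.toH - y'.toH‖) := by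
  obtain ⟨ψ₀, hψ₀, hfac⟩ := hψ.factor
  generalize hf : (fun p : ℝ × E d × HSpace d τ => ψ₀ p.1 p.2.1 p.2.2) = f at hψ₀
  have hfac' : ∀ t ∈ Icc 0 T, ∀ x : PathSpace d τ, ψ t x = f (t, x.ev 0, x.toH) := by
    intro t ht x; rw [hfac t ht x, ← hf]
  generalize hS : (Icc 0 T ×ˢ univ : Set (ℝ × E d × HSpace d τ)) = S at hψ₀
  have hmem : ∀ t ∈ Icc 0 T, ∀ q : E d × HSpace d τ, (t, q) ∈ S := fun t ht q => by
    rw [← hS]; exact mk_mem_prod ht (mem_univ _)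
  have hT : 0 < T := hs.1.trans_lt hs.2
  have hsS : s ∈ Icc 0 T := ⟨hs.1, hs.2.le⟩
  have hu : UniqueDiffOn ℝ S := by
    rw [← hS]; exact (uniqueDiffOn_Icc hT).prod uniqueDiffOn_univ
  have hconv : Convex ℝ S := by rw [← hS]; exact (convex_Icc 0 T).prod convex_univ
  have hpS : (s, z.ev 0, z.toH) ∈ S := hmem s hsS _
  have hDf := (hψ₀.differentiableOn one_ne_zero _ hpS).hasFDerivWithinAt
  have hst := fun ε (hε : 0 < ε) => ContDiffOn.strict_bound hψ₀ hu hconv hpS hε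
  generalize fderivWithin ℝ f S (s, z.ev 0, z.toH) = D at hDf hst
  have hdt : dt T ψ s z = D (1, 0, 0) := by
    have h1 : HasDerivWithinAt (fun t : ℝ => ((t, z.ev 0, z.toH) : ℝ × E d × HSpace d τ)) (1, 0, 0)
        (Icc 0 T) s := by
      have := (hasDerivAt_id s).prodMk ((hasDerivAt_const s (z.ev 0)).prodMk
        (hasDerivAt_const s z.toH))
      exact this.hasDerivWithinAt
    have h2 : HasDerivWithinAt (f ∘ fun t : ℝ => ((t, z.ev 0, z.toH) : ℝ × E d × HSpace d τ))
        (D (1, 0, 0)) (Icc 0 T) s :=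
      HasFDerivWithinAt.comp_hasDerivWithinAt (t := S) s hDf h1 (fun t ht => hmem t ht _)
    have h3 : HasDerivWithinAt (fun t => ψ t z) (D (1, 0, 0)) (Icc 0 T) s :=
      h2.congr (fun t ht => hfac' t ht z) (hfac' s hsS z)
    exact h3.derivWithin (uniqueDiffOn_Icc hT s hsS)
  have hfd : HasFDerivAt (ψ s) (D.comp ((0 : PathSpace d τ →L[ℝ] ℝ).prod ((evL 0).prod toHL))) z := by
    have h1 : HasFDerivAt (fun x : PathSpace d τ => ((s, x.ev 0, x.toH) : ℝ × E d × HSpace d τ))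
        ((0 : PathSpace d τ →L[ℝ] ℝ).prod ((evL 0).prod toHL)) z :=
      (hasFDerivAt_const s z).prodMk ((evL 0).hasFDerivAt.prodMk toHL.hasFDerivAt)
    have h2 := HasFDerivWithinAt.comp_hasFDerivAt (t := S) z hDf h1
      (Eventually.of_forall fun x => hmem s hsS _)
    exact h2.congr_of_eventuallyEq (Eventually.of_forall fun x => hfac' s hsS x)
  -- `G` and `A` are the partial derivatives in `x(0)` and in `H`. Jumps have zero class in `H`, so
  -- they are seen by `G` alone.
  refine ⟨D.comp ((ContinuousLinearMap.inr ℝ ℝ (E d × HSpace d τ)).comp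
    (ContinuousLinearMap.inl ℝ (E d) (HSpace d τ))),
    D.comp ((ContinuousLinearMap.inr ℝ ℝ (E d × HSpace d τ)).comp
    (ContinuousLinearMap.inr ℝ (E d) (HSpace d τ))), fun v => ?_, fun ε hε => ?_⟩
  · rw [hfd.fderiv]
    change D (0, (jump v : PathSpace d τ).ev 0, (jump v : PathSpace d τ).toH) = D (0, v, 0)
    rw [jump_ev_zero, jump_toH]
  · obtain ⟨δ, hδ, h⟩ := hst ε hε
    refine ⟨δ / 2, half_pos hδ, fun t ht y y' h1 h2 h3 h4 h5 => ?_⟩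
    have m1 : ((t, y.ev 0, y.toH) : ℝ × E d × HSpace d τ)
        ∈ Metric.ball ((s, z.ev 0, z.toH) : ℝ × E d × HSpace d τ) δ := by
      rw [mem_ball_iff_norm, Prod.mk_sub_mk, Prod.mk_sub_mk]
      exact (norm_triple_le (r := δ / 2) h1.le h2.le h3.le).trans_lt (half_lt_self hδ)
    have m2 : ((s, y'.ev 0, y'.toH) : ℝ × E d × HSpace d τ)
        ∈ Metric.ball ((s, z.ev 0, z.toH) : ℝ × E d × HSpace d τ) δ := by
      rw [mem_ball_iff_norm, Prod.mk_sub_mk, Prod.mk_sub_mk]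
      refine (norm_triple_le (r := δ / 2) ?_ h4.le h5.le).trans_lt (half_lt_self hδ)
      rw [sub_self, norm_zero]; exact (half_pos hδ).le
    have key := h _ ⟨hmem t ht _, m1⟩ _ ⟨hmem s hsS _, m2⟩
    rw [← hfac' t ht, ← hfac' s hsS, Prod.mk_sub_mk, Prod.mk_sub_mk] at key
    have e : ((t - s, y.ev 0 - y'.ev 0, y.toH - y'.toH) : ℝ × E d × HSpace d τ)
        = (t - s) • ((1, 0, 0) : ℝ × E d × HSpace d τ) + (0, y.ev 0 - y'.ev 0, 0)
          + (0, 0, y.toH - y'.toH) := by simp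
    rw [Real.norm_eq_abs] at key
    have e2 : D (t - s, y.ev 0 - y'.ev 0, y.toH - y'.toH) = (t - s) * dt T ψ s z
        + D (0, y.ev 0 - y'.ev 0, 0) + D (0, 0, y.toH - y'.toH) := by
      rw [e, map_add, map_add, map_smul, hdt, smul_eq_mul]
    rw [e2] at key
    refine key.trans (mul_le_mul_of_nonneg_left ?_ hε.le)
    have n1 := abs_nonneg (t - s)
    have n2 := norm_nonneg (y.ev 0 - y'.ev 0)
    have n3 := norm_nonneg (y.toH - y'.toH)
    refine norm_triple_le ?_ ?_ ?_
    · rw [Real.norm_eq_abs]; linarith only [n2, n3]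
    · linarith only [n1, n3]
    · linarith only [n1, n2]

/-- The first-order expansion of a test function along all Lipschitz continuations of a path. -/
theorem IsTest.expansion {ψ : ℝ → PathSpace d τ → ℝ} (hψ : IsTest T ψ) {s : ℝ} (hs : s ∈ Ico 0 T)
    (z : PathSpace d τ) : ∃ G : E d →L[ℝ] ℝ, (∀ v, fderiv ℝ (ψ s) z (jump v) = G v) ∧
      ∀ C ≥ 0, ∀ ε > 0, ∃ δ > 0, ∀ h, 0 < h → h < δ → ∀ y : PathSpace d τ,
        (∀ θ ∈ Icc (-τ) 0, θ < -h → y.ev θ = z.ev (θ + h)) →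
        (∀ θ ∈ Icc (-τ) 0, -h ≤ θ → ‖y.ev θ - z.ev 0‖ ≤ C * h) →
        |ψ (s + h) y - ψ s z - h * (dt T ψ s z + genS (ψ s) z) - G (y.ev 0 - z.ev 0)| ≤ ε * h := by
  have hτ0 := hτ.out
  obtain ⟨G, A, hG, hst⟩ := hψ.strict hs z
  have hsS : s ∈ Icc 0 T := ⟨hs.1, hs.2.le⟩
  refine ⟨G, hG, fun C hC ε hε => ?_⟩
  have hgen : Tendsto (fun h : ℝ => (ψ s (flatShift h z) - ψ s z) / h) (𝓝[>] 0)
      (𝓝 (genS (ψ s) z)) := tendsto_nhds_limUnder (hψ.domS s hsS z)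
  -- The three increments in the strict estimate add up to at most `(1 + 2 * C) * h`.
  obtain ⟨δ₁, hδ₁, hst⟩ := hst (ε / (3 * (1 + 2 * C))) (by positivity)
  have ev1 : ∀ᶠ h in 𝓝[>] (0 : ℝ), |(ψ s (flatShift h z) - ψ s z) / h - genS (ψ s) z| < ε / 3 :=
    hgen.eventually (Metric.ball_mem_nhds _ (by positivity))
  have ev2 : ∀ᶠ h in 𝓝[>] (0 : ℝ), ‖(flatShift h z).toH - z.toH‖ < δ₁ / 2 :=
    (flatShift_tendsto z).eventually (Iio_mem_nhds (show (0 : ℝ) < δ₁ / 2 by positivity))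
  have ev3 : ∀ᶠ h in 𝓝[>] (0 : ℝ), ‖A‖ * (√h * C) < ε / 3 := by
    have hc : Continuous fun h : ℝ => ‖A‖ * (√h * C) := by fun_prop
    have := (hc.tendsto 0).mono_left (nhdsWithin_le_nhds (s := Ioi 0))
    simp only [Real.sqrt_zero, zero_mul, mul_zero] at this
    exact this.eventually (Iio_mem_nhds (by positivity))
  have ev4 : ∀ᶠ h in 𝓝[>] (0 : ℝ), (1 + 2 * C) * h < δ₁ / 2 := by
    have hc : Continuous fun h : ℝ => (1 + 2 * C) * h := by fun_prop
    have := (hc.tendsto 0).mono_left (nhdsWithin_le_nhds (s := Ioi 0))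
    simp only [mul_zero] at this
    exact this.eventually (Iio_mem_nhds (by positivity))
  have ev5 : ∀ᶠ h in 𝓝[>] (0 : ℝ), h < min (min τ 1) (T - s) :=
    mem_nhdsWithin_of_mem_nhds (Iio_mem_nhds (lt_min (lt_min hτ0 one_pos) (sub_pos.2 hs.2)))
  obtain ⟨δ, hδ, hall⟩ := mem_nhdsGT_iff_exists_Ioo_subset.1
    (ev1.and (ev2.and (ev3.and (ev4.and ev5))))
  refine ⟨δ, hδ, fun h h0 hhδ y hy1 hy2 => ?_⟩
  obtain ⟨a1, a2, a3, a4, a5⟩ := hall ⟨h0, hhδ⟩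
  have hτh : h < τ := a5.trans_le ((min_le_left _ _).trans (min_le_left _ _))
  have h1h : h < 1 := a5.trans_le ((min_le_left _ _).trans (min_le_right _ _))
  have hTh : h < T - s := a5.trans_le (min_le_right _ _)
  have hsh : s + h ∈ Icc 0 T := ⟨add_nonneg hs.1 h0.le, by linarith only [hTh]⟩
  have hyz := norm_toH_sub_flatShift_le h0.le hτh.le hy1 hy2
  have hy0 : ‖y.ev 0 - z.ev 0‖ ≤ C * h := hy2 0 mem_zero (by linarith only [h0])
  have hCh : 0 ≤ C * h := mul_nonneg hC h0.le
  have hyz' : ‖y.toH - (flatShift h z).toH‖ ≤ C * h :=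
    hyz.trans (mul_le_of_le_one_left hCh (Real.sqrt_le_one.2 h1h.le))
  have hfl : (flatShift h z).ev 0 = z.ev 0 := by
    rw [flatShift_ev h z mem_zero, ev_of_le z (by linarith only [h0])]
  have hyz2 : ‖y.toH - z.toH‖ < δ₁ := by
    calc ‖y.toH - z.toH‖ ≤ ‖y.toH - (flatShift h z).toH‖ + ‖(flatShift h z).toH - z.toH‖ :=
          norm_sub_le_norm_sub_add_norm_sub _ _ _
      _ < δ₁ / 2 + δ₁ / 2 := add_lt_add (by linarith only [hyz', a4, hCh, h0]) a2
      _ = δ₁ := add_halves δ₁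
  -- The increment is split at the flat continuation: the generator covers the step from `z` to it,
  -- strict differentiability the step from it to `y`. Plain differentiability at `z` would not do,
  -- since the distance of the flat continuation from `z` in `H` need not be `O(h)`.
  have key := hst (s + h) hsh y (flatShift h z)
    (by rw [add_sub_cancel_left, abs_of_pos h0]; linarith only [a4, hCh, h0, hδ₁])
    (by linarith only [hy0, a4, hCh, h0, hδ₁]) hyz2
    (by rw [hfl, sub_self, norm_zero]; exact hδ₁) (a2.trans (half_lt_self hδ₁))
  rw [hfl, add_sub_cancel_left, abs_of_pos h0] at key
  have b2 : ε / (3 * (1 + 2 * C)) * (h + ‖y.ev 0 - z.ev 0‖ + ‖y.toH - (flatShift h z).toH‖)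
      ≤ ε / 3 * h := by
    calc _ ≤ ε / (3 * (1 + 2 * C)) * ((1 + 2 * C) * h) := by
          refine mul_le_mul_of_nonneg_left ?_ (by positivity)
          linarith only [hy0, hyz']
      _ = _ := by field_simp
  have b1 : |A (y.toH - (flatShift h z).toH)| ≤ ε / 3 * h := by
    calc _ ≤ ‖A‖ * (√h * (C * h)) :=
          (A.le_opNorm _).trans (mul_le_mul_of_nonneg_left hyz (norm_nonneg _))
      _ = (‖A‖ * (√h * C)) * h := by ring
      _ ≤ _ := mul_le_mul_of_nonneg_right a3.le h0.le
  have b3 : |ψ s (flatShift h z) - ψ s z - h * genS (ψ s) z| ≤ ε / 3 * h := by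
    have : ψ s (flatShift h z) - ψ s z - h * genS (ψ s) z
        = ((ψ s (flatShift h z) - ψ s z) / h - genS (ψ s) z) * h := by field_simp
    rw [this, abs_mul, abs_of_pos h0]
    exact mul_le_mul_of_nonneg_right a1.le h0.le
  replace key := key.trans b2
  rw [abs_le] at b1 b3 key ⊢
  constructor <;> linarith only [b1.1, b1.2, b3.1, b3.2, key.1, key.2]

end Tests

/-! ### The value function is a viscosity solution. -/

section Viscosity

variable {d : ℕ} {τ T K : ℝ} [hτ : Fact (0 < τ)] {U : Type*} {P : Coefficients d U}

/-- The velocity of the state at time `s` with past `z` under the control value `u`. -/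
def velocity (P : Coefficients d U) (s : ℝ) (z : PathSpace d τ) (u : U) : E d :=
  P.F s (z.ev 0) (delayInner τ P.a z.ev) u + P.b s (z.ev (-τ))

theorem hamiltonian_def (s : ℝ) (z : PathSpace d τ) (p : PathSpace d τ →L[ℝ] ℝ) :
    hamiltonian P s z p = ⨅ u : U, (p (jump (velocity P s z u)) + P.q s (z.ev 0) u) := rfl

theorem norm_velocity_le (hP : CoefBound P τ T K) {s : ℝ} (hs : s ∈ Icc 0 T) (z : PathSpace d τ) :
    ∃ C ≥ 0, ∀ u, ‖velocity P s z u‖ ≤ C := by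
  have hK := hP.one_le
  refine ⟨K * (1 + ‖z.ev 0‖ + |delayInner τ P.a z.ev|) + ‖P.b s (z.ev (-τ))‖, by positivity,
    fun u => ?_⟩
  exact (norm_add_le _ _).trans (add_le_add_left (hP.F_growth s hs _ _ _) _)

theorem norm_jump_le (v : E d) : ‖(jump v : PathSpace d τ)‖ ≤ ‖v‖ := by
  refine lp.norm_le_of_forall_le (norm_nonneg _) fun η => ?_
  change ‖if 0 ≤ (η : ℝ) then v else 0‖ ≤ ‖v‖
  split_ifs <;> simp

theorem bddBelow_hamiltonian (hP : CoefBound P τ T K) {s : ℝ} (hs : s ∈ Icc 0 T)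
    (z : PathSpace d τ) (p : PathSpace d τ →L[ℝ] ℝ) :
    BddBelow (range fun u : U => p (jump (velocity P s z u)) + P.q s (z.ev 0) u) := by
  obtain ⟨C, hC, h⟩ := norm_velocity_le hP hs z
  refine ⟨-(‖p‖ * C + K * (1 + ‖z.ev 0‖)), ?_⟩
  rintro _ ⟨u, rfl⟩
  have h1 : |p (jump (velocity P s z u))| ≤ ‖p‖ * C :=
    (p.le_opNorm _).trans (by gcongr; exact (norm_jump_le _).trans (h u))
  have h2 := hP.q_growth s hs (z.ev 0) u
  simp only
  linarith [neg_le_of_abs_le h1, neg_le_of_abs_le h2]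

variable [MeasurableSpace U]

theorem velocity_integrable (hstate : StateHyp P τ T) (hP : CoefBound P τ T K) {s r : ℝ}
    (hs : s ∈ Icc 0 T) (hsr : s ≤ r) (z : PathSpace d τ) {u : ℝ → U} (hu : u ∈ controls s r) :
    IntervalIntegrable (fun σ => velocity P s z (u σ)) volume s r := by
  obtain ⟨C, hC, h⟩ := norm_velocity_le hP hs z
  rw [intervalIntegrable_iff_integrableOn_Icc_of_le hsr]
  have hm : Measurable fun σ : Icc s r => velocity P s z (u σ) := by
    have := hstate.F_meas.comp (f := fun σ : Icc s r => ((⟨s, hs⟩ : Icc (0 : ℝ) T), z.ev 0,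
      delayInner τ P.a z.ev, u σ)) (measurable_const.prodMk
        (measurable_const.prodMk (measurable_const.prodMk hu)))
    exact Measurable.add_const this _
  exact Integrable.of_bound
    (aemeasurable_restrict_of_measurable_subtype measurableSet_Icc hm).aestronglyMeasurable
    C (Eventually.of_forall fun σ => h _)

theorem frozen_cost_integrable (hcost : CostHyp P T) (hP : CoefBound P τ T K) {s r : ℝ}
    (hs : s ∈ Icc 0 T) (hsr : s ≤ r) (x : E d) {u : ℝ → U} (hu : u ∈ controls s r) :
    IntervalIntegrable (fun σ => P.q s x (u σ)) volume s r := by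
  rw [intervalIntegrable_iff_integrableOn_Icc_of_le hsr]
  have hm : Measurable fun σ : Icc s r => P.q s x (u σ) := by
    have := hcost.q_meas.comp (f := fun σ : Icc s r => ((⟨s, hs⟩ : Icc (0 : ℝ) T), x, u σ))
      (measurable_const.prodMk (measurable_const.prodMk hu))
    exact this
  exact Integrable.of_bound
    (aemeasurable_restrict_of_measurable_subtype measurableSet_Icc hm).aestronglyMeasurable
    (K * (1 + ‖x‖)) (Eventually.of_forall fun σ => hP.q_growth s hs _ _)

/-- Short-time expansion of the state and of the running cost, uniform in the control. -/
theorem trajectory_expansion (hT : 0 < T) (hstate : StateHyp P τ T) (hcost : CostHyp P T)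
    (hP : CoefBound P τ T K) {s : ℝ} (hs : s ∈ Ico 0 T) (z : PathSpace d τ) :
    ∃ C > 0, ∀ ε > 0, ∃ δ > 0, s + δ ≤ T ∧ ∀ h, 0 < h → h < δ → ∀ u ∈ controls s (s + h),
      ∀ X, IsRC X → IsTrajectory P (s + h) s z u X →
        (∀ r ∈ Icc s (s + h), ‖X r - z.ev 0‖ ≤ C * (r - s)) ∧
        ‖X (s + h) - z.ev 0 - ∫ σ in s..(s + h), velocity P s z (u σ)‖ ≤ ε * h ∧
        |(∫ σ in s..(s + h), P.q σ (X σ) (u σ)) - ∫ σ in s..(s + h), P.q s (z.ev 0) (u σ)|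
          ≤ ε * h := by
  have hτ0 := hτ.out
  obtain ⟨B, hB, hb⟩ := trajectory_bounds (P := P) (τ := τ) hT hP
  obtain ⟨L, hL, ρ, hρ, hqc⟩ := hcost.cont
  have hK := hP.one_le
  have hK0 : 0 < K := by linarith
  have hsT : s ∈ Icc 0 T := ⟨hs.1, hs.2.le⟩
  have hn := one_le_size z
  set n := size z with hn'
  -- For `h < τ` the delayed values are values of `z`, bounded by its supremum norm. So a trajectory
  -- is Lipschitz at `s`, with a constant that depends on `z` but not on the control.
  set C := K * (1 + B * n + B * n) + K * (‖z‖ + B * n) + 1 with hC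
  have hC0 : 0 < C := by positivity
  set R := ‖z‖ + B * n with hR
  have hR0 : 0 ≤ R := by positivity
  refine ⟨C, hC0, fun ε hε => ?_⟩
  have ev1 : ∀ᶠ h in 𝓝[>] (0 : ℝ), K * (h + C * h + K * (√h * (n + B * n))) + K * h * R < ε / 2 := by
    have hc : Continuous fun h : ℝ => K * (h + C * h + K * (√h * (n + B * n))) + K * h * R := by
      fun_prop
    have := (hc.tendsto 0).mono_left (nhdsWithin_le_nhds (s := Ioi 0))
    simp only [Real.sqrt_zero, zero_mul, mul_zero, add_zero] at this
    exact this.eventually (Iio_mem_nhds (by positivity))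
  have ev2 : ∀ᶠ h in 𝓝[>] (0 : ℝ), L * (C * h) + ρ h R < ε := by
    have hc : Continuous fun h : ℝ => L * (C * h) := by fun_prop
    have := ((hc.tendsto 0).mono_left (nhdsWithin_le_nhds (s := Ioi 0))).add (hρ.tendsto R hR0)
    simp only [mul_zero, add_zero] at this
    exact this.eventually (Iio_mem_nhds hε)
  -- The delayed state shortly after `s` is `z` slightly to the right of `-τ`, so right-continuity
  -- there is what freezing the velocity requires.
  have ev3 : ∀ᶠ h in 𝓝[>] (0 : ℝ), ‖z.ev (-τ + h) - z.ev (-τ)‖ < ε / (2 * K) := by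
    have h1 : Tendsto (fun h : ℝ => -τ + h) (𝓝[>] 0) (𝓝[≥] (-τ)) := by
      refine tendsto_nhdsWithin_iff.2 ⟨?_, ?_⟩
      · have : Tendsto (fun h : ℝ => -τ + h) (𝓝 0) (𝓝 (-τ + 0)) :=
          (continuous_const.add continuous_id).tendsto 0
        rw [add_zero] at this
        exact this.mono_left nhdsWithin_le_nhds
      · filter_upwards [self_mem_nhdsWithin] with h hh
        exact le_add_of_nonneg_right (mem_Ioi.1 hh).le
    have h2 := ((z.ev_rightCont (-τ)).tendsto.comp h1).eventually
      (Metric.ball_mem_nhds _ (show 0 < ε / (2 * K) by positivity))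
    filter_upwards [h2] with h hh
    exact mem_ball_iff_norm.1 hh
  have ev5 : ∀ᶠ h in 𝓝[>] (0 : ℝ), h < min τ (T - s) :=
    mem_nhdsWithin_of_mem_nhds (Iio_mem_nhds (lt_min hτ0 (sub_pos.2 hs.2)))
  obtain ⟨δ, hδ, hall⟩ := mem_nhdsGT_iff_exists_Ioo_subset.1
    (ev1.and (ev2.and (ev3.and ev5)))
  have hδ0 : 0 < δ := hδ
  refine ⟨min δ (T - s), lt_min hδ0 (sub_pos.2 hs.2), by linarith [min_le_right δ (T - s)],
    fun h h0 hhδ u hu X hX hx => ?_⟩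
  have hhδ' : h < δ := hhδ.trans_le (min_le_left _ _)
  have hhT : s + h ≤ T := by linarith [min_le_right δ (T - s)]
  have hhτ : h < τ := (hall ⟨h0, hhδ'⟩).2.2.2.trans_le (min_le_left _ _)
  have hsh : s ≤ s + h := by linarith
  have hb' := hb s (s + h) z u X hs.1 hsh hhT hu hX hx
  have hmem : ∀ r ∈ Icc s (s + h), r ∈ Icc 0 T := fun r hr => ⟨hs.1.trans hr.1, hr.2.trans hhT⟩
  have hpast : ∀ σ ∈ Icc s (s + h), X (σ - τ) = z.ev (-τ + (σ - s)) := fun σ hσ => by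
    rw [hx.past (σ - τ) ⟨by linarith [hσ.1], by linarith [hσ.2]⟩]; congr 1; ring
  have hXτ : ∀ σ ∈ Icc s (s + h), ‖X (σ - τ)‖ ≤ R := fun σ hσ => by
    rw [hpast σ hσ]
    exact (z.norm_ev_le _).trans (le_add_of_nonneg_right (by positivity))
  have i1 := fun r (hr : r ∈ Icc s (s + h)) =>
    drift_integrable hstate hP hu hX hs.1 hhT le_rfl hr.1 hr.2
  have i2 := fun r (hr : r ∈ Icc s (s + h)) => delay_integrable hP hX hs.1 hr.1 (hr.2.trans hhT)
  have hXr : ∀ r ∈ Icc s (s + h), X r - z.ev 0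
      = ∫ σ in s..r, (drift P τ u X σ + P.b σ (X (σ - τ))) := fun r hr => by
    rw [intervalIntegral.integral_add (i1 r hr) (i2 r hr), hx.eqn r hr, add_assoc,
      add_sub_cancel_left]
    rfl
  have hLip : ∀ r ∈ Icc s (s + h), ‖X r - z.ev 0‖ ≤ C * (r - s) := by
    intro r hr
    rw [hXr r hr]
    have := intervalIntegral.norm_integral_le_of_norm_le_const (a := s) (b := r) (C := C)
      (f := fun σ => drift P τ u X σ + P.b σ (X (σ - τ))) fun σ hσ => ?_
    · rwa [abs_of_nonneg (sub_nonneg.2 hr.1)] at this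
    · rw [uIoc_of_le hr.1] at hσ
      have hσ' : σ ∈ Icc s (s + h) := ⟨hσ.1.le, hσ.2.trans hr.2⟩
      have h1 : ‖drift P τ u X σ‖ ≤ K * (1 + B * n + B * n) := by
        refine (hP.F_growth σ (hmem σ hσ') _ _ _).trans ?_
        have := (hb' σ hσ').1
        have := (hb' σ hσ').2.1
        gcongr
      have h2 : ‖P.b σ (X (σ - τ))‖ ≤ K * R := by
        refine ((P.b σ).le_opNorm _).trans ?_
        have := hP.b_le σ (hmem σ hσ')
        have := hXτ σ hσ'
        gcongr
      refine (norm_add_le _ _).trans ?_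
      rw [hC]
      linarith
  refine ⟨hLip, ?_, ?_⟩
  · have hr : s + h ∈ Icc s (s + h) := ⟨hsh, le_rfl⟩
    rw [hXr _ hr, ← intervalIntegral.integral_sub ((i1 _ hr).add (i2 _ hr))
      (velocity_integrable hstate hP hsT hsh z hu)]
    have := intervalIntegral.norm_integral_le_of_norm_le_const (a := s) (b := s + h) (C := ε)
      (f := fun σ => drift P τ u X σ + P.b σ (X (σ - τ)) - velocity P s z (u σ)) fun σ hσ => ?_
    · rwa [add_sub_cancel_left, abs_of_pos h0] at this
    · rw [uIoc_of_le hsh] at hσ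
      have hσ' : σ ∈ Icc s (s + h) := ⟨hσ.1.le, hσ.2⟩
      have hk0 : 0 < σ - s := by linarith [hσ.1]
      have hkδ : σ - s < δ := by linarith [hσ.2]
      -- The smallness conditions hold on the whole interval `(0, δ)`, so they can be used at the
      -- elapsed time `σ - s`.
      obtain ⟨a1, a2, a3, a4⟩ := hall ⟨hk0, hkδ⟩
      set k := σ - s with hk
      have h1 : |(delayInner τ P.a fun θ => X (σ + θ)) - delayInner τ P.a z.ev|
          ≤ K * (√k * (n + B * n)) := by
        have e : (delayInner τ P.a fun θ => X (σ + θ))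
            = delayInner τ P.a (seg X σ : PathSpace d τ).ev :=
          delayInner_congr P.a fun θ hθ => (seg_ev hX σ hθ).symm
        rw [e, delayInner_sub hP ((isRC_ev _).intervalIntegrable _ _)
          ((isRC_ev _).intervalIntegrable _ _)]
        have h3 : weakDist (seg X σ) z ≤ √k * (n + B * n) := by
          refine (weakDist_continuation hk0.le fun θ hθ hθr => ?_).trans ?_
          · rw [seg_ev hX σ hθ, hx.past (σ + θ) ⟨by linarith [hθ.1], by linarith⟩]
            congr 1; rw [hk]; ring
          · gcongr
            · exact norm_toH_le_size z
            · exact (hb' σ hσ').2.2.1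
        refine hP.a_weak _ _ (((isRC_ev _).sub (isRC_ev _)).intervalIntegrable _ _) fun l hl => ?_
        exact (le_weakDist (seg X σ) z hl).trans h3
      have h2 : ‖drift P τ u X σ - P.F s (z.ev 0) (delayInner τ P.a z.ev) (u σ)‖
          ≤ K * (k + C * k + K * (√k * (n + B * n))) := by
        refine (hP.F_lip σ (hmem σ hσ') s hsT _ _ _ _ _).trans ?_
        have := hLip σ hσ'
        have e : |s - σ| = k := by rw [abs_sub_comm, abs_of_pos hk0]
        rw [e]
        gcongr
      have h4 : ‖P.b σ (X (σ - τ)) - P.b s (z.ev (-τ))‖ ≤ K * k * R + ε / 2 := by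
        have e : P.b σ (X (σ - τ)) - P.b s (z.ev (-τ)) = (P.b σ - P.b s) (X (σ - τ))
            + P.b s (X (σ - τ) - z.ev (-τ)) := by
          rw [map_sub]; simp
        rw [e]
        refine (norm_add_le _ _).trans (add_le_add ?_ ?_)
        · refine ((P.b σ - P.b s).le_opNorm _).trans ?_
          have b1 := hP.b_lip s hsT σ (hmem σ hσ')
          rw [abs_of_pos hk0] at b1
          have b2 := hXτ σ hσ'
          gcongr
        · refine ((P.b s).le_opNorm _).trans ?_
          have b1 := hP.b_le s hsT
          rw [hpast σ hσ']
          calc _ ≤ K * (ε / (2 * K)) := by gcongr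
            _ = _ := by field_simp
      have e5 : drift P τ u X σ + P.b σ (X (σ - τ)) - velocity P s z (u σ)
          = (drift P τ u X σ - P.F s (z.ev 0) (delayInner τ P.a z.ev) (u σ))
            + (P.b σ (X (σ - τ)) - P.b s (z.ev (-τ))) := by
        rw [velocity]; abel
      rw [e5]
      refine (norm_add_le _ _).trans ?_
      linarith
  · rw [← intervalIntegral.integral_sub (cost_integrable hcost hP hu hX hs.1 hhT le_rfl hsh le_rfl)
      (frozen_cost_integrable hcost hP hsT hsh _ hu)]
    have := intervalIntegral.norm_integral_le_of_norm_le_const (a := s) (b := s + h) (C := ε)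
      (f := fun σ => P.q σ (X σ) (u σ) - P.q s (z.ev 0) (u σ)) fun σ hσ => ?_
    · rwa [add_sub_cancel_left, abs_of_pos h0] at this
    · rw [uIoc_of_le hsh] at hσ
      have hσ' : σ ∈ Icc s (s + h) := ⟨hσ.1.le, hσ.2⟩
      have hk0 : 0 < σ - s := by linarith [hσ.1]
      have hkδ : σ - s < δ := by linarith [hσ.2]
      obtain ⟨a1, a2, a3, a4⟩ := hall ⟨hk0, hkδ⟩
      have h1 := hqc σ (hmem σ hσ') s hsT (X σ) (z.ev 0) (u σ)
      have h2 := abs_nonneg (P.φ (X σ) - P.φ (z.ev 0))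
      have h3 : max ‖X σ‖ ‖z.ev 0‖ ≤ R := by
        refine max_le ((hb' σ hσ').1.trans ?_) ((z.norm_ev_le _).trans ?_)
        · exact le_add_of_nonneg_left (norm_nonneg _)
        · exact le_add_of_nonneg_right (by positivity)
      rw [abs_sub_comm s σ, abs_of_pos hk0] at h1
      have h4 := hρ.mono (σ - s) hk0.le _ (le_max_of_le_left (norm_nonneg _)) (σ - s) le_rfl R h3
      have h5 : L * ‖X σ - z.ev 0‖ ≤ L * (C * (σ - s)) := by
        gcongr; exact hLip σ hσ'
      rw [Real.norm_eq_abs]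
      linarith

omit [MeasurableSpace U] in
theorem IsTrajectory.concat_seg {s h : ℝ} {z : PathSpace d τ} {u : ℝ → U} {X : ℝ → E d}
    (hh : 0 ≤ h) (hx : IsTrajectory P (s + h) s z u X) (hX : IsRC X) :
    concat s z (s + h) (seg X (s + h)) = seg X (s + h) := by
  refine path_ext fun θ hθ => ?_
  rw [concat_ev _ _ _ _ hθ]
  split_ifs with h1
  · rfl
  · push Not at h1
    rw [seg_ev hX _ hθ, hx.past (s + h + θ) ⟨by linarith [hθ.1], by linarith⟩]
    congr 1; ring

omit [MeasurableSpace U] in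
theorem IsTrajectory.seg_mem_pathsIn {s h : ℝ} {z : PathSpace d τ} {u : ℝ → U} {X : ℝ → E d}
    (hh : 0 ≤ h) (hx : IsTrajectory P (s + h) s z u X) (hX : IsRC X) {A : Set (E d)}
    (hz : z ∈ pathsIn A)
    (hA : ∀ r ∈ Icc s (s + h), X r ∈ A) : seg X (s + h) ∈ (pathsIn A : Set (PathSpace d τ)) := by
  intro θ hθ
  rw [seg_ev hX _ hθ]
  rcases le_total s (s + h + θ) with h1 | h1
  · exact hA _ ⟨h1, by linarith [hθ.2]⟩
  · rw [hx.past (s + h + θ) ⟨by linarith [hθ.1], h1⟩]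
    exact hz _ ⟨by linarith [hθ.1], by linarith⟩

/-- Short-time expansion of a test function along all trajectories, uniform in the control. -/
theorem IsTest.trajectory_expansion (hT : 0 < T) (hstate : StateHyp P τ T) (hcost : CostHyp P T)
    (hP : CoefBound P τ T K) {s : ℝ} (hs : s ∈ Ico 0 T) (z : PathSpace d τ) {Q : Set (E d)}
    (hQ : IsOpen Q) (hz : z ∈ pathsIn (closure Q)) (hz0 : z.ev 0 ∈ Q)
    {ψ : ℝ → PathSpace d τ → ℝ} (hψ : IsTest T ψ) {ε : ℝ} (hε : 0 < ε) :
    ∃ h > 0, s + h ≤ T ∧ ∀ u ∈ controls s (s + h), ∀ X, IsRC X → IsTrajectory P (s + h) s z u X →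
      seg X (s + h) ∈ (pathsIn (closure Q) : Set (PathSpace d τ)) ∧
      IntervalIntegrable (fun σ => fderiv ℝ (ψ s) z (jump (velocity P s z (u σ)))) volume s (s + h) ∧
      |ψ (s + h) (seg X (s + h)) - ψ s z - (h * (dt T ψ s z + genS (ψ s) z)
          + ∫ σ in s..(s + h), fderiv ℝ (ψ s) z (jump (velocity P s z (u σ))))| ≤ ε * h ∧
      |(∫ σ in s..(s + h), P.q σ (X σ) (u σ)) - ∫ σ in s..(s + h), P.q s (z.ev 0) (u σ)|
          ≤ ε * h := by
  obtain ⟨G, hG, hexp⟩ := hψ.expansion hs z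
  obtain ⟨C, hC, htr⟩ := DelayHJB.trajectory_expansion hT hstate hcost hP hs z
  obtain ⟨δ₁, hδ₁, h1⟩ := hexp C hC.le (ε / 2) (by positivity)
  obtain ⟨δ₂, hδ₂, hδT, h2⟩ := htr (min ε (ε / (2 * (‖G‖ + 1)))) (by positivity)
  obtain ⟨r, hr, hball⟩ := Metric.isOpen_iff.1 hQ _ hz0
  have hsT : s ∈ Icc 0 T := ⟨hs.1, hs.2.le⟩
  -- `C * h < r` keeps the state inside `Q`, so the segment reached is an admissible competitor. The
  -- choice is made before any control is named.
  set h := min (min δ₁ δ₂) (r / C) / 2 with hh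
  have hm : 0 < min (min δ₁ δ₂) (r / C) := by positivity
  have h0 : 0 < h := by positivity
  have hhm : h < min (min δ₁ δ₂) (r / C) := half_lt_self hm
  have hhδ₁ : h < δ₁ := hhm.trans_le ((min_le_left _ _).trans (min_le_left _ _))
  have hhδ₂ : h < δ₂ := hhm.trans_le ((min_le_left _ _).trans (min_le_right _ _))
  have hhr : C * h < r := by
    have := hhm.trans_le (min_le_right _ _)
    rw [lt_div_iff₀ hC] at this
    linarith
  refine ⟨h, h0, by linarith, fun u hu X hX hx => ?_⟩
  obtain ⟨b1, b2, b3⟩ := h2 h h0 hhδ₂ u hu X hX hx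
  have hsh : s ≤ s + h := by linarith
  have hvi := velocity_integrable hstate hP hsT hsh z hu
  have hGi : IntervalIntegrable (fun σ => G (velocity P s z (u σ))) volume s (s + h) :=
    ⟨G.integrable_comp hvi.1, G.integrable_comp hvi.2⟩
  have hmem : seg X (s + h) ∈ (pathsIn (closure Q) : Set (PathSpace d τ)) := by
    refine IsTrajectory.seg_mem_pathsIn h0.le hx hX hz fun r' hr' => subset_closure (hball (mem_ball_iff_norm.2 ?_))
    refine (b1 r' hr').trans_lt (lt_of_le_of_lt ?_ hhr)
    gcongr
    linarith [hr'.2]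
  simp only [hG]
  refine ⟨hmem, hGi, ?_, b3.trans (by gcongr; exact min_le_left _ _)⟩
  have key := h1 h h0 hhδ₁ (seg X (s + h)) (fun θ hθ hθh => ?_) (fun θ hθ hθh => ?_)
  · rw [seg_ev_zero hX] at key
    rw [G.intervalIntegral_comp_comm hvi]
    have c1 : |G (X (s + h) - z.ev 0) - G (∫ σ in s..(s + h), velocity P s z (u σ))|
        ≤ ε / 2 * h := by
      rw [← map_sub]
      calc _ ≤ ‖G‖ * (ε / (2 * (‖G‖ + 1)) * h) := by
            refine (G.le_opNorm _).trans ?_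
            gcongr
            refine b2.trans ?_
            gcongr
            exact min_le_right _ _
        _ = (‖G‖ / (‖G‖ + 1)) * (ε / 2 * h) := by field_simp
        _ ≤ _ := by
            refine mul_le_of_le_one_left (by positivity) ?_
            rw [div_le_one (by positivity)]
            linarith
    rw [abs_le] at key c1 ⊢
    constructor <;> linarith
  · rw [seg_ev hX _ hθ, hx.past (s + h + θ) ⟨by linarith [hθ.1], by linarith⟩]
    congr 1; ring
  · rw [seg_ev hX _ hθ]
    refine (b1 _ ⟨by linarith, by linarith [hθ.2]⟩).trans ?_
    gcongr
    linarith [hθ.2]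

/-- Every constant control is a competitor in `dpp_le`. Maximality bounds the increment of the value
by that of the test function; dividing by `h` gives the inequality for each control value, hence for
the infimum. -/
theorem isSubsolution_valueFunction [Nonempty U] (hT : 0 < T) (hstate : StateHyp P τ T)
    (hcost : CostHyp P T) (hP : CoefBound P τ T K) :
    IsSubsolution P T (valueFunction (τ := τ) P T) := by
  refine ⟨(valueFunction_mem_class hT hstate hcost hP).continuousOn,
    fun x => (valueFunction_terminal hT hstate hP x).le, ?_⟩
  intro Q hQ _ ψ hψ s hs z hz hz0 hlub
  have hsT : s ∈ Icc 0 T := ⟨hs.1, hs.2.le⟩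
  rw [hamiltonian_def]
  suffices h : -(dt T ψ s z + genS (ψ s) z) ≤
      ⨅ u : U, (fderiv ℝ (ψ s) z (jump (velocity P s z u)) + P.q s (z.ev 0) u) by linarith
  refine le_ciInf fun u => le_of_forall_pos_le_add fun ε hε => ?_
  obtain ⟨h, h0, hhT, hexp⟩ := hψ.trajectory_expansion hT hstate hcost hP hs z hQ hz hz0
    (half_pos hε)
  have hu := const_mem_controls u s (s + h)
  have hsh : s ≤ s + h := by linarith
  obtain ⟨X, hX, hx⟩ := exists_trajectory hstate hP hs.1 hsh hhT z hu
  obtain ⟨a1, -, a3, a4⟩ := hexp _ hu X hX hx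
  have h1 := hlub.1 ⟨s + h, ⟨hsh, hhT⟩, seg X (s + h), a1, rfl⟩
  have h2 := dpp_le hT hstate hcost hP hs.1 hsh hhT hu hX hx
  rw [IsTrajectory.concat_seg h0.le hx hX] at h1
  simp only [intervalIntegral.integral_const, add_sub_cancel_left, smul_eq_mul] at a3 a4
  set D := fderiv ℝ (ψ s) z (jump (velocity P s z u))
  set S := dt T ψ s z + genS (ψ s) z
  have h3 : 0 ≤ h * (S + (D + P.q s (z.ev 0) u + ε)) := by
    rw [abs_le] at a3 a4
    linarith [a3.2, a4.2]
  have h4 := nonneg_of_mul_nonneg_right h3 h0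
  linarith

/-- Nearly optimal controls depend on `h` and need not converge, so the expansion has to be uniform
in the control. The integrand along the control is at least the Hamiltonian at almost no cost, since
the Hamiltonian is an infimum over control values. -/
theorem isSupersolution_valueFunction [Nonempty U] (hT : 0 < T) (hstate : StateHyp P τ T)
    (hcost : CostHyp P T) (hP : CoefBound P τ T K) :
    IsSupersolution P T (valueFunction (τ := τ) P T) := by
  refine ⟨(valueFunction_mem_class hT hstate hcost hP).continuousOn,
    fun x => (valueFunction_terminal hT hstate hP x).ge, ?_⟩
  intro Q hQ _ ψ hψ s hs z hz hz0 hglb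
  have hsT : s ∈ Icc 0 T := ⟨hs.1, hs.2.le⟩
  refine le_of_forall_pos_le_add fun ε hε => ?_
  obtain ⟨h, h0, hhT, hexp⟩ := hψ.trajectory_expansion hT hstate hcost hP hs z hQ hz hz0
    (show 0 < ε / 3 by positivity)
  have hsh : s ≤ s + h := by linarith
  -- The optimality error is of order `h`, so it survives the division by `h` as `ε / 3`.
  obtain ⟨u, hu, X, hX, hx, hge⟩ := dpp_ge hT hstate hcost hP hsT z (show 0 < ε / 3 * h by positivity)
  have hu' := controls_mono hu le_rfl hhT
  have hx' := hx.mono hhT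
  obtain ⟨a1, a2, a3, a4⟩ := hexp u hu' X hX hx'
  have h1 := hglb.1 ⟨s + h, ⟨hsh, hhT⟩, seg X (s + h), a1, rfl⟩
  have h2 := hge (s + h) ⟨hsh, hhT⟩
  rw [IsTrajectory.concat_seg h0.le hx' hX] at h1
  have hqi := frozen_cost_integrable hcost hP hsT hsh (z.ev 0) hu'
  have h3 : h * hamiltonian P s z (-fderiv ℝ (ψ s) z) ≤ (∫ σ in s..(s + h), P.q s (z.ev 0) (u σ))
      - ∫ σ in s..(s + h), fderiv ℝ (ψ s) z (jump (velocity P s z (u σ))) := by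
    rw [← intervalIntegral.integral_sub hqi a2]
    have : ∫ σ in s..(s + h), hamiltonian P s z (-fderiv ℝ (ψ s) z)
        ≤ ∫ σ in s..(s + h), (P.q s (z.ev 0) (u σ)
          - fderiv ℝ (ψ s) z (jump (velocity P s z (u σ)))) := by
      refine intervalIntegral.integral_mono_on hsh intervalIntegrable_const (hqi.sub a2)
        fun σ _ => ?_
      have := ciInf_le (bddBelow_hamiltonian hP hsT z (-fderiv ℝ (ψ s) z)) (u σ)
      rw [hamiltonian_def]
      refine this.trans_eq ?_
      simp only [neg_apply]
      ring
    simpa using this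
  set D := ∫ σ in s..(s + h), fderiv ℝ (ψ s) z (jump (velocity P s z (u σ)))
  set H := hamiltonian P s z (-fderiv ℝ (ψ s) z)
  have h4 : 0 ≤ h * (0 + ε - (-dt T ψ s z - genS (ψ s) z + H)) := by
    rw [abs_le] at a3 a4
    linarith [a3.2, a4.1]
  have h5 := nonneg_of_mul_nonneg_right h4 h0
  linarith

end Viscosity

/-! ### The integration operator -/

section Volterra

variable {d : ℕ} {τ : ℝ} [hτ : Fact (0 < τ)]

theorem norm_sq_eq_integral (f : HSpace d τ) : ‖f‖ ^ 2 = ∫ θ in (-τ)..0, ‖f θ‖ ^ 2 := by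
  rw [← real_inner_self_eq_norm_sq, L2.inner_def, intervalIntegral.integral_of_le neg_le_zero',
    ← integral_Icc_eq_integral_Ioc]
  exact integral_congr_ae (Eventually.of_forall fun θ => real_inner_self_eq_norm_sq _)

theorem integrable_HSpace (f : HSpace d τ) : Integrable f (volume.restrict (Icc (-τ) (0 : ℝ))) :=
  (Lp.memLp f).integrable one_le_two

theorem integral_norm_le_HSpace (f : HSpace d τ) :
    ∫ θ in Icc (-τ) 0, ‖f θ‖ ≤ √τ * ‖f‖ := by
  have h1 : IntervalIntegrable (fun θ => ‖f θ‖) volume (-τ) 0 := by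
    rw [intervalIntegrable_iff_integrableOn_Icc_of_le neg_le_zero']
    exact (integrable_HSpace f).norm
  have h2 : IntervalIntegrable (fun θ => ‖f θ‖ ^ 2) volume (-τ) 0 := by
    rw [intervalIntegrable_iff_integrableOn_Icc_of_le neg_le_zero']
    exact (Lp.memLp f).integrable_norm_pow two_ne_zero
  have h3 := sq_integral_le neg_le_zero' h1 h2
  rw [← norm_sq_eq_integral] at h3
  rw [integral_Icc_eq_integral_Ioc, ← intervalIntegral.integral_of_le neg_le_zero']
  refine abs_le_of_sq_le_sq' ?_ (by positivity) |>.2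
  rw [mul_pow, Real.sq_sqrt hτ.out.le]
  linarith

theorem norm_primitive_le_HSpace (f : HSpace d τ) (l : ℝ) :
    ‖∫ θ in l..0, f θ ∂(volume.restrict (Icc (-τ) (0 : ℝ)))‖ ≤ √τ * ‖f‖ := by
  refine (intervalIntegral.norm_integral_le_integral_norm_uIoc).trans
    (le_trans ?_ (integral_norm_le_HSpace f))
  exact setIntegral_le_integral (integrable_HSpace f).norm (Eventually.of_forall fun _ => norm_nonneg _)

theorem continuous_primitive_HSpace (f : HSpace d τ) :
    Continuous fun l : ℝ => ∫ θ in l..0, f θ ∂(volume.restrict (Icc (-τ) (0 : ℝ))) := by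
  have := (intervalIntegral.continuous_primitive
    (fun a b => (integrable_HSpace f).intervalIntegrable (a := a) (b := b)) 0).neg
  refine this.congr fun l => ?_
  rw [Pi.neg_apply, intervalIntegral.integral_symm, neg_neg]

/-- The path `l ↦ ∫_l^0 f` for `f ∈ H`. -/
def primitivePath (f : HSpace d τ) : PathSpace d τ :=
  PathSpace.mk' (fun l => ∫ θ in l..0, f θ ∂(volume.restrict (Icc (-τ) (0 : ℝ))))
    ⟨_, norm_primitive_le_HSpace f⟩ fun l => (continuous_primitive_HSpace f).continuousWithinAt

theorem primitivePath_ev' (f : HSpace d τ) {l : ℝ} (hl : l ∈ Icc (-τ) 0) :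
    (primitivePath f).ev l = ∫ θ in l..0, f θ ∂(volume.restrict (Icc (-τ) (0 : ℝ))) :=
  PathSpace.ev_mk' _ _ _ hl

theorem norm_path_le (x : PathSpace d τ) {C : ℝ} (hC : ∀ θ ∈ Icc (-τ) 0, ‖x.ev θ‖ ≤ C) :
    ‖x‖ ≤ C := by
  refine lp.norm_le_of_forall_le ((norm_nonneg _).trans (hC 0 mem_zero)) fun θ => ?_
  exact (congrArg norm (x.ev_of_mem θ.2)).ge.trans (hC _ θ.2)

/-- Integration from the right end point, as a continuous linear map `H → 𝒟`. -/
def primitiveL : HSpace d τ →L[ℝ] PathSpace d τ :=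
  LinearMap.mkContinuous
    { toFun := primitivePath
      map_add' := fun f g => path_ext fun l hl => by
        rw [ev_add, primitivePath_ev' _ hl, primitivePath_ev' _ hl, primitivePath_ev' _ hl,
          ← intervalIntegral.integral_add (integrable_HSpace f).intervalIntegrable
            (integrable_HSpace g).intervalIntegrable]
        refine intervalIntegral.integral_congr_ae ?_
        filter_upwards [Lp.coeFn_add f g] with θ hθ _
        rw [hθ, Pi.add_apply]
      map_smul' := fun c f => path_ext fun l hl => by
        rw [RingHom.id_apply, ev_smul, primitivePath_ev' _ hl, primitivePath_ev' _ hl,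
          ← intervalIntegral.integral_smul]
        refine intervalIntegral.integral_congr_ae ?_
        filter_upwards [Lp.coeFn_smul c f] with θ hθ _
        rw [hθ, Pi.smul_apply] }
    (√τ) fun f => norm_path_le _ fun θ hθ => by
      change ‖(primitivePath f).ev θ‖ ≤ _
      rw [primitivePath_ev' f hθ]
      exact norm_primitive_le_HSpace f θ

theorem primitiveL_ev (x : PathSpace d τ) {l : ℝ} (hl : l ∈ Icc (-τ) 0) :
    (primitiveL x.toH).ev l = ∫ θ in l..0, x.ev θ := by
  change (primitivePath x.toH).ev l = _
  rw [primitivePath_ev' _ hl, intervalIntegral.integral_of_le hl.2,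
    intervalIntegral.integral_of_le hl.2, Measure.restrict_restrict measurableSet_Ioc,
    inter_eq_left.2 (show Ioc l 0 ⊆ Icc (-τ) 0 from fun θ hθ => ⟨hl.1.trans hθ.1.le, hθ.2⟩)]
  refine integral_congr_ae ?_
  have := x.memLp.coeFn_toLp
  exact ae_mono (Measure.restrict_mono
    (show Ioc l 0 ⊆ Icc (-τ) 0 from fun θ hθ => ⟨hl.1.trans hθ.1.le, hθ.2⟩) le_rfl) this

/-- The constant path. -/
def constPath (v : E d) : PathSpace d τ :=
  PathSpace.mk' (fun _ => v) ⟨‖v‖, fun _ => le_rfl⟩ fun _ => continuousWithinAt_const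

theorem constPath_ev (v : E d) {θ : ℝ} (hθ : θ ∈ Icc (-τ) 0) :
    (constPath v : PathSpace d τ).ev θ = v :=
  PathSpace.ev_mk' _ _ _ hθ

theorem inner_toH (x y : PathSpace d τ) :
    inner ℝ x.toH y.toH = ∫ θ in (-τ)..0, inner ℝ (x.ev θ) (y.ev θ) := by
  rw [L2.inner_def, intervalIntegral.integral_of_le neg_le_zero', ← integral_Icc_eq_integral_Ioc]
  refine integral_congr_ae ?_
  filter_upwards [x.memLp.coeFn_toLp, y.memLp.coeFn_toLp] with θ h1 h2
  rw [PathSpace.toH, PathSpace.toH, h1, h2]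

omit hτ in
theorem IsRC.hasDerivWithinAt_integral {f : ℝ → E d} (hf : IsRC f) (a c : ℝ) :
    HasDerivWithinAt (fun r => ∫ θ in a..r, f θ) (f c) (Ici c) c :=
  intervalIntegral.integral_hasDerivWithinAt_right (hf.intervalIntegrable _ _)
    (hf.measurable.stronglyMeasurable.stronglyMeasurableAtFilter) ((hf.rc c).mono Ioi_subset_Ici_self)

/-- `2 ∫ ⟨G, g⟩ = |G(-τ)|²` for `G(l) = ∫_l^0 g`. -/
theorem two_inner_primitive (g : PathSpace d τ) :
    2 * inner ℝ (primitiveL g.toH).toH g.toH = ‖(primitiveL g.toH).ev (-τ)‖ ^ 2 := by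
  have hg := isRC_ev g
  have hc : Continuous fun l : ℝ => ∫ θ in l..0, g.ev θ := by
    have := (intervalIntegral.continuous_primitive (fun a b => hg.intervalIntegrable a b) 0).neg
    refine this.congr fun l => ?_
    rw [Pi.neg_apply, intervalIntegral.integral_symm, neg_neg]
  have hd : ∀ l, HasDerivWithinAt (fun l => ‖∫ θ in l..0, g.ev θ‖ ^ 2)
      (2 * inner ℝ (∫ θ in l..0, g.ev θ) (-g.ev l)) (Ici l) l := by
    intro l
    have h1 : HasDerivWithinAt (fun l => ∫ θ in l..0, g.ev θ) (-g.ev l) (Ici l) l := by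
      refine (hg.hasDerivWithinAt_integral 0 l).neg.congr (fun r _ => ?_) ?_ <;>
      exact intervalIntegral.integral_symm _ _
    exact h1.norm_sq
  have hint : IntervalIntegrable (fun l => 2 * inner ℝ (∫ θ in l..0, g.ev θ) (-g.ev l)) volume
      (-τ) 0 := by
    obtain ⟨C, hC⟩ := hg.bdd
    refine IntervalIntegrable.const_mul ?_ 2
    have hm : Measurable fun l => inner ℝ (∫ θ in l..0, g.ev θ) (-g.ev l) :=
      hc.measurable.inner hg.measurable.neg
    refine ((hc.norm.mul_const C).intervalIntegrable (-τ) 0).mono_fun hm.aestronglyMeasurable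
      (Eventually.of_forall fun l => ?_)
    refine (norm_inner_le_norm (𝕜 := ℝ) _ _).trans ?_
    rw [norm_neg]
    refine le_trans ?_ (le_abs_self _)
    gcongr
    exact hC l
  have key := intervalIntegral.integral_eq_sub_of_hasDeriv_right
    (f := fun l => ‖∫ θ in l..0, g.ev θ‖ ^ 2) (a := -τ) (b := 0)
    (hc.norm.pow 2).continuousOn (fun l _ => (hd l).mono Ioi_subset_Ici_self) hint
  rw [inner_toH, primitiveL_ev g mem_left, ← intervalIntegral.integral_const_mul]
  have e : ∫ θ in (-τ)..0, 2 * inner ℝ ((primitiveL g.toH).ev θ) (g.ev θ)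
      = -∫ l in (-τ)..0, 2 * inner ℝ (∫ θ in l..0, g.ev θ) (-g.ev l) := by
    rw [← intervalIntegral.integral_neg]
    refine intervalIntegral.integral_congr fun θ hθ => ?_
    rw [uIcc_of_le neg_le_zero'] at hθ
    simp only [primitiveL_ev g hθ, inner_neg_right]
    ring
  rw [e, key]
  simp

/-! ### Right derivatives along the flat continuation -/

theorem flatShift_zero (x : PathSpace d τ) : flatShift 0 x = x :=
  path_ext fun θ hθ => by rw [flatShift_ev 0 x hθ, zero_add]

theorem flatShift_ev_zero {h : ℝ} (hh : 0 ≤ h) (x : PathSpace d τ) :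
    (flatShift h x).ev 0 = x.ev 0 := by
  rw [flatShift_ev h x mem_zero, ev_of_le x (by linarith)]

/-- The right derivative of a moving window integral. -/
theorem hasDerivWithinAt_window {G : Type*} [NormedAddCommGroup G] [NormedSpace ℝ G]
    [CompleteSpace G] {g : ℝ → G} (hi : ∀ a b, IntervalIntegrable g volume a b)
    (hm : StronglyMeasurable g) (hc : ∀ r, ContinuousWithinAt g (Ici r) r) (p q : ℝ) :
    HasDerivWithinAt (fun h => ∫ θ in p..q, g (h + θ)) (g q - g p) (Ici 0) 0 := by
  have hF : ∀ c, HasDerivWithinAt (fun h => ∫ θ in p..(h + c), g θ) (g c) (Ici 0) 0 := by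
    intro c
    have h1 : HasDerivWithinAt (fun r => ∫ θ in p..r, g θ) (g (0 + c)) (Ici (0 + c)) (0 + c) :=
      intervalIntegral.integral_hasDerivWithinAt_right (hi _ _)
        hm.stronglyMeasurableAtFilter ((hc _).mono Ioi_subset_Ici_self)
    have h2 : HasDerivWithinAt (fun h : ℝ => h + c) 1 (Ici 0) 0 :=
      (hasDerivWithinAt_id 0 _).add_const c
    have := h1.scomp 0 h2 (fun h hh => by simpa using hh)
    simpa [Function.comp_def] using this
  refine ((hF q).sub (hF p)).congr_of_mem (fun h hh => ?_) self_mem_Ici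
  rw [intervalIntegral.integral_comp_add_left (fun θ => g θ), Pi.sub_apply,
    intervalIntegral.integral_interval_sub_left (hi _ _) (hi _ _)]

theorem hasDerivWithinAt_primitive_left (x : PathSpace d τ) :
    HasDerivWithinAt (fun h => (primitiveL (flatShift h x).toH).ev (-τ)) (x.ev 0 - x.ev (-τ))
      (Ici 0) 0 := by
  refine (hasDerivWithinAt_window (isRC_ev x).intervalIntegrable
    (isRC_ev x).measurable.stronglyMeasurable (isRC_ev x).rc (-τ) 0).congr_of_mem
    (fun h hh => ?_) self_mem_Ici
  rw [primitiveL_ev _ mem_left]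
  refine intervalIntegral.integral_congr fun θ hθ => ?_
  rw [uIcc_of_le neg_le_zero'] at hθ
  exact flatShift_ev h x hθ

theorem hasDerivWithinAt_norm_sq (x : PathSpace d τ) :
    HasDerivWithinAt (fun h => ‖(flatShift h x).toH‖ ^ 2) (‖x.ev 0‖ ^ 2 - ‖x.ev (-τ)‖ ^ 2)
      (Ici 0) 0 := by
  refine (hasDerivWithinAt_window (isRC_ev x).sq_intervalIntegrable
    ((isRC_ev x).measurable.norm.pow_const 2).stronglyMeasurable
    (fun r => ((isRC_ev x).rc r).norm.pow 2) (-τ) 0).congr_of_mem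
    (fun h hh => ?_) self_mem_Ici
  rw [norm_toH_sq]
  refine intervalIntegral.integral_congr fun θ hθ => ?_
  rw [uIcc_of_le neg_le_zero'] at hθ
  simp only [flatShift_ev h x hθ]

/-- The difference quotients converge at each time and are uniformly bounded, so they converge in
`H` by dominated convergence. Convergence in `𝒟` may fail because `x` is merely right-continuous. -/
theorem hasDerivWithinAt_primitive (x : PathSpace d τ) :
    HasDerivWithinAt (fun h => (primitiveL (flatShift h x).toH).toH) (constPath (x.ev 0) - x).toH
      (Ici 0) 0 := by
  have hx := isRC_ev x
  have hwin := fun l => hasDerivWithinAt_window hx.intervalIntegrable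
    hx.measurable.stronglyMeasurable hx.rc l 0
  set A : ℝ → PathSpace d τ := fun h =>
    h⁻¹ • (primitiveL (flatShift h x).toH - primitiveL x.toH) - (constPath (x.ev 0) - x) with hA
  have hAev : ∀ h, ∀ l ∈ Icc (-τ) 0, (A h).ev l
      = h⁻¹ • ((∫ θ in l..0, x.ev (h + θ)) - ∫ θ in l..0, x.ev θ) - (x.ev 0 - x.ev l) := by
    intro h l hl
    rw [hA, ev_sub, ev_smul, ev_sub, ev_sub, constPath_ev _ hl, primitiveL_ev _ hl,
      primitiveL_ev _ hl]
    congr 3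
    refine intervalIntegral.integral_congr fun θ hθ => ?_
    rw [uIcc_of_le hl.2] at hθ
    exact flatShift_ev h x ⟨hl.1.trans hθ.1, hθ.2⟩
  have hlim : ∀ l ∈ Icc (-τ) 0, Tendsto (fun h => (A h).ev l) (𝓝[>] 0) (𝓝 0) := by
    intro l hl
    have h1 := (hasDerivWithinAt_iff_tendsto_slope.1 (hwin l)).sub_const (x.ev 0 - x.ev l)
    rw [Ici_sdiff_left, sub_self] at h1
    refine h1.congr fun h => ?_
    rw [hAev h l hl, slope_def_module]
    simp
  have hbd : ∀ h > 0, ∀ l ∈ Icc (-τ) 0, ‖(A h).ev l‖ ≤ 4 * ‖x‖ := by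
    intro h hh l hl
    have b : ∀ c, ‖∫ θ in c..(h + c), x.ev θ‖ ≤ ‖x‖ * h := fun c => by
      have := intervalIntegral.norm_integral_le_of_norm_le_const (a := c) (b := h + c)
        (f := x.ev) fun θ _ => x.norm_ev_le θ
      rwa [add_sub_cancel_right, abs_of_pos hh] at this
    have e : (∫ θ in l..0, x.ev (h + θ)) - ∫ θ in l..0, x.ev θ
        = (∫ θ in 0..(h + 0), x.ev θ) - ∫ θ in l..(h + l), x.ev θ := by
      rw [intervalIntegral.integral_comp_add_left (fun θ => x.ev θ),
        intervalIntegral.integral_interval_sub_interval_comm' (hx.intervalIntegrable _ _)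
          (hx.intervalIntegrable _ _) (hx.intervalIntegrable _ _)]
    rw [hAev h l hl, e]
    calc _ ≤ ‖h⁻¹ • ((∫ θ in 0..(h + 0), x.ev θ) - ∫ θ in l..(h + l), x.ev θ)‖ + ‖x.ev 0 - x.ev l‖ :=
          norm_sub_le _ _
      _ ≤ h⁻¹ * (‖x‖ * h + ‖x‖ * h) + (‖x‖ + ‖x‖) := by
          rw [norm_smul, Real.norm_of_nonneg (inv_nonneg.2 hh.le)]
          gcongr
          · exact (norm_sub_le _ _).trans (add_le_add (b 0) (b l))
          · exact (norm_sub_le _ _).trans (add_le_add (x.norm_ev_le _) (x.norm_ev_le _))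
      _ = _ := by field_simp; ring
  have h2 : Tendsto (fun h => ∫ l in (-τ)..0, ‖(A h).ev l‖ ^ 2) (𝓝[>] 0)
      (𝓝 (∫ l in (-τ)..0, (0 : ℝ))) := by
    refine intervalIntegral.tendsto_integral_filter_of_dominated_convergence
      (fun _ => (4 * ‖x‖) ^ 2) ?_ ?_ intervalIntegrable_const ?_
    · exact Eventually.of_forall fun h =>
        ((isRC_ev (A h)).measurable.norm.pow_const 2).aestronglyMeasurable
    · filter_upwards [self_mem_nhdsWithin] with h hh
      refine Eventually.of_forall fun l hl => ?_
      rw [uIoc_of_le neg_le_zero'] at hl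
      rw [norm_pow, norm_norm]
      gcongr
      exact hbd h hh l ⟨hl.1.le, hl.2⟩
    · refine Eventually.of_forall fun l hl => ?_
      rw [uIoc_of_le neg_le_zero'] at hl
      simpa using (hlim l ⟨hl.1.le, hl.2⟩).norm.pow 2
  have h3 := h2.sqrt
  simp only [intervalIntegral.integral_zero, Real.sqrt_zero] at h3
  rw [hasDerivWithinAt_iff_tendsto_slope, Ici_sdiff_left, tendsto_iff_norm_sub_tendsto_zero]
  refine h3.congr fun h => ?_
  rw [← norm_toH_sq, Real.sqrt_sq (norm_nonneg _), hA, toH_sub, toH_smul, toH_sub, slope_def_module,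
    flatShift_zero, sub_zero]

end Volterra

/-! ### The test functions of the comparison argument -/

section TestFunctions

variable {d : ℕ} {τ : ℝ} [hτ : Fact (0 < τ)]

/-- `(x(0) - y(0)) + B ∫_{-τ}^0 (x - y)`. -/
def gap (B : E d →L[ℝ] E d) (x y : PathSpace d τ) : E d :=
  x.ev 0 - y.ev 0 + B ((primitiveL (x - y).toH).ev (-τ))

/-- The penalty for the distance of two paths. -/
def penalty (B : E d →L[ℝ] E d) (x y : PathSpace d τ) : ℝ :=
  ‖gap B x y‖ ^ 2 + ‖(primitiveL (x - y).toH).toH‖ ^ 2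

/-- The growth function `e^{μ(T-t)} (1 + |x(0)|² + |x|_H²)`. -/
def growth (T μ t : ℝ) (x : PathSpace d τ) : ℝ :=
  Real.exp (μ * (T - t)) * (1 + ‖x.ev 0‖ ^ 2 + ‖x.toH‖ ^ 2)

/-- The test function. -/
def testFn (T α γ β μ : ℝ) (B : ℝ → E d →L[ℝ] E d) (t' : ℝ) (y : PathSpace d τ) (t : ℝ)
    (x : PathSpace d τ) : ℝ :=
  α * penalty (B t) x y + γ * (t - t') ^ 2 + β * growth T μ t x

variable {T α γ β μ : ℝ} {B : ℝ → E d →L[ℝ] E d} {t' : ℝ} {y : PathSpace d τ}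

/-- The flat continuation fixes the value at `0`, so only the primitives and the `H` norm move. The
terms in `x(-τ)` come from mass leaving the window at its left end. -/
theorem hasDerivWithinAt_testFn_flatShift (s : ℝ) (x : PathSpace d τ) :
    HasDerivWithinAt (fun h => testFn T α γ β μ B t' y s (flatShift h x))
      (α * (2 * inner ℝ (gap (B s) x y) (B s (x.ev 0 - x.ev (-τ)))
          + 2 * inner ℝ (primitiveL (x - y).toH).toH (constPath (x.ev 0) - x).toH)
        + β * (Real.exp (μ * (T - s)) * (‖x.ev 0‖ ^ 2 - ‖x.ev (-τ)‖ ^ 2))) (Ici 0) 0 := by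
  have h1 := (B s).hasFDerivAt.comp_hasDerivWithinAt 0
    ((hasDerivWithinAt_primitive_left x).sub_const ((primitiveL y.toH).ev (-τ)))
  have h2 := (h1.const_add (x.ev 0 - y.ev 0)).norm_sq
  have h3 := ((hasDerivWithinAt_primitive x).sub_const (primitiveL y.toH).toH).norm_sq
  have h4 := (((hasDerivWithinAt_norm_sq x).const_add (1 + ‖x.ev 0‖ ^ 2)).const_mul
    (Real.exp (μ * (T - s)))).const_mul β
  have h5 := (((h2.add h3).const_mul α).add_const (γ * (s - t') ^ 2)).add h4
  simp only [flatShift_zero] at h5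
  refine (h5.congr_of_mem (fun h hh => ?_) self_mem_Ici).congr_deriv ?_
  · simp only [testFn, penalty, gap, growth, flatShift_ev_zero (mem_Ici.1 hh), toH_sub, map_sub,
      ev_sub, Pi.add_apply, Function.comp_apply]
  · simp only [gap, toH_sub, map_sub, ev_sub, Function.comp_apply, flatShift_zero]

theorem genS_testFn (s : ℝ) (x : PathSpace d τ) : genS (testFn T α γ β μ B t' y s) x
      = α * (2 * inner ℝ (gap (B s) x y) (B s (x.ev 0 - x.ev (-τ)))
          + 2 * inner ℝ (primitiveL (x - y).toH).toH (constPath (x.ev 0) - x).toH)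
        + β * (Real.exp (μ * (T - s)) * (‖x.ev 0‖ ^ 2 - ‖x.ev (-τ)‖ ^ 2)) := by
  have h := hasDerivWithinAt_testFn_flatShift (T := T) (α := α) (γ := γ) (β := β) (μ := μ) (B := B)
    (t' := t') (y := y) s x
  rw [hasDerivWithinAt_iff_tendsto_slope, Ici_sdiff_left] at h
  refine Tendsto.limUnder_eq (h.congr fun h => ?_)
  rw [slope_def_field, flatShift_zero, sub_zero]

theorem inDomS_testFn (s : ℝ) : InDomS (testFn T α γ β μ B t' y s) := by
  intro x
  have h := hasDerivWithinAt_testFn_flatShift (T := T) (α := α) (γ := γ) (β := β) (μ := μ) (B := B)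
    (t' := t') (y := y) s x
  rw [hasDerivWithinAt_iff_tendsto_slope, Ici_sdiff_left] at h
  refine ⟨_, h.congr fun h => ?_⟩
  rw [slope_def_field, flatShift_zero, sub_zero]

/-- The test function factors through `ℝ × ℝ^d × H`, smoothly. -/
theorem exists_factor_testFn (hB : ContDiff ℝ 1 B) : ∃ Ψ : ℝ × E d × HSpace d τ → ℝ,
    ContDiff ℝ 1 Ψ ∧ ∀ t (x : PathSpace d τ), testFn T α γ β μ B t' y t x = Ψ (t, x.ev 0, x.toH) := by
  set Ψ : ℝ × E d × HSpace d τ → ℝ := fun p =>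
    α * (‖p.2.1 - y.ev 0 + B p.1 (evL (-τ) (primitiveL (p.2.2 - y.toH)))‖ ^ 2
      + ‖toHL (primitiveL (p.2.2 - y.toH))‖ ^ 2) + γ * (p.1 - t') ^ 2
      + β * (Real.exp (μ * (T - p.1)) * (1 + ‖p.2.1‖ ^ 2 + ‖p.2.2‖ ^ 2)) with hΨ
  have c1 : ContDiff ℝ 1 Ψ := by
    have k1 : ContDiff ℝ 1 fun p : ℝ × E d × HSpace d τ => primitiveL (p.2.2 - y.toH) :=
      primitiveL.contDiff.comp ((contDiff_snd.comp contDiff_snd).sub contDiff_const)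
    have k2 : ContDiff ℝ 1 fun p : ℝ × E d × HSpace d τ => B p.1 :=
      hB.comp contDiff_fst
    have k3 := k2.clm_apply ((evL (-τ)).contDiff.comp k1)
    have k4 := toHL.contDiff.comp k1
    have k5 : ContDiff ℝ 1 fun p : ℝ × E d × HSpace d τ => p.2.1 :=
      contDiff_fst.comp contDiff_snd
    have k6 : ContDiff ℝ 1 fun p : ℝ × E d × HSpace d τ => p.2.2 :=
      contDiff_snd.comp contDiff_snd
    have k7 : ContDiff ℝ 1 fun p : ℝ × E d × HSpace d τ => p.1 := contDiff_fst
    exact ((contDiff_const.mul ((((k5.sub contDiff_const).add k3).norm_sq ℝ).add (k4.norm_sq ℝ))).add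
      (contDiff_const.mul ((k7.sub contDiff_const).pow 2))).add
      (contDiff_const.mul ((Real.contDiff_exp.comp (contDiff_const.mul (contDiff_const.sub k7))).mul
        ((contDiff_const.add (k5.norm_sq ℝ)).add (k6.norm_sq ℝ))))
  refine ⟨Ψ, c1, fun t x => ?_⟩
  simp only [hΨ, testFn, penalty, gap, growth, toH_sub, evL_apply, toHL_apply]

theorem contDiff_testFn (hB : ContDiff ℝ 1 B) :
    ContDiff ℝ 1 fun p : ℝ × PathSpace d τ => testFn T α γ β μ B t' y p.1 p.2 := by
  obtain ⟨Ψ, c1, hfac⟩ := exists_factor_testFn (T := T) (α := α) (γ := γ) (β := β) (μ := μ)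
    (t' := t') (y := y) hB
  have c2 : ContDiff ℝ 1 fun p : ℝ × PathSpace d τ => Ψ (p.1, evL 0 p.2, toHL p.2) :=
    c1.comp (contDiff_fst.prodMk (((evL 0).contDiff.comp contDiff_snd).prodMk
      (toHL.contDiff.comp contDiff_snd)))
  have e : (fun p : ℝ × PathSpace d τ => testFn T α γ β μ B t' y p.1 p.2)
      = fun p => Ψ (p.1, evL 0 p.2, toHL p.2) := funext fun p => hfac p.1 p.2
  rw [e]
  exact c2

theorem isTest_testFn (hB : ContDiff ℝ 1 B) : IsTest T (testFn T α γ β μ B t' y) := by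
  obtain ⟨Ψ, c1, hfac⟩ := exists_factor_testFn (T := T) (α := α) (γ := γ) (β := β) (μ := μ)
    (t' := t') (y := y) hB
  exact ⟨(contDiff_testFn hB).contDiffOn, fun s _ => inDomS_testFn s, fun t v f => Ψ (t, v, f),
    c1.contDiffOn, fun t _ x => hfac t x⟩

theorem dt_testFn (hT : 0 < T) (hB : ContDiff ℝ 1 B) {s : ℝ} (hs : s ∈ Icc 0 T)
    (x : PathSpace d τ) : dt T (testFn T α γ β μ B t' y) s x
      = α * (2 * inner ℝ (gap (B s) x y) (deriv B s ((primitiveL (x - y).toH).ev (-τ))))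
        + γ * (2 * (s - t')) - β * (μ * growth T μ s x) := by
  have hBd : HasDerivAt B (deriv B s) s := (hB.differentiable one_ne_zero s).hasDerivAt
  have h1 := ((hBd.clm_apply (hasDerivAt_const s ((primitiveL (x - y).toH).ev (-τ)))).const_add
    (x.ev 0 - y.ev 0)).norm_sq
  have h2 := ((h1.add_const (‖(primitiveL (x - y).toH).toH‖ ^ 2)).const_mul α)
  have h3 := ((((hasDerivAt_id s).sub_const t').pow 2).const_mul γ)
  have h4 := (((((hasDerivAt_id s).const_sub T).const_mul μ).exp).mul_const
    (1 + ‖x.ev 0‖ ^ 2 + ‖x.toH‖ ^ 2)).const_mul β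
  have h5 := ((h2.add h3).add h4).hasDerivWithinAt (s := Icc 0 T)
  refine Eq.trans (HasDerivWithinAt.derivWithin h5 (uniqueDiffOn_Icc hT s hs)) ?_
  simp only [gap, growth, map_zero, add_zero, id]
  ring

/-- Adding `r` times a jump translates `x(0)`, and with it `gap`, by `r • v` and leaves everything
seen by `H` unchanged, so this is a derivative of two squared norms along a line. -/
theorem fderiv_testFn_jump (hB : ContDiff ℝ 1 B) {s : ℝ} (x : PathSpace d τ) (v : E d) :
    fderiv ℝ (testFn T α γ β μ B t' y s) x (jump v)
      = α * (2 * inner ℝ (gap (B s) x y) v)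
        + β * (Real.exp (μ * (T - s)) * (2 * inner ℝ (x.ev 0) v)) := by
  have h1 : DifferentiableAt ℝ (testFn T α γ β μ B t' y s) x :=
    (((contDiff_testFn hB).comp (contDiff_const.prodMk contDiff_id)).differentiable
      one_ne_zero).differentiableAt
  have h2 : HasDerivAt (fun r : ℝ => x + r • jump v) (jump v) 0 := by
    simpa using ((hasDerivAt_id (0 : ℝ)).smul_const (jump v : PathSpace d τ)).const_add x
  have h3 : HasDerivAt (fun r : ℝ => testFn T α γ β μ B t' y s (x + r • jump v))
      (fderiv ℝ (testFn T α γ β μ B t' y s) x (jump v)) 0 := by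
    have h1' : HasFDerivAt (testFn T α γ β μ B t' y s)
        (fderiv ℝ (testFn T α γ β μ B t' y s) x) (x + (0 : ℝ) • jump v) := by
      rw [zero_smul, add_zero]; exact h1.hasFDerivAt
    exact h1'.comp_hasDerivAt (0 : ℝ) h2
  have hv : HasDerivAt (fun r : ℝ => r • v) v 0 := by
    simpa using (hasDerivAt_id (0 : ℝ)).smul_const v
  have h4 := ((((hv.const_add (gap (B s) x y)).norm_sq.add_const
    (‖(primitiveL (x - y).toH).toH‖ ^ 2)).const_mul α).add_const (γ * (s - t') ^ 2)).add
    (((((hv.const_add (x.ev 0)).norm_sq.const_add 1).add_const (‖x.toH‖ ^ 2)).const_mul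
      (Real.exp (μ * (T - s)))).const_mul β)
  refine h3.unique (h4.congr_deriv ?_ |>.congr_of_eventuallyEq (Eventually.of_forall fun r => ?_))
  · simp
  · have e : gap (B s) (x + r • jump v) y = gap (B s) x y + r • v := by
      simp only [gap, ev_add, ev_smul, toH_add, toH_smul, toH_sub, jump_toH, jump_ev_zero,
        smul_zero, add_zero]
      abel
    simp only [testFn, penalty, e, growth, ev_add, ev_smul, toH_add, toH_smul, toH_sub, jump_toH,
      jump_ev_zero, smul_zero, add_zero, Pi.add_apply]

end TestFunctions

/-! ### Steklov averages -/

/-- A bounded Lipschitz function on an interval has uniform `C¹` approximations with the same bound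
and the same Lipschitz constant. -/
theorem exists_smooth_approx {G : Type*} [NormedAddCommGroup G] [NormedSpace ℝ G] [CompleteSpace G]
    {T K η : ℝ} (hT : 0 ≤ T) (hK : 0 ≤ K) (hη : 0 < η) {b : ℝ → G}
    (hb : ∀ t ∈ Icc 0 T, ‖b t‖ ≤ K)
    (hlip : ∀ t ∈ Icc 0 T, ∀ s ∈ Icc 0 T, ‖b s - b t‖ ≤ K * |s - t|) :
    ∃ B : ℝ → G, ContDiff ℝ 1 B ∧ (∀ t, ‖B t‖ ≤ K) ∧ (∀ t, ‖deriv B t‖ ≤ K) ∧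
      ∀ t ∈ Icc 0 T, ‖B t - b t‖ ≤ K * η := by
  -- Constant extension preserves both constants; the averages over `[t, t + η]` are then `C¹`, and
  -- their derivative is a difference quotient, bounded by the Lipschitz constant whatever `η` is.
  set c : ℝ → G := fun t => b (projIcc 0 T hT t) with hc
  have hclip : ∀ s t, ‖c s - c t‖ ≤ K * |s - t| := fun s t =>
    (hlip _ (projIcc 0 T hT t).2 _ (projIcc 0 T hT s).2).trans
      (mul_le_mul_of_nonneg_left (abs_projIcc_sub_projIcc hT) hK)
  have hcb : ∀ t, ‖c t‖ ≤ K := fun t => hb _ (projIcc 0 T hT t).2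
  have hcc : Continuous c := by
    refine (LipschitzWith.of_dist_le_mul (K := K.toNNReal) fun s t => ?_).continuous
    rw [dist_eq_norm, Real.dist_eq, Real.coe_toNNReal _ hK]
    exact hclip s t
  have hci := fun p q => hcc.intervalIntegrable (μ := volume) p q
  have hd : ∀ t, HasDerivAt (fun t => η⁻¹ • ∫ r in t..(t + η), c r) (η⁻¹ • (c (t + η) - c t)) t := by
    intro t
    have h1 := fun u => intervalIntegral.integral_hasDerivAt_right (hci 0 u)
      (hcc.stronglyMeasurableAtFilter _ _) hcc.continuousAt
    have h2 := ((h1 (t + η)).comp_add_const t η).sub (h1 t)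
    refine (h2.const_smul η⁻¹).congr_of_eventuallyEq (Eventually.of_forall fun u => ?_)
    simp only [Pi.smul_apply, Pi.sub_apply]
    rw [intervalIntegral.integral_interval_sub_left (hci _ _) (hci _ _)]
  have hderiv : deriv (fun t => η⁻¹ • ∫ r in t..(t + η), c r) = fun t => η⁻¹ • (c (t + η) - c t) :=
    funext fun t => (hd t).deriv
  refine ⟨fun t => η⁻¹ • ∫ r in t..(t + η), c r, ?_, fun t => ?_, fun t => ?_, fun t ht => ?_⟩
  · rw [contDiff_one_iff_deriv]
    refine ⟨fun t => (hd t).differentiableAt, ?_⟩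
    rw [hderiv]
    fun_prop
  · have := intervalIntegral.norm_integral_le_of_norm_le_const (a := t) (b := t + η) (f := c)
      fun r _ => hcb r
    rw [add_sub_cancel_left, abs_of_pos hη] at this
    rw [norm_smul, Real.norm_of_nonneg (inv_nonneg.2 hη.le)]
    calc _ ≤ η⁻¹ * (K * η) := by gcongr
      _ = K := by field_simp
  · rw [hderiv]
    have := hclip (t + η) t
    rw [add_sub_cancel_left, abs_of_pos hη] at this
    rw [norm_smul, Real.norm_of_nonneg (inv_nonneg.2 hη.le)]
    calc _ ≤ η⁻¹ * (K * η) := by gcongr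
      _ = K := by field_simp
  · have e1 : b t = c t := by rw [hc]; simp only; rw [projIcc_of_mem hT ht]
    have e2 : (η⁻¹ • ∫ r in t..(t + η), c r) - c t = η⁻¹ • ∫ r in t..(t + η), (c r - c t) := by
      rw [intervalIntegral.integral_sub (hci _ _) intervalIntegrable_const,
        intervalIntegral.integral_const, add_sub_cancel_left, smul_sub, smul_smul,
        inv_mul_cancel₀ hη.ne', one_smul]
    have := intervalIntegral.norm_integral_le_of_norm_le_const (a := t) (b := t + η) (C := K * η)
      (f := fun r => c r - c t) fun r hr => by
        rw [uIoc_of_le (by linarith)] at hr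
        refine (hclip r t).trans (mul_le_mul_of_nonneg_left ?_ hK)
        rw [abs_of_pos (by linarith [hr.1])]
        linarith [hr.2]
    rw [add_sub_cancel_left, abs_of_pos hη] at this
    rw [e1, e2, norm_smul, Real.norm_of_nonneg (inv_nonneg.2 hη.le)]
    calc _ ≤ η⁻¹ * (K * η * η) := by gcongr
      _ = _ := by field_simp

/-! ### Selection of maximal points -/

/-- A near-maximizing chain: if every chain along which `f` grows has an upper bound where `f` is not
smaller, then `f` has a maximal point whose value is almost the supremum. -/
theorem exists_maximal_of_chains {α : Type*} {r : α → α → Prop} (hrefl : ∀ p, r p p)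
    (htrans : ∀ p q s, r p q → r q s → r p s) {f : α → ℝ} {p₀ : α}
    (hbdd : BddAbove (f '' {q | r p₀ q}))
    (hchain : ∀ p : ℕ → α, r p₀ (p 0) → (∀ i j, i ≤ j → r (p i) (p j)) → Monotone (f ∘ p) →
      ∃ q, (∀ i, r (p i) q) ∧ ∀ i, f (p i) ≤ f q) {δ : ℝ} (hδ : 0 < δ) :
    ∃ q, r p₀ q ∧ (∀ s, r q s → f s ≤ f q) ∧ ∀ s, r p₀ s → f s ≤ f q + δ := by
  -- A successor must be nearly optimal and must not lower `f`. If `p` is already nearly optimal it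
  -- is kept, otherwise a near-maximizer beats it.
  have step : ∀ (p : {p // r p₀ p}) (ε : ℝ), 0 < ε → ∃ q : {q // r p₀ q}, r p.1 q.1 ∧ f p.1 ≤ f q.1 ∧
      ∀ s, r p.1 s → f s ≤ f q.1 + ε := by
    intro p ε hε
    by_cases h : ∀ s, r p.1 s → f s ≤ f p.1 + ε
    · exact ⟨p, hrefl _, le_rfl, h⟩
    push Not at h
    obtain ⟨s, hs, hfs⟩ := h
    have hb : BddAbove (f '' {q | r p.1 q}) :=
      hbdd.mono (image_mono fun q hq => htrans _ _ _ p.2 hq)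
    have hne : (f '' {q | r p.1 q}).Nonempty := ⟨_, s, hs, rfl⟩
    obtain ⟨_, ⟨q, hq, rfl⟩, hlt⟩ := exists_lt_of_lt_csSup hne (sub_lt_self _ hε)
    have hle : ∀ s, r p.1 s → f s ≤ f q + ε := fun s hs => by
      have := le_csSup hb ⟨s, hs, rfl⟩
      linarith
    exact ⟨⟨q, htrans _ _ _ p.2 hq⟩, hq, by linarith [hle s hs], hle⟩
  choose! g hg using step
  set ε : ℕ → ℝ := fun n => δ * (1 / 2) ^ n with hε
  have hεpos : ∀ n, 0 < ε n := fun n => by positivity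
  set p : ℕ → {q // r p₀ q} := fun n => Nat.rec ⟨p₀, hrefl p₀⟩ (fun n q => g q (ε n)) n with hp
  have hsucc : ∀ n, p (n + 1) = g (p n) (ε n) := fun n => rfl
  have hmono : Monotone (f ∘ fun n => (p n).1) := monotone_nat_of_le_succ fun n => by
    simp only [Function.comp_apply, hsucc]
    exact (hg (p n) (ε n) (hεpos n)).2.1
  have hrel : ∀ i j, i ≤ j → r (p i).1 (p j).1 := fun i j hij => by
    induction j, hij using Nat.le_induction with
    | base => exact hrefl _
    | succ j _ ih =>
      refine htrans _ _ _ ih ?_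
      rw [hsucc]
      exact (hg (p j) (ε j) (hεpos j)).1
  obtain ⟨q, hq, hfq⟩ := hchain (fun n => (p n).1) (hrefl p₀) hrel hmono
  -- What follows `q` follows every `p n`, so letting `n` grow makes `q` exactly maximal among its
  -- successors; `n = 0`, where `ε 0 = δ`, gives the global statement.
  have hnear : ∀ n s, r (p n).1 s → f s ≤ f q + ε n := fun n s hs => by
    have h1 := (hg (p n) (ε n) (hεpos n)).2.2 s hs
    have h2 := hfq (n + 1)
    rw [hsucc] at h2
    linarith
  refine ⟨q, hq 0, fun s hs => ?_, fun s hs => ?_⟩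
  · have ht : Tendsto (fun n => f q + ε n) atTop (𝓝 (f q + δ * 0)) :=
      ((tendsto_pow_atTop_nhds_zero_of_lt_one (by norm_num) (by norm_num)).const_mul δ).const_add _
    rw [mul_zero, add_zero] at ht
    exact ge_of_tendsto' ht fun n => hnear n s (htrans _ _ _ (hq n) hs)
  · simpa [hε] using hnear 0 s hs

/-! ### Limits of chains of continuations and maxima of the doubled functional. -/

section Continuations

variable {d : ℕ} {τ T : ℝ} [hτ : Fact (0 < τ)]

/-- The path of `q`, in absolute time, agrees with the path of `p` before the time of `p`. -/
structure Continues (p q : ℝ × PathSpace d τ) : Prop where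
  le : p.1 ≤ q.1
  past : ∀ θ ∈ Icc (-τ) 0, θ < p.1 - q.1 → q.2.ev θ = p.2.ev (θ + (q.1 - p.1))

theorem Continues.refl (p : ℝ × PathSpace d τ) : Continues p p :=
  ⟨le_rfl, fun θ _ _ => by rw [sub_self, add_zero]⟩

theorem Continues.trans {p q s : ℝ × PathSpace d τ} (h1 : Continues p q) (h2 : Continues q s) :
    Continues p s := by
  refine ⟨h1.le.trans h2.le, fun θ hθ hlt => ?_⟩
  have l1 := h1.le
  have l2 := h2.le
  rw [h2.past θ hθ (by linarith), h1.past _ ⟨by linarith [hθ.1], by linarith⟩ (by linarith)]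
  congr 1
  ring

theorem continues_concat {s t : ℝ} (hst : s ≤ t) (z x : PathSpace d τ) :
    Continues (s, z) (t, concat s z t x) := by
  refine ⟨hst, fun θ hθ hlt => ?_⟩
  simp only at hlt ⊢
  rw [concat_ev _ _ _ _ hθ, if_neg (not_le.2 hlt), add_comm]

theorem concat_mem_pathsIn {A : Set (E d)} {s t : ℝ} (hst : s ≤ t) {z x : PathSpace d τ}
    (hz : z ∈ pathsIn A) (hx : x ∈ pathsIn A) : concat s z t x ∈ pathsIn A := by
  intro θ hθ
  rw [concat_ev _ _ _ _ hθ]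
  split_ifs with h
  · exact hx θ hθ
  · exact hz _ ⟨by linarith [hθ.1], by linarith⟩

theorem concat_self (s : ℝ) (z : PathSpace d τ) : concat s z s z = z := by
  refine path_ext fun θ hθ => ?_
  rw [concat_ev _ _ _ _ hθ]
  split_ifs <;> simp

/-- A chain of continuations has an upper bound with any prescribed end point. -/
theorem exists_limit_of_chain {A : Set (E d)} (hA : Bornology.IsBounded A)
    {p : ℕ → ℝ × PathSpace d τ} (hpT : ∀ i, (p i).1 ≤ T) (hpA : ∀ i, (p i).2 ∈ pathsIn A)
    (hp : ∀ i j, i ≤ j → Continues (p i) (p j)) {v : E d} (hv : v ∈ A) :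
    ∃ z : PathSpace d τ, z ∈ pathsIn A ∧ z.ev 0 = v ∧
      ∀ i, Continues (p i) (⨆ i, (p i).1, z) := by
  have hτ0 := hτ.out
  have hbdd : BddAbove (range fun i => (p i).1) := ⟨T, by rintro _ ⟨i, rfl⟩; exact hpT i⟩
  set s := ⨆ i, (p i).1 with hs
  have hle : ∀ i, (p i).1 ≤ s := fun i => le_ciSup hbdd i
  have hex : ∀ c < 0, ∃ i, s + c < (p i).1 := fun c hc => exists_lt_of_lt_ciSup (by linarith)
  have hcons : ∀ c, -τ ≤ c → ∀ i j, s + c < (p i).1 → s + c < (p j).1 →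
      (p i).2.ev (c + s - (p i).1) = (p j).2.ev (c + s - (p j).1) := by
    intro c hc
    have main : ∀ i j, i ≤ j → s + c < (p i).1 → s + c < (p j).1 →
        (p i).2.ev (c + s - (p i).1) = (p j).2.ev (c + s - (p j).1) := by
      intro i j hij h1 h2
      rw [(hp i j hij).past (c + s - (p j).1) ⟨by linarith [hle j], by linarith⟩ (by linarith)]
      congr 1
      ring
    intro i j h1 h2
    rcases le_total i j with h | h
    · exact main i j h h1 h2
    · exact (main j i h h2 h1).symm
  choose! n hn using hex
  -- Before the limiting time the value comes from any member of the chain that has already passed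
  -- that instant; by consistency the index is irrelevant. The value at `0` is free, since
  -- `Continues` prescribes only strictly earlier times.
  set Z : ℝ → E d := fun θ => if 0 ≤ θ then v else
    (p (n (max θ (-τ)))).2.ev (max θ (-τ) + s - (p (n (max θ (-τ)))).1) with hZ
  have hneg : ∀ θ < 0, max θ (-τ) < 0 := fun θ hθ => max_lt hθ (by linarith)
  have hZA : ∀ θ, Z θ ∈ A := by
    intro θ
    simp only [hZ]
    split_ifs with h
    · exact hv
    · have := hn _ (hneg θ (not_le.1 h))
      exact hpA _ _ ⟨by linarith [hle (n (max θ (-τ))), le_max_right θ (-τ)], by linarith⟩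
  have hZi : ∀ θ < 0, ∀ i, s + max θ (-τ) < (p i).1 →
      Z θ = (p i).2.ev (max θ (-τ) + s - (p i).1) := by
    intro θ hθ i hi
    simp only [hZ]
    rw [if_neg (not_le.2 hθ)]
    exact hcons _ (le_max_right _ _) _ _ (hn _ (hneg θ hθ)) hi
  have hrc : ∀ θ, ContinuousWithinAt Z (Ici θ) θ := by
    intro θ
    by_cases h : 0 ≤ θ
    · exact continuousWithinAt_const.congr (fun η hη => if_pos (h.trans hη)) (if_pos h)
    · push Not at h
      have hi := hn _ (hneg θ h)
      -- A single member describes `Z` near a time before the end, so right-continuity is inherited.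
      -- No left limit at the end is needed.
      set i := n (max θ (-τ))
      have hc : Continuous fun η : ℝ => s + max η (-τ) := by fun_prop
      have hev : Z =ᶠ[𝓝[Ici θ] θ] fun η => (p i).2.ev (max η (-τ) + s - (p i).1) := by
        filter_upwards [mem_nhdsWithin_of_mem_nhds (Iio_mem_nhds h),
          mem_nhdsWithin_of_mem_nhds (hc.continuousAt.eventually (Iio_mem_nhds hi))] with η h1 h2
        exact hZi η h1 i h2
      refine ContinuousWithinAt.congr_of_eventuallyEq ?_ hev (hZi θ h i hi)
      refine ((p i).2.ev_rightCont _).comp (t := Ici (max θ (-τ) + s - (p i).1))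
        (f := fun η : ℝ => max η (-τ) + s - (p i).1) ?_ fun η hη => ?_
      · exact Continuous.continuousWithinAt (by fun_prop)
      · have : max θ (-τ) ≤ max η (-τ) := max_le_max_right _ hη
        simp only [mem_Ici]
        linarith
  obtain ⟨C, hC⟩ := hA.exists_norm_le
  refine ⟨PathSpace.mk' Z ⟨C, fun θ => hC _ (hZA θ)⟩ hrc, fun θ hθ => ?_, ?_, fun i => ⟨hle i, ?_⟩⟩
  · rw [PathSpace.ev_mk' _ _ _ hθ]; exact hZA θ
  · rw [PathSpace.ev_mk' _ _ _ mem_zero]; exact if_pos le_rfl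
  · intro θ hθ hlt
    simp only at hlt ⊢
    have hm : max θ (-τ) = θ := max_eq_left hθ.1
    rw [PathSpace.ev_mk' _ _ _ hθ, hZi θ (by linarith [hle i]) i (by rw [hm]; linarith), hm,
      add_sub_assoc]

/-- The mode of convergence along chains of continuations. -/
structure WeakTendsto (p : ℕ → ℝ × PathSpace d τ) (q : ℝ × PathSpace d τ) : Prop where
  time : Tendsto (fun i => (p i).1) atTop (𝓝 q.1)
  value : Tendsto (fun i => (p i).2.ev 0) atTop (𝓝 (q.2.ev 0))
  primitive : Tendsto (fun i => primitiveL (p i).2.toH) atTop (𝓝 (primitiveL q.2.toH))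
  norm : Tendsto (fun i => ‖(p i).2.toH‖ ^ 2) atTop (𝓝 (‖q.2.toH‖ ^ 2))

theorem norm_primitiveL_le_weakDist (x y : PathSpace d τ) :
    ‖primitiveL (x - y).toH‖ ≤ weakDist x y :=
  norm_path_le _ fun l hl => by
    rw [primitiveL_ev _ hl]
    exact le_weakDist x y hl

theorem weakDist_le_norm_primitiveL (x y : PathSpace d τ) :
    weakDist x y ≤ ‖primitiveL (x - y).toH‖ :=
  weakDist_le fun l hl => by
    have := (primitiveL (x - y).toH).norm_ev_le l
    rwa [primitiveL_ev _ hl] at this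

/-- The primitives and the squared norms converge automatically, at the rates of
`weakDist_continuation` and `abs_norm_toH_sq_sub_le`. Only the end values need a hypothesis. -/
theorem weakTendsto_of_continues {R : ℝ} {p : ℕ → ℝ × PathSpace d τ} {q : ℝ × PathSpace d τ}
    (hp : ∀ i, ∀ θ ∈ Icc (-τ) 0, ‖(p i).2.ev θ‖ ≤ R) (hq : ∀ θ ∈ Icc (-τ) 0, ‖q.2.ev θ‖ ≤ R)
    (hc : ∀ i, Continues (p i) q) (ht : Tendsto (fun i => (p i).1) atTop (𝓝 q.1))
    (hv : Tendsto (fun i => (p i).2.ev 0) atTop (𝓝 (q.2.ev 0))) : WeakTendsto p q := by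
  have h0 : Tendsto (fun i => q.1 - (p i).1) atTop (𝓝 0) := by
    simpa using ht.const_sub q.1
  have hpast : ∀ i, ∀ θ ∈ Icc (-τ) 0, θ < -(q.1 - (p i).1) →
      q.2.ev θ = (p i).2.ev (θ + (q.1 - (p i).1)) := fun i θ hθ h =>
    (hc i).past θ hθ (by linarith)
  have hpos : ∀ i, 0 ≤ q.1 - (p i).1 := fun i => sub_nonneg.2 (hc i).le
  refine ⟨ht, hv, ?_, ?_⟩
  · rw [tendsto_iff_norm_sub_tendsto_zero]
    have h1 : Tendsto (fun i => √(q.1 - (p i).1) * (√τ * R + √τ * R)) atTop (𝓝 0) := by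
      simpa using h0.sqrt.mul_const (√τ * R + √τ * R)
    refine squeeze_zero (fun i => norm_nonneg _) (fun i => ?_) h1
    rw [norm_sub_rev, ← map_sub, ← toH_sub]
    refine (norm_primitiveL_le_weakDist _ _).trans ((weakDist_continuation (hpos i) (hpast i)).trans ?_)
    gcongr
    · exact norm_toH_le _ (hp i)
    · exact norm_toH_le _ hq
  · rw [tendsto_iff_norm_sub_tendsto_zero]
    have h1 : Tendsto (fun i => (q.1 - (p i).1) * R ^ 2) atTop (𝓝 0) := by
      simpa using h0.mul_const (R ^ 2)
    refine squeeze_zero (fun i => norm_nonneg _) (fun i => ?_) h1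
    rw [norm_sub_rev, Real.norm_eq_abs]
    exact abs_norm_toH_sq_sub_le (hpos i) (hpast i) (hp i) hq

theorem InUniquenessClass.tendsto {w : ℝ → PathSpace d τ → ℝ} (hw : InUniquenessClass T w)
    {p : ℕ → ℝ × PathSpace d τ} {q : ℝ × PathSpace d τ} (h : WeakTendsto p q)
    (hp : ∀ i, (p i).1 ∈ Icc 0 T) (hq : q.1 ∈ Icc 0 T) :
    Tendsto (fun i => w (p i).1 (p i).2) atTop (𝓝 (w q.1 q.2)) := by
  obtain ⟨Λ, hΛ, hw⟩ := hw
  rw [tendsto_iff_norm_sub_tendsto_zero]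
  have hn : Tendsto (fun i => ‖(p i).2.toH‖) atTop (𝓝 ‖q.2.toH‖) := by
    simpa using h.norm.sqrt
  have h1 : Tendsto (fun i => Λ * (1 + ‖(p i).2.ev 0‖ + ‖(p i).2.toH‖ + ‖q.2.ev 0‖ + ‖q.2.toH‖) *
      (‖(p i).2.ev 0 - q.2.ev 0‖ + √|q.1 - (p i).1| + ‖primitiveL ((p i).2 - q.2).toH‖)) atTop
      (𝓝 (Λ * (1 + ‖q.2.ev 0‖ + ‖q.2.toH‖ + ‖q.2.ev 0‖ + ‖q.2.toH‖) * (0 + √|0| + 0))) := by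
    refine ((((h.value.norm.const_add 1).add hn).add_const _).add_const _).const_mul Λ |>.mul ?_
    refine ((tendsto_iff_norm_sub_tendsto_zero.1 h.value).add ?_).add ?_
    · have := h.time.const_sub q.1
      rw [sub_self] at this
      exact this.abs.sqrt
    · simp only [toH_sub, map_sub]
      exact tendsto_iff_norm_sub_tendsto_zero.1 h.primitive
  simp only [abs_zero, Real.sqrt_zero, add_zero, mul_zero] at h1
  refine squeeze_zero (fun i => norm_nonneg _) (fun i => ?_) h1
  refine ((hw _ (hp i) _ hq _ _).2).trans ?_
  gcongr
  exact weakDist_le_norm_primitiveL _ _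

theorem tendsto_penalty {B : ℝ → E d →L[ℝ] E d} (hB : Continuous B) {p p' : ℕ → ℝ × PathSpace d τ}
    {q q' : ℝ × PathSpace d τ} (h : WeakTendsto p q) (h' : WeakTendsto p' q') :
    Tendsto (fun i => penalty (B (p i).1) (p i).2 (p' i).2) atTop
      (𝓝 (penalty (B q.1) q.2 q'.2)) := by
  simp only [penalty, gap, toH_sub, map_sub, ev_sub]
  have e : ∀ {p : ℕ → ℝ × PathSpace d τ} {q : ℝ × PathSpace d τ}, WeakTendsto p q →
      Tendsto (fun i => (primitiveL (p i).2.toH).ev (-τ)) atTop (𝓝 ((primitiveL q.2.toH).ev (-τ))) :=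
    fun h => ((evL (-τ)).continuous.tendsto _).comp h.primitive
  have k : ∀ {p : ℕ → ℝ × PathSpace d τ} {q : ℝ × PathSpace d τ}, WeakTendsto p q →
      Tendsto (fun i => (primitiveL (p i).2.toH).toH) atTop (𝓝 (primitiveL q.2.toH).toH) :=
    fun h => (toHL.continuous.tendsto _).comp h.primitive
  have b := (hB.tendsto q.1).comp h.time
  have c : ∀ {f : ℕ → E d} (v : E d), Tendsto f atTop (𝓝 v) →
      Tendsto (fun i => B (p i).1 (f i)) atTop (𝓝 (B q.1 v)) := fun v hf =>
    (isBoundedBilinearMap_apply.continuous.tendsto (B q.1, v)).comp (b.prodMk_nhds hf)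
  exact (((h.value.sub h'.value).add ((c _ (e h)).sub (c _ (e h')))).norm.pow 2).add
    (((k h).sub (k h')).norm.pow 2)

theorem tendsto_growth {μ : ℝ} {p : ℕ → ℝ × PathSpace d τ} {q : ℝ × PathSpace d τ}
    (h : WeakTendsto p q) :
    Tendsto (fun i => growth T μ (p i).1 (p i).2) atTop (𝓝 (growth T μ q.1 q.2)) :=
  ((Real.continuous_exp.tendsto _).comp ((h.time.const_sub T).const_mul μ)).mul
    (((h.value.norm.pow 2).const_add 1).add h.norm)

/-- The doubled functional of the comparison argument. -/
def doubled (T α γ β μ : ℝ) (B : ℝ → E d →L[ℝ] E d) (w₁ w₂ : ℝ → PathSpace d τ → ℝ)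
    (p q : ℝ × PathSpace d τ) : ℝ :=
  w₁ p.1 p.2 - w₂ q.1 q.2 - α * penalty (B p.1) p.2 q.2 - γ * (p.1 - q.1) ^ 2
    - β * growth T μ p.1 p.2 - β * growth T μ q.1 q.2

theorem penalty_nonneg (B : E d →L[ℝ] E d) (x y : PathSpace d τ) : 0 ≤ penalty B x y := by
  unfold penalty; positivity

theorem growth_nonneg (T μ t : ℝ) (x : PathSpace d τ) : 0 ≤ growth T μ t x := by
  unfold growth; positivity

/-- A near-maximal point of the doubled functional over the continuations of a point that is maximal
over its own continuations. -/
theorem exists_maximal_doubled {α γ β μ R : ℝ} {B : ℝ → E d →L[ℝ] E d}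
    {w₁ w₂ : ℝ → PathSpace d τ → ℝ} (hα : 0 ≤ α) (hγ : 0 ≤ γ) (hβ : 0 ≤ β) (hB : Continuous B)
    (h₁ : InUniquenessClass T w₁) (h₂ : InUniquenessClass T w₂) {p₀ : ℝ × PathSpace d τ}
    (hp₀ : p₀.1 ∈ Icc 0 T) (hpR : p₀.2 ∈ pathsIn (Metric.closedBall 0 R)) {δ : ℝ} (hδ : 0 < δ) :
    ∃ q q' : ℝ × PathSpace d τ, q.1 ∈ Icc 0 T ∧ q'.1 ∈ Icc 0 T ∧
      q.2 ∈ pathsIn (Metric.closedBall 0 R) ∧ q'.2 ∈ pathsIn (Metric.closedBall 0 R) ∧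
      Continues p₀ q ∧ Continues p₀ q' ∧
      (∀ s s', Continues q s → Continues q' s' → s.1 ≤ T → s'.1 ≤ T →
        s.2 ∈ pathsIn (Metric.closedBall 0 R) → s'.2 ∈ pathsIn (Metric.closedBall 0 R) →
        doubled T α γ β μ B w₁ w₂ s s' ≤ doubled T α γ β μ B w₁ w₂ q q') ∧
      ∀ s s', Continues p₀ s → Continues p₀ s' → s.1 ≤ T → s'.1 ≤ T →
        s.2 ∈ pathsIn (Metric.closedBall 0 R) → s'.2 ∈ pathsIn (Metric.closedBall 0 R) →
        doubled T α γ β μ B w₁ w₂ s s' ≤ doubled T α γ β μ B w₁ w₂ q q' + δ := by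
  set S := {p : ℝ × PathSpace d τ // p.1 ∈ Icc 0 T ∧ p.2 ∈ pathsIn (Metric.closedBall 0 R)} with hS
  have hnorm : ∀ p : S, ∀ θ ∈ Icc (-τ) 0, ‖p.1.2.ev θ‖ ≤ R := fun p θ hθ =>
    mem_closedBall_zero_iff.1 (p.2.2 θ hθ)
  have hsup : ∀ p : ℕ → S, (∀ i j, i ≤ j → Continues (p i).1 (p j).1) →
      Tendsto (fun i => (p i).1.1) atTop (𝓝 (⨆ i, (p i).1.1)) ∧ (⨆ i, (p i).1.1) ∈ Icc 0 T := by
    intro p hp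
    have hbdd : BddAbove (range fun i => (p i).1.1) := ⟨T, by rintro _ ⟨i, rfl⟩; exact (p i).2.1.2⟩
    exact ⟨tendsto_atTop_ciSup (fun i j hij => (hp i j hij).le) hbdd,
      (p 0).2.1.1.trans (le_ciSup hbdd 0), ciSup_le fun i => (p i).2.1.2⟩
  have hlim : ∀ p : ℕ → S, (∀ i j, i ≤ j → Continues (p i).1 (p j).1) → ∀ v ∈ Metric.closedBall 0 R,
      Tendsto (fun i => (p i).1.2.ev 0) atTop (𝓝 v) →
      ∃ q : S, (∀ i, Continues (p i).1 q.1) ∧ WeakTendsto (fun i => (p i).1) q.1 := by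
    intro p hp v hv hpv
    obtain ⟨z, hzA, hzv, hz⟩ := exists_limit_of_chain (T := T) Metric.isBounded_closedBall
      (fun i => (p i).2.1.2) (fun i => (p i).2.2) hp hv
    obtain ⟨ht, hsT⟩ := hsup p hp
    let q : S := ⟨(⨆ i, (p i).1.1, z), hsT, hzA⟩
    exact ⟨q, hz, weakTendsto_of_continues (fun i => hnorm (p i)) (hnorm q) hz ht
      (by rw [← hzv] at hpv; exact hpv)⟩
  obtain ⟨Λ, hΛ, hw₁⟩ := id h₁
  obtain ⟨Λ', hΛ', hw₂⟩ := id h₂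
  have hbdd : BddAbove (range fun p : S × S => doubled T α γ β μ B w₁ w₂ p.1.1 p.2.1) := by
    refine ⟨Λ * (1 + R + √τ * R) + Λ' * (1 + R + √τ * R), ?_⟩
    rintro _ ⟨⟨p, q⟩, rfl⟩
    have b1 : w₁ p.1.1 p.1.2 ≤ Λ * (1 + R + √τ * R) := by
      refine ((le_abs_self _).trans (hw₁ _ p.2.1 _ p.2.1 _ p.1.2).1).trans ?_
      gcongr
      · exact hnorm p 0 mem_zero
      · exact norm_toH_le _ (hnorm p)
    have b2 : -w₂ q.1.1 q.1.2 ≤ Λ' * (1 + R + √τ * R) := by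
      refine ((neg_le_abs _).trans (hw₂ _ q.2.1 _ q.2.1 _ q.1.2).1).trans ?_
      gcongr
      · exact hnorm q 0 mem_zero
      · exact norm_toH_le _ (hnorm q)
    have c1 := mul_nonneg hα (penalty_nonneg (B p.1.1) p.1.2 q.1.2)
    have c2 := mul_nonneg hγ (sq_nonneg (p.1.1 - q.1.1))
    have c3 := mul_nonneg hβ (growth_nonneg T μ p.1.1 p.1.2)
    have c4 := mul_nonneg hβ (growth_nonneg T μ q.1.1 q.1.2)
    simp only [doubled]
    linarith
  have hchain : ∀ p : ℕ → S × S,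
      (∀ i j, i ≤ j → Continues (p i).1.1 (p j).1.1 ∧ Continues (p i).2.1 (p j).2.1) →
      Monotone ((fun p : S × S => doubled T α γ β μ B w₁ w₂ p.1.1 p.2.1) ∘ p) →
      ∃ q : S × S, (∀ i, Continues (p i).1.1 q.1.1 ∧ Continues (p i).2.1 q.2.1) ∧
        ∀ i, doubled T α γ β μ B w₁ w₂ (p i).1.1 (p i).2.1
          ≤ doubled T α γ β μ B w₁ w₂ q.1.1 q.2.1 := by
    intro p hp hmono
    -- Compactness is used only for the pair of end values in `ℝ^d`. Monotonicity then carries the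
    -- bound from the subsequence to all indices.
    have hcpt : IsCompact (Metric.closedBall (0 : E d) R ×ˢ Metric.closedBall (0 : E d) R) :=
      (isCompact_closedBall 0 R).prod (isCompact_closedBall 0 R)
    obtain ⟨⟨v, v'⟩, hv, φ, hφ, hφt⟩ := hcpt.tendsto_subseq
      (x := fun i => ((p i).1.1.2.ev 0, (p i).2.1.2.ev 0))
      (fun i => ⟨(p i).1.2.2 0 mem_zero, (p i).2.2.2 0 mem_zero⟩)
    rw [nhds_prod_eq, tendsto_prod_iff'] at hφt
    obtain ⟨q, hq, hqt⟩ := hlim (fun i => (p (φ i)).1)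
      (fun i j hij => (hp _ _ (hφ.monotone hij)).1) v hv.1 hφt.1
    obtain ⟨q', hq', hqt'⟩ := hlim (fun i => (p (φ i)).2)
      (fun i j hij => (hp _ _ (hφ.monotone hij)).2) v' hv.2 hφt.2
    refine ⟨(q, q'), fun i => ⟨(hp _ _ (hφ.id_le i)).1.trans (hq i),
      (hp _ _ (hφ.id_le i)).2.trans (hq' i)⟩, fun i => ?_⟩
    have ht : Tendsto (fun i => doubled T α γ β μ B w₁ w₂ (p (φ i)).1.1 (p (φ i)).2.1) atTop
        (𝓝 (doubled T α γ β μ B w₁ w₂ q.1 q'.1)) := by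
      refine (((((h₁.tendsto hqt (fun i => (p (φ i)).1.2.1) q.2.1).sub
        (h₂.tendsto hqt' (fun i => (p (φ i)).2.2.1) q'.2.1)).sub
        ((tendsto_penalty hB hqt hqt').const_mul α)).sub ?_).sub
        ((tendsto_growth hqt).const_mul β)).sub ((tendsto_growth hqt').const_mul β)
      exact ((hqt.time.sub hqt'.time).pow 2).const_mul γ
    refine ge_of_tendsto ht ?_
    filter_upwards [eventually_ge_atTop i] with j hj
    exact hmono (hj.trans (hφ.id_le j))
  let P₀ : S := ⟨p₀, hp₀, hpR⟩
  obtain ⟨q, hq0, hq1, hq2⟩ := exists_maximal_of_chains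
    (r := fun p q : S × S => Continues p.1.1 q.1.1 ∧ Continues p.2.1 q.2.1)
    (f := fun p : S × S => doubled T α γ β μ B w₁ w₂ p.1.1 p.2.1) (p₀ := (P₀, P₀))
    (fun p => ⟨Continues.refl _, Continues.refl _⟩)
    (fun p q s h1 h2 => ⟨h1.1.trans h2.1, h1.2.trans h2.2⟩)
    (hbdd.mono (image_subset_range _ _)) (fun p _ hp hmono => hchain p hp hmono) hδ
  have hT0 : ∀ s : ℝ × PathSpace d τ, Continues p₀ s → 0 ≤ s.1 := fun s hs => hp₀.1.trans hs.le
  refine ⟨q.1.1, q.2.1, q.1.2.1, q.2.2.1, q.1.2.2, q.2.2.2, hq0.1, hq0.2,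
    fun s s' a a' b b' c c' => ?_, fun s s' a a' b b' c c' => ?_⟩
  · exact hq1 (⟨s, ⟨hT0 s (hq0.1.trans a), b⟩, c⟩, ⟨s', ⟨hT0 s' (hq0.2.trans a'), b'⟩, c'⟩) ⟨a, a'⟩
  · exact hq2 (⟨s, ⟨hT0 s a, b⟩, c⟩, ⟨s', ⟨hT0 s' a', b'⟩, c'⟩) ⟨a, a'⟩

end Continuations

/-! ### The viscosity inequalities at a maximal point of the doubled functional -/

section Inequality

variable {d : ℕ} {τ T K : ℝ} [hτ : Fact (0 < τ)] {U : Type*} {P : Coefficients d U}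

theorem gap_swap (B : E d →L[ℝ] E d) (x y : PathSpace d τ) : gap B y x = -gap B x y := by
  simp only [gap, toH_sub, map_sub, ev_sub]
  abel

theorem primitiveL_swap (x y : PathSpace d τ) :
    primitiveL (y - x).toH = -primitiveL (x - y).toH := by
  rw [← map_neg, toH_sub, toH_sub, neg_sub]

theorem toH_neg (x : PathSpace d τ) : (-x).toH = -x.toH := by
  rw [← toHL_apply, map_neg, toHL_apply]

theorem penalty_swap (B : E d →L[ℝ] E d) (x y : PathSpace d τ) : penalty B y x = penalty B x y := by
  rw [penalty, penalty, gap_swap, primitiveL_swap, toH_neg, norm_neg, norm_neg]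

/-- Differences of infima are bounded by differences at a near-minimizer. -/
theorem exists_hamiltonian_sub_le [Nonempty U] (hP : CoefBound P τ T K) {s s' : ℝ}
    (hs : s ∈ Icc 0 T) (z z' : PathSpace d τ) (p p' : PathSpace d τ →L[ℝ] ℝ) {ε : ℝ} (hε : 0 < ε) :
    ∃ u, hamiltonian P s z p - hamiltonian P s' z' p' ≤
      p (jump (velocity P s z u)) + P.q s (z.ev 0) u
        - (p' (jump (velocity P s' z' u)) + P.q s' (z'.ev 0) u) + ε := by
  rw [hamiltonian_def, hamiltonian_def]
  obtain ⟨u, hu⟩ := exists_lt_of_ciInf_lt (lt_add_of_pos_right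
    (⨅ u : U, (p' (jump (velocity P s' z' u)) + P.q s' (z'.ev 0) u)) hε)
  have h1 := ciInf_le (bddBelow_hamiltonian hP hs z p) u
  exact ⟨u, by linarith⟩

/-- Fixing one of the two points turns the doubled functional into a difference with an admissible
test function of the other, and the two viscosity inequalities are subtracted. The `γ` terms cancel,
because the derivatives of `(s - s')²` in the two times are opposite. -/
theorem doubled_inequality [Nonempty U] (hT : 0 < T) (hP : CoefBound P τ T K)
    {α γ β μ R : ℝ} {B : ℝ → E d →L[ℝ] E d} (hB : ContDiff ℝ 1 B) {w₁ w₂ : ℝ → PathSpace d τ → ℝ}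
    (h₁ : IsSubsolution P T w₁) (h₂ : IsSupersolution P T w₂) {s s' : ℝ} {z z' : PathSpace d τ}
    (hs : s ∈ Ico 0 T) (hs' : s' ∈ Ico 0 T) (hz : z ∈ pathsIn (Metric.closedBall 0 R))
    (hz' : z' ∈ pathsIn (Metric.closedBall 0 R)) (hz0 : ‖z.ev 0‖ < R) (hz0' : ‖z'.ev 0‖ < R)
    (hmax : ∀ p p', Continues (s, z) p → Continues (s', z') p' → p.1 ≤ T → p'.1 ≤ T →
      p.2 ∈ pathsIn (Metric.closedBall 0 R) → p'.2 ∈ pathsIn (Metric.closedBall 0 R) →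
      doubled T α γ β μ B w₁ w₂ p p' ≤ doubled T α γ β μ B w₁ w₂ (s, z) (s', z')) {ε : ℝ}
    (hε : 0 < ε) : ∃ u, 0 ≤
      α * (2 * inner ℝ (gap (B s) z z')
            (deriv B s ((primitiveL (z - z').toH).ev (-τ)) + B s (z.ev 0 - z'.ev 0)
              - B s (z.ev (-τ) - z'.ev (-τ)) + (velocity P s z u - velocity P s' z' u))
          + 2 * inner ℝ (primitiveL (z - z').toH).toH (constPath (z.ev 0 - z'.ev 0)).toH
          - ‖(primitiveL (z - z').toH).ev (-τ)‖ ^ 2)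
        + β * (Real.exp (μ * (T - s)) * (‖z.ev 0‖ ^ 2 - ‖z.ev (-τ)‖ ^ 2
            + 2 * inner ℝ (z.ev 0) (velocity P s z u)) - μ * growth T μ s z)
        + β * (Real.exp (μ * (T - s')) * (‖z'.ev 0‖ ^ 2 - ‖z'.ev (-τ)‖ ^ 2
            + 2 * inner ℝ (z'.ev 0) (velocity P s' z' u)) - μ * growth T μ s' z')
        + (P.q s (z.ev 0) u - P.q s' (z'.ev 0) u) + ε := by
  have hR : R ≠ 0 := ((norm_nonneg _).trans_lt hz0).ne'
  have hcl : closure (Metric.ball (0 : E d) R) = Metric.closedBall 0 R := closure_ball 0 hR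
  have hsT : s ∈ Icc 0 T := ⟨hs.1, hs.2.le⟩
  have hsT' : s' ∈ Icc 0 T := ⟨hs'.1, hs'.2.le⟩
  have hBc : ContDiff ℝ 1 fun _ : ℝ => B s := contDiff_const
  have sub := h₁.test (Metric.ball 0 R) Metric.isOpen_ball Metric.isBounded_ball
    (testFn T α γ β μ B s' z') (isTest_testFn hB) s hs z (by rwa [hcl])
    (mem_ball_zero_iff.2 hz0) (by
      rw [hcl]
      have e : ∀ t x, w₁ t x - testFn T α γ β μ B s' z' t x
          = doubled T α γ β μ B w₁ w₂ (t, x) (s', z') + (w₂ s' z' + β * growth T μ s' z') := by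
        intro t x
        simp only [testFn, doubled]
        ring
      constructor
      · rintro _ ⟨t, ht, x, hx, rfl⟩
        beta_reduce
        rw [e, e]
        exact add_le_add_left (hmax _ _ (continues_concat ht.1 z x) (Continues.refl _) ht.2 hsT'.2
          (concat_mem_pathsIn ht.1 hz hx) hz') _
      · intro b hb
        exact hb ⟨s, ⟨le_rfl, hsT.2⟩, z, hz, by rw [concat_self]⟩)
  -- The penalty uses `B` at the first time only, so as a function of the second point its
  -- coefficient is the constant `B s`, and `deriv B` occurs only once.
  have sup := h₂.test (Metric.ball 0 R) Metric.isOpen_ball Metric.isBounded_ball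
    (testFn T α γ β μ (fun _ => B s) s z) (isTest_testFn hBc) s' hs' z' (by rwa [hcl])
    (mem_ball_zero_iff.2 hz0') (by
      rw [hcl]
      have e : ∀ t x, w₂ t x + testFn T α γ β μ (fun _ => B s) s z t x
          = -doubled T α γ β μ B w₁ w₂ (s, z) (t, x) + (w₁ s z - β * growth T μ s z) := by
        intro t x
        simp only [testFn, doubled]
        rw [penalty_swap]
        ring
      constructor
      · rintro _ ⟨t, ht, x, hx, rfl⟩
        beta_reduce
        rw [e, e]
        exact add_le_add_left (neg_le_neg (hmax _ _ (Continues.refl _) (continues_concat ht.1 z' x)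
          hsT.2 ht.2 hz (concat_mem_pathsIn ht.1 hz' hx))) _
      · intro b hb
        exact hb ⟨s', ⟨le_rfl, hsT'.2⟩, z', hz', by rw [concat_self]⟩)
  obtain ⟨u, hu⟩ := exists_hamiltonian_sub_le hP (s' := s') hsT z z'
    (fderiv ℝ (testFn T α γ β μ B s' z' s) z)
    (-fderiv ℝ (testFn T α γ β μ (fun _ => B s) s z s') z') hε
  rw [neg_apply, fderiv_testFn_jump hB, fderiv_testFn_jump hBc] at hu
  rw [dt_testFn hT hB hsT, genS_testFn] at sub
  rw [dt_testFn hT hBc hsT', genS_testFn] at sup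
  have e1 : inner ℝ (primitiveL (z - z').toH).toH (constPath (z.ev 0) - z).toH
      - inner ℝ (primitiveL (z - z').toH).toH (constPath (z'.ev 0) - z').toH
      = inner ℝ (primitiveL (z - z').toH).toH (constPath (z.ev 0 - z'.ev 0)).toH
        - inner ℝ (primitiveL (z - z').toH).toH (z - z').toH := by
    rw [← inner_sub_right, ← inner_sub_right, ← toH_sub, ← toH_sub]
    congr 2
    refine path_ext fun θ hθ => ?_
    simp only [ev_sub, constPath_ev _ hθ]
    abel
  -- Turns the pairing of the primitive with the path difference into the negative square that later
  -- absorbs cross terms.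
  have e2 := two_inner_primitive (z - z')
  have e3 : inner ℝ (gap (B s) z z')
      (deriv B s ((primitiveL (z - z').toH).ev (-τ)) + B s (z.ev 0 - z'.ev 0)
        - B s (z.ev (-τ) - z'.ev (-τ)) + (velocity P s z u - velocity P s' z' u))
      = inner ℝ (gap (B s) z z') (deriv B s ((primitiveL (z - z').toH).ev (-τ)))
        + inner ℝ (gap (B s) z z') (B s (z.ev 0 - z.ev (-τ)))
        - inner ℝ (gap (B s) z z') (B s (z'.ev 0 - z'.ev (-τ)))
        + inner ℝ (gap (B s) z z') (velocity P s z u)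
        - inner ℝ (gap (B s) z z') (velocity P s' z' u) := by
    simp only [inner_add_right, inner_sub_right, map_sub]
    ring
  simp only [gap_swap (B s) z z', primitiveL_swap z z', toH_neg, inner_neg_left, deriv_const,
    zero_apply, inner_zero_right] at sup hu
  refine ⟨u, ?_⟩
  rw [e3]
  generalize inner ℝ (gap (B s) z z') (deriv B s ((primitiveL (z - z').toH).ev (-τ))) = i1 at *
  generalize inner ℝ (gap (B s) z z') (B s (z.ev 0 - z.ev (-τ))) = i2 at *
  generalize inner ℝ (gap (B s) z z') (B s (z'.ev 0 - z'.ev (-τ))) = i3 at *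
  generalize inner ℝ (gap (B s) z z') (velocity P s z u) = i4 at *
  generalize inner ℝ (gap (B s) z z') (velocity P s' z' u) = i5 at *
  generalize inner ℝ (primitiveL (z - z').toH).toH (constPath (z.ev 0) - z).toH = j1 at *
  generalize inner ℝ (primitiveL (z - z').toH).toH (constPath (z'.ev 0) - z').toH = j2 at *
  generalize inner ℝ (primitiveL (z - z').toH).toH (constPath (z.ev 0 - z'.ev 0)).toH = j3 at *
  generalize inner ℝ (primitiveL (z - z').toH).toH (z - z').toH = j4 at *
  generalize hamiltonian P s z (fderiv ℝ (testFn T α γ β μ B s' z' s) z) = H1 at *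
  generalize hamiltonian P s' z' (-fderiv ℝ (testFn T α γ β μ (fun _ => B s) s z s') z') = H2 at *
  rw [← e2]
  have e4 : 2 * α * (j1 - j2) = 2 * α * (j3 - j4) := by rw [e1]
  linarith only [sub, sup, hu, e4]

end Inequality

/-! ### Estimates for the comparison argument -/

section Estimates

variable {d : ℕ} {τ T K : ℝ} [hτ : Fact (0 < τ)] {U : Type*} {P : Coefficients d U}

theorem abs_delayInner_le_toH (hP : CoefBound P τ T K) (z : PathSpace d τ) :
    |delayInner τ P.a z.ev| ≤ K * (√τ * ‖z.toH‖) := by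
  refine (abs_delayInner_le hP ((isRC_ev z).intervalIntegrable _ _)).trans ?_
  have := integral_norm_le_toH z le_rfl neg_le_zero' le_rfl
  rw [zero_sub, neg_neg] at this
  exact mul_le_mul_of_nonneg_left this (zero_le_one.trans hP.one_le)

/-- Rests on `a(-τ) = 0` through `a_volterra`. A bound by the supremum of the primitive would not be
dominated by the square root of the penalty. -/
theorem abs_delayInner_sub_le_primitive (hP : CoefBound P τ T K) (z z' : PathSpace d τ) :
    |delayInner τ P.a z.ev - delayInner τ P.a z'.ev| ≤ K * ‖(primitiveL (z - z').toH).toH‖ := by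
  rw [delayInner_sub hP ((isRC_ev z).intervalIntegrable _ _) ((isRC_ev z').intervalIntegrable _ _)]
  refine (hP.a_volterra (fun θ => (z - z').ev θ) ((isRC_ev _).intervalIntegrable _ _)).trans ?_
  refine mul_le_mul_of_nonneg_left ?_ (zero_le_one.trans hP.one_le)
  refine Real.sqrt_le_iff.2 ⟨norm_nonneg _, ?_⟩
  rw [norm_toH_sq]
  refine (intervalIntegral.integral_congr fun θ hθ => ?_).le
  rw [uIcc_of_le neg_le_zero'] at hθ
  simp only [primitiveL_ev _ hθ]

/-- The growth function decays along all trajectories if `μ` is large. -/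
theorem exists_growth_decay (hP : CoefBound P τ T K) : ∃ μ ≥ (0 : ℝ), ∀ s ∈ Icc 0 T,
    ∀ (z : PathSpace d τ) (u : U), Real.exp (μ * (T - s)) * (‖z.ev 0‖ ^ 2 - ‖z.ev (-τ)‖ ^ 2
      + 2 * inner ℝ (z.ev 0) (velocity P s z u)) - μ * growth T μ s z ≤ -1 := by
  have hK := hP.one_le
  have hτ0 := hτ.out.le
  have hμ : 0 ≤ 2 + 3 * K + K ^ 4 * τ + K ^ 2 := by positivity
  refine ⟨2 + 3 * K + K ^ 4 * τ + K ^ 2, hμ, fun s hs z u => ?_⟩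
  set μ := 2 + 3 * K + K ^ 4 * τ + K ^ 2 with hμd
  have hv : ‖velocity P s z u‖ ≤ K * (1 + ‖z.ev 0‖ + K * (√τ * ‖z.toH‖)) + K * ‖z.ev (-τ)‖ := by
    refine (norm_add_le _ _).trans (add_le_add ?_ ?_)
    · refine (hP.F_growth s hs _ _ _).trans ?_
      gcongr
      exact abs_delayInner_le_toH hP z
    · exact (ContinuousLinearMap.le_opNorm _ _).trans (by gcongr; exact hP.b_le s hs)
  have hin : inner ℝ (z.ev 0) (velocity P s z u) ≤ ‖z.ev 0‖ *
      (K * (1 + ‖z.ev 0‖ + K * (√τ * ‖z.toH‖)) + K * ‖z.ev (-τ)‖) :=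
    (real_inner_le_norm _ _).trans (by gcongr)
  have he : 1 ≤ Real.exp (μ * (T - s)) := Real.one_le_exp (mul_nonneg hμ (sub_nonneg.2 hs.2))
  rw [growth]
  generalize Real.exp (μ * (T - s)) = e at he
  generalize inner ℝ (z.ev 0) (velocity P s z u) = i at hin
  have ha := norm_nonneg (z.ev 0)
  have hb := norm_nonneg (z.ev (-τ))
  have hn := norm_nonneg z.toH
  generalize ‖z.ev 0‖ = a at *
  generalize ‖z.ev (-τ)‖ = b at *
  generalize ‖z.toH‖ = n at *
  have hr := Real.sq_sqrt hτ0
  generalize √τ = r at *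
  have key : a ^ 2 - b ^ 2 + 2 * i ≤ (μ - 1) * (1 + a ^ 2 + n ^ 2) := by
    have k1 : 2 * (a * K) ≤ K * (1 + a ^ 2) := by nlinarith [sq_nonneg (a - 1)]
    have k2 : 2 * (a * (K * (K * (r * n)))) ≤ K ^ 4 * τ * a ^ 2 + n ^ 2 := by
      rw [← hr]; nlinarith [sq_nonneg (K ^ 2 * r * a - n)]
    -- The point delay is absorbed by `-|x(-τ)|²`, which the generator produces from the squared
    -- norm of `H`.
    have k3 : 2 * (a * (K * b)) ≤ K ^ 2 * a ^ 2 + b ^ 2 := by nlinarith [sq_nonneg (K * a - b)]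
    have k4 : 0 ≤ (2 * K + K ^ 4 * τ + K ^ 2) * n ^ 2 := by positivity
    have k5 : 0 ≤ K * n ^ 2 := by positivity
    have k6 : 0 ≤ K ^ 4 * τ := by positivity
    have k7 : 0 ≤ K ^ 2 := by positivity
    rw [hμd]
    linarith
  have hpos : (1 : ℝ) ≤ 1 + a ^ 2 + n ^ 2 := by nlinarith [sq_nonneg a, sq_nonneg n]
  have h1 : e * (a ^ 2 - b ^ 2 + 2 * i) ≤ e * ((μ - 1) * (1 + a ^ 2 + n ^ 2)) :=
    mul_le_mul_of_nonneg_left key (zero_le_one.trans he)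
  have h2 : 1 * 1 ≤ e * (1 + a ^ 2 + n ^ 2) := mul_le_mul he hpos zero_le_one (zero_le_one.trans he)
  linarith

/-- The constant in the estimate of the penalty terms. -/
def penaltyConst (K τ : ℝ) : ℝ :=
  1 + 4 * K + K ^ 2 + √τ + 2 * (K + 2 * K ^ 2) ^ 2 + 2 * τ * K ^ 2

/-- Once `g` is replaced by `x + K * i`, the quantity `i` appears only linearly, against `x` and
`n`, and `-i ^ 2` absorbs it by completing the square. In use, `x` is the norm of the gap, `n` the
`H` norm of the primitive, `i` the primitive at `-τ`, and `c` the error. -/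
theorem penalty_quadratic {K τ x n i g c : ℝ} (hK : 0 ≤ K) (hτ : 0 ≤ τ) (hx : 0 ≤ x) (hn : 0 ≤ n)
    (hg : g ≤ x + K * i) :
    2 * (x * (K * i + K * g + (K * (g + K * n) + c))) + 2 * (n * (√τ * g)) - i ^ 2
      ≤ penaltyConst K τ * (x ^ 2 + n ^ 2) + c ^ 2 := by
  have hr := Real.sq_sqrt hτ
  have hr0 := Real.sqrt_nonneg τ
  unfold penaltyConst
  generalize √τ = r at *
  have h1 : x * g ≤ x * (x + K * i) := mul_le_mul_of_nonneg_left hg hx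
  have h2 : (n * r) * g ≤ (n * r) * (x + K * i) := mul_le_mul_of_nonneg_left hg (by positivity)
  have h3 : 2 * (x * n) * (K ^ 2 + r) ≤ (x ^ 2 + n ^ 2) * (K ^ 2 + r) :=
    mul_le_mul_of_nonneg_right (by nlinarith [sq_nonneg (x - n)]) (by positivity)
  have h4 := sq_nonneg (i - ((K + 2 * K ^ 2) * x + r * K * n))
  have h5 := sq_nonneg ((K + 2 * K ^ 2) * x - r * K * n)
  have h6 := sq_nonneg (x - c)
  have h7 : 0 ≤ 4 * K * n ^ 2 := by positivity
  have h8 : 0 ≤ 2 * (K + 2 * K ^ 2) ^ 2 * n ^ 2 := by positivity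
  have h9 : 0 ≤ 2 * τ * K ^ 2 * x ^ 2 := by positivity
  have h10 : K * (x * g) ≤ K * (x * (x + K * i)) := mul_le_mul_of_nonneg_left h1 hK
  have h11 : 2 * (r * K * n) ^ 2 = 2 * τ * K ^ 2 * n ^ 2 := by rw [← hr]; ring
  nlinarith only [h2, h3, h4, h5, h6, h7, h8, h9, h10, h11, sq_nonneg n]

theorem norm_value_le_gap {B : E d →L[ℝ] E d} (hB : ‖B‖ ≤ K) (z z' : PathSpace d τ) :
    ‖z.ev 0 - z'.ev 0‖ ≤ ‖gap B z z'‖ + K * ‖(primitiveL (z - z').toH).ev (-τ)‖ := by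
  have e : z.ev 0 - z'.ev 0 = gap B z z' - B ((primitiveL (z - z').toH).ev (-τ)) := by
    rw [gap]; abel
  rw [e]
  refine (norm_sub_le _ _).trans (add_le_add_right ?_ _)
  exact (B.le_opNorm _).trans (by gcongr)

/-- Up to replacing `B` by `P.b` and `s` by `s'`, the point delays of the velocities cancel against
`B (z(-τ) - z'(-τ))`. Only these replacements need the bound `R`, and they make up the error; the
rest is a quadratic form in the penalty variables. -/
theorem penalty_terms_le (hP : CoefBound P τ T K) {R η : ℝ} {B B' : E d →L[ℝ] E d} {s s' : ℝ}
    (hs : s ∈ Icc 0 T) (hs' : s' ∈ Icc 0 T) (hB : ‖B‖ ≤ K) (hB' : ‖B'‖ ≤ K)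
    (hBb : ‖B - P.b s‖ ≤ K * η) {z z' : PathSpace d τ}
    (hz : ‖z.ev (-τ)‖ ≤ R) (hz' : ‖z'.ev (-τ)‖ ≤ R) (u : U) :
    2 * inner ℝ (gap B z z')
          (B' ((primitiveL (z - z').toH).ev (-τ)) + B (z.ev 0 - z'.ev 0)
            - B (z.ev (-τ) - z'.ev (-τ)) + (velocity P s z u - velocity P s' z' u))
        + 2 * inner ℝ (primitiveL (z - z').toH).toH (constPath (z.ev 0 - z'.ev 0)).toH
        - ‖(primitiveL (z - z').toH).ev (-τ)‖ ^ 2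
      ≤ penaltyConst K τ * penalty B z z' + (K * ((1 + R) * |s - s'| + 2 * R * η)) ^ 2 := by
  have hK := zero_le_one.trans hP.one_le
  have hη : 0 ≤ K * η := (norm_nonneg _).trans hBb
  set G := primitiveL (z - z').toH with hG
  set g := z.ev 0 - z'.ev 0 with hg
  set D := |s - s'| with hD
  have hD0 : 0 ≤ D := abs_nonneg _
  have hR : 0 ≤ R := (norm_nonneg _).trans hz
  have hF : ‖P.F s (z.ev 0) (delayInner τ P.a z.ev) u - P.F s' (z'.ev 0) (delayInner τ P.a z'.ev) u‖
      ≤ K * (D + ‖g‖ + K * ‖G.toH‖) := by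
    refine (hP.F_lip s hs s' hs' _ _ _ _ u).trans ?_
    rw [abs_sub_comm s' s]
    gcongr
    exact abs_delayInner_sub_le_primitive hP z z'
  have hb1 : ‖(P.b s - B) (z.ev (-τ))‖ ≤ K * η * R := by
    refine (ContinuousLinearMap.le_opNorm _ _).trans ?_
    rw [norm_sub_rev]
    gcongr
  have hb2 : ‖(B - P.b s) (z'.ev (-τ))‖ ≤ K * η * R := by
    refine (ContinuousLinearMap.le_opNorm _ _).trans ?_
    gcongr
  have hb3 : ‖(P.b s - P.b s') (z'.ev (-τ))‖ ≤ K * D * R := by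
    refine (ContinuousLinearMap.le_opNorm _ _).trans ?_
    gcongr
    exact hP.b_lip s' hs' s hs
  have hB1 : ‖B' (G.ev (-τ))‖ ≤ K * ‖G.ev (-τ)‖ := (B'.le_opNorm _).trans (by gcongr)
  have hB2 : ‖B g‖ ≤ K * ‖g‖ := (B.le_opNorm _).trans (by gcongr)
  have hW : ‖B' (G.ev (-τ)) + B g - B (z.ev (-τ) - z'.ev (-τ))
      + (velocity P s z u - velocity P s' z' u)‖
      ≤ K * ‖G.ev (-τ)‖ + K * ‖g‖
        + (K * (‖g‖ + K * ‖G.toH‖) + K * ((1 + R) * D + 2 * R * η)) := by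
    have e : B' (G.ev (-τ)) + B g - B (z.ev (-τ) - z'.ev (-τ))
        + (velocity P s z u - velocity P s' z' u)
        = B' (G.ev (-τ)) + B g + (P.F s (z.ev 0) (delayInner τ P.a z.ev) u
            - P.F s' (z'.ev 0) (delayInner τ P.a z'.ev) u) + ((P.b s - B) (z.ev (-τ))
          + (B - P.b s) (z'.ev (-τ)) + (P.b s - P.b s') (z'.ev (-τ))) := by
      simp only [velocity, map_sub, sub_apply]
      abel
    rw [e]
    have n1 := norm_add_le (B' (G.ev (-τ)) + B g + (P.F s (z.ev 0) (delayInner τ P.a z.ev) u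
            - P.F s' (z'.ev 0) (delayInner τ P.a z'.ev) u)) ((P.b s - B) (z.ev (-τ))
          + (B - P.b s) (z'.ev (-τ)) + (P.b s - P.b s') (z'.ev (-τ)))
    have n2 := norm_add₃_le (a := B' (G.ev (-τ))) (b := B g) (c := P.F s (z.ev 0)
      (delayInner τ P.a z.ev) u - P.F s' (z'.ev 0) (delayInner τ P.a z'.ev) u)
    have n3 := norm_add₃_le (a := (P.b s - B) (z.ev (-τ))) (b := (B - P.b s) (z'.ev (-τ)))
      (c := (P.b s - P.b s') (z'.ev (-τ)))
    linarith only [n1, n2, n3, hF, hb1, hb2, hb3, hB1, hB2]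
  have hc : ‖(constPath g : PathSpace d τ).toH‖ ≤ √τ * ‖g‖ :=
    norm_toH_le _ fun θ hθ => by rw [constPath_ev _ hθ]
  have hi1 := (real_inner_le_norm (gap B z z') _).trans
    (mul_le_mul_of_nonneg_left hW (norm_nonneg (gap B z z')))
  have hi2 := (real_inner_le_norm G.toH (constPath g).toH).trans
    (mul_le_mul_of_nonneg_left hc (norm_nonneg G.toH))
  have key := penalty_quadratic (K := K) (τ := τ) (x := ‖gap B z z'‖) (n := ‖G.toH‖)
    (i := ‖G.ev (-τ)‖) (g := ‖g‖) (c := K * ((1 + R) * D + 2 * R * η)) hK hτ.out.le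
    (norm_nonneg _) (norm_nonneg _) (norm_value_le_gap hB z z')
  rw [penalty]
  linarith only [hi1, hi2, key]

end Estimates

/-! ### The inequality at a maximum and the choice of penalization parameters. -/

section Comparison

variable {d : ℕ} {τ T K : ℝ} [hτ : Fact (0 < τ)] {U : Type*} {P : Coefficients d U}

/-- Each growth term is at most `-β`, which puts `2 * β` on the left. The aim is to make everything
on the right small. -/
theorem doubled_estimate [Nonempty U] (hT : 0 < T) (hP : CoefBound P τ T K) {L : ℝ} {ρ : ℝ → ℝ → ℝ}
    (hρ : IsLocalModulus ρ) (hq : ∀ t ∈ Icc 0 T, ∀ s ∈ Icc 0 T, ∀ (x y : E d) (u : U),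
      |P.q t x u - P.q s y u| + |P.φ x - P.φ y| ≤ L * ‖x - y‖ + ρ |s - t| (max ‖x‖ ‖y‖)) {μ : ℝ}
    (hμ : ∀ s ∈ Icc 0 T, ∀ (z : PathSpace d τ) (u : U),
      Real.exp (μ * (T - s)) * (‖z.ev 0‖ ^ 2 - ‖z.ev (-τ)‖ ^ 2
        + 2 * inner ℝ (z.ev 0) (velocity P s z u)) - μ * growth T μ s z ≤ -1)
    {α γ β R η : ℝ} (hα : 0 ≤ α) (hβ : 0 ≤ β) {B : ℝ → E d →L[ℝ] E d} (hB : ContDiff ℝ 1 B)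
    (hBK : ∀ t, ‖B t‖ ≤ K) (hBK' : ∀ t, ‖deriv B t‖ ≤ K)
    (hBb : ∀ t ∈ Icc 0 T, ‖B t - P.b t‖ ≤ K * η) {w₁ w₂ : ℝ → PathSpace d τ → ℝ}
    (h₁ : IsSubsolution P T w₁) (h₂ : IsSupersolution P T w₂) {s s' : ℝ} {z z' : PathSpace d τ}
    (hs : s ∈ Ico 0 T) (hs' : s' ∈ Ico 0 T) (hz : z ∈ pathsIn (Metric.closedBall 0 R))
    (hz' : z' ∈ pathsIn (Metric.closedBall 0 R)) (hz0 : ‖z.ev 0‖ < R) (hz0' : ‖z'.ev 0‖ < R)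
    (hmax : ∀ p p', Continues (s, z) p → Continues (s', z') p' → p.1 ≤ T → p'.1 ≤ T →
      p.2 ∈ pathsIn (Metric.closedBall 0 R) → p'.2 ∈ pathsIn (Metric.closedBall 0 R) →
      doubled T α γ β μ B w₁ w₂ p p' ≤ doubled T α γ β μ B w₁ w₂ (s, z) (s', z')) :
    2 * β ≤ α * (penaltyConst K τ * penalty (B s) z z'
        + (K * ((1 + R) * |s - s'| + 2 * R * η)) ^ 2)
      + L * ‖z.ev 0 - z'.ev 0‖ + ρ |s - s'| R := by
  refine le_of_forall_pos_le_add fun ε hε => ?_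
  obtain ⟨u, hu⟩ := doubled_inequality hT hP hB h₁ h₂ hs hs' hz hz' hz0 hz0' hmax hε
  have hsT : s ∈ Icc 0 T := ⟨hs.1, hs.2.le⟩
  have hsT' : s' ∈ Icc 0 T := ⟨hs'.1, hs'.2.le⟩
  have k1 := mul_le_mul_of_nonneg_left (hμ s hsT z u) hβ
  have k2 := mul_le_mul_of_nonneg_left (hμ s' hsT' z' u) hβ
  have k3 := mul_le_mul_of_nonneg_left (penalty_terms_le hP hsT hsT' (hBK s) (hBK' s) (hBb s hsT)
    (mem_closedBall_zero_iff.1 (hz _ mem_left)) (mem_closedBall_zero_iff.1 (hz' _ mem_left)) u) hα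
  have k4 := hq s hsT s' hsT' (z.ev 0) (z'.ev 0) u
  have k5 := abs_nonneg (P.φ (z.ev 0) - P.φ (z'.ev 0))
  have k6 := le_abs_self (P.q s (z.ev 0) u - P.q s' (z'.ev 0) u)
  have k7 := hρ.mono |s' - s| (abs_nonneg _) _ (le_max_of_le_left (norm_nonneg (z.ev 0)))
    |s' - s| le_rfl R (max_le hz0.le hz0'.le)
  rw [abs_sub_comm s' s] at k4 k7
  linarith only [hu, k1, k2, k3, k4, k5, k6, k7]

/-- Interpolation of the supremum of a primitive between its `L²` norm and the bound of its
derivative. -/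
theorem norm_primitiveL_le {R κ : ℝ} (hκ : 0 < κ) (g : PathSpace d τ)
    (hg : ∀ θ ∈ Icc (-τ) 0, ‖g.ev θ‖ ≤ 2 * R) :
    ‖primitiveL g.toH‖ ≤ κ + 16 * R * ‖(primitiveL g.toH).toH‖ ^ 2 / κ ^ 2 := by
  set G := primitiveL g.toH with hG
  have hR : 0 ≤ 2 * R := (norm_nonneg _).trans (hg 0 mem_zero)
  have hlip : ∀ l ∈ Icc (-τ) 0, ∀ r ∈ Icc (-τ) 0, l ≤ r → ‖G.ev l - G.ev r‖ ≤ 2 * R * (r - l) := by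
    intro l hl r hr hlr
    have hi := (isRC_ev g).intervalIntegrable
    rw [hG, primitiveL_ev _ hl, primitiveL_ev _ hr,
      ← intervalIntegral.integral_add_adjacent_intervals (hi l r) (hi r 0), add_sub_cancel_right]
    have := intervalIntegral.norm_integral_le_of_norm_le_const (a := l) (b := r) (C := 2 * R)
      (f := g.ev) fun θ hθ => by
        rw [uIoc_of_le hlr] at hθ
        exact hg θ ⟨hl.1.trans hθ.1.le, hθ.2.trans hr.2⟩
    rwa [abs_of_nonneg (sub_nonneg.2 hlr)] at this
  have hG0 : G.ev 0 = 0 := by rw [hG, primitiveL_ev _ mem_zero]; simp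
  have hsq := norm_toH_sq G
  refine norm_path_le _ fun l hl => ?_
  by_cases hW : ‖G.ev l‖ ≤ κ
  · exact hW.trans (le_add_of_nonneg_right (by
      have : 0 ≤ R := by linarith
      positivity))
  push Not at hW
  set W := ‖G.ev l‖ with hWd
  have hWpos : 0 < W := hκ.trans hW
  have hWl : W ≤ 2 * R * (0 - l) := by
    have := hlip l hl 0 mem_zero hl.2
    rwa [hG0, sub_zero] at this
  have hRpos : 0 < R := by
    by_contra h
    have : 2 * R = 0 := by linarith
    rw [this, zero_mul] at hWl
    linarith
  -- The primitive has Lipschitz constant `2 * R`, so it keeps at least half of its size `W` over a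
  -- length `W / (4 * R)` to the right of `l`. There is room for this interval because the primitive
  -- vanishes at `0`. Hence `W ^ 3` is at most `16 * R` times its squared `L²` norm.
  set h := W / (4 * R) with hh
  have hh0 : 0 < h := by positivity
  have hWh : W = 4 * R * h := by rw [hh]; field_simp
  have hlh : l + h ≤ 0 := by
    by_contra hc
    push Not at hc
    nlinarith
  have hint : (W / 2) ^ 2 * h ≤ ‖G.toH‖ ^ 2 := by
    rw [hsq]
    have h1 : ∫ θ in l..(l + h), (W / 2) ^ 2 ≤ ∫ θ in l..(l + h), ‖G.ev θ‖ ^ 2 := by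
      refine intervalIntegral.integral_mono_on (by linarith) intervalIntegrable_const
        ((isRC_ev G).sq_intervalIntegrable _ _) fun θ hθ => ?_
      have h2 := hlip l hl θ ⟨hl.1.trans hθ.1, hθ.2.trans hlh⟩ hθ.1
      have h3 : W ≤ ‖G.ev l - G.ev θ‖ + ‖G.ev θ‖ := by
        simpa using norm_add_le (G.ev l - G.ev θ) (G.ev θ)
      have h4 : 2 * R * (θ - l) ≤ 2 * R * h := by gcongr; linarith [hθ.2]
      exact pow_le_pow_left₀ (by positivity) (by linarith) 2
    rw [intervalIntegral.integral_const, add_sub_cancel_left, smul_eq_mul] at h1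
    have h5 := integral_sq_mono (isRC_ev G) hl.1 (by linarith : l ≤ l + h) hlh
    linarith
  have hW3 : W ^ 3 ≤ 16 * R * ‖G.toH‖ ^ 2 := by
    have : W ^ 3 = 16 * R * ((W / 2) ^ 2 * h) := by rw [hh]; field_simp; ring
    rw [this]
    gcongr
  have hfin : W ≤ 16 * R * ‖G.toH‖ ^ 2 / κ ^ 2 := by
    rw [le_div_iff₀ (by positivity)]
    refine le_trans ?_ hW3
    have : κ ^ 2 ≤ W ^ 2 := by gcongr
    nlinarith
  linarith

/-- Choice of the penalization parameters. -/
theorem exists_penalization {C K R κ r : ℝ} (hC : 0 ≤ C) (hK : 0 ≤ K) (hR : 0 ≤ R) (hκ : 0 < κ)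
    (hκ1 : κ ≤ 1) (hr : 0 < r) : ∃ α γ η : ℝ, 0 < α ∧ 0 < γ ∧ 0 < η ∧ α * η ^ 2 ≤ κ ∧
      ∀ p D W g : ℝ, 0 ≤ p → 0 ≤ D → W ≤ κ + 16 * R * p / κ ^ 2 → g ≤ √p + K * W →
        α * p + γ * D ^ 2 ≤ C * (g + √D + W) + κ →
        α * p ≤ (2 * C * (K + 3) + 2) * κ ∧ α * D ^ 2 ≤ (2 * C * (K + 3) + 2) * κ ∧
        g ≤ (K + 2 + (2 * C * (K + 3) + 2)) * κ ∧ √D ≤ (1 + (2 * C * (K + 3) + 2)) * κ ∧ D < r := by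
  -- `A` is the coefficient of `p` in the resulting bound for `g + W`. The value of `α` below
  -- absorbs `C * (p * A)` twice over.
  set A := 1 / κ + (K + 1) * (16 * R) / κ ^ 2 with hA
  set C₂ := 2 * C * (K + 3) + 2 with hC₂
  have hA1 : 1 ≤ A := by
    have h1 : 1 ≤ 1 / κ := by rw [le_div_iff₀ hκ]; linarith
    have h2 : 0 ≤ (K + 1) * (16 * R) / κ ^ 2 := by positivity
    linarith
  have hC₂0 : 0 ≤ C₂ := by positivity
  set α := 2 * C * A + A with hα
  have hCA : 0 ≤ C * A := by positivity
  have hα1 : 1 ≤ α := by rw [hα]; linarith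
  have hκ3 : 0 < 1 / κ ^ 3 := by positivity
  have hr2 : 0 ≤ (C₂ * κ + 1) / r ^ 2 := by positivity
  -- The first part absorbs `√D ≤ κ + D ^ 2 / κ ^ 3`, the second controls `α * D ^ 2`, and the third
  -- forces `D < r`.
  set γ := (2 * C + 1) * (1 / κ ^ 3) + α + (C₂ * κ + 1) / r ^ 2 with hγ
  have hCκ3 : 0 ≤ C * (1 / κ ^ 3) := by positivity
  -- The smoothing scale is chosen last, because its square is multiplied by `α`.
  refine ⟨α, γ, κ / α, by linarith, by rw [hγ]; linarith, by positivity, ?_, ?_⟩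
  · have : α * (κ / α) ^ 2 = κ * (κ / α) := by field_simp
    rw [this]
    refine mul_le_of_le_one_right hκ.le ?_
    rw [div_le_one (by linarith)]
    linarith
  intro p D W g hp hD hW hg hmain
  have hsp : √p ≤ κ + p * (1 / κ) := by
    rcases le_total (√p) κ with h | h
    · have : 0 ≤ p * (1 / κ) := by positivity
      linarith
    · have : √p ≤ p * (1 / κ) := by
        rw [mul_one_div, le_div_iff₀ hκ]
        nlinarith [Real.mul_self_sqrt hp, Real.sqrt_nonneg p]
      linarith
  have hsD : √D ≤ κ + D ^ 2 * (1 / κ ^ 3) := by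
    rcases le_total (√D) κ with h | h
    · have : 0 ≤ D ^ 2 * (1 / κ ^ 3) := by positivity
      linarith
    · have : √D ≤ D ^ 2 * (1 / κ ^ 3) := by
        rw [mul_one_div, le_div_iff₀ (by positivity)]
        have h1 : κ ^ 3 ≤ √D ^ 3 := by gcongr
        have h2 : D ^ 2 = √D * √D ^ 3 := by
          nth_rewrite 1 [← Real.sq_sqrt hD]; ring
        rw [h2]
        exact mul_le_mul_of_nonneg_left h1 (Real.sqrt_nonneg D)
      linarith
  have hW' : (K + 1) * W ≤ (K + 1) * κ + p * ((K + 1) * (16 * R) / κ ^ 2) := by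
    calc _ ≤ (K + 1) * (κ + 16 * R * p / κ ^ 2) := by gcongr
      _ = _ := by ring
  have hpA : p * A = p * (1 / κ) + p * ((K + 1) * (16 * R) / κ ^ 2) := by rw [hA]; ring
  have hgW : g + W ≤ (K + 2) * κ + p * A := by linarith
  have hsum : α * p + γ * D ^ 2 ≤ C * ((K + 3) * κ + p * A + D ^ 2 * (1 / κ ^ 3)) + κ := by
    refine hmain.trans (add_le_add_left (mul_le_mul_of_nonneg_left ?_ hC) _)
    linarith
  have hD2 : 0 ≤ D ^ 2 := sq_nonneg D
  have t1 : α * p = 2 * (C * (p * A)) + p * A := by rw [hα]; ring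
  have t2 : γ * D ^ 2 = 2 * (C * (D ^ 2 * (1 / κ ^ 3))) + D ^ 2 * (1 / κ ^ 3) + α * D ^ 2
      + (C₂ * κ + 1) / r ^ 2 * D ^ 2 := by rw [hγ]; ring
  have s1 : 0 ≤ p * A := by positivity
  have s2 : 0 ≤ D ^ 2 * (1 / κ ^ 3) := by positivity
  have s3 : 0 ≤ α * D ^ 2 := by positivity
  have s4 : 0 ≤ (C₂ * κ + 1) / r ^ 2 * D ^ 2 := by positivity
  have s5 : 0 ≤ C * (p * A) := by positivity
  have s6 : 0 ≤ C * (D ^ 2 * (1 / κ ^ 3)) := by positivity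
  have hbound : α * p + γ * D ^ 2 ≤ C₂ * κ := by
    have e : C₂ * κ = 2 * (C * ((K + 3) * κ)) + 2 * κ := by rw [hC₂]; ring
    rw [e]
    linarith
  have hγD : 0 ≤ γ * D ^ 2 := by linarith
  have hαp : 0 ≤ α * p := by linarith
  refine ⟨by linarith, by linarith, ?_, by linarith, ?_⟩
  · have hκK : 0 ≤ K * κ := by positivity
    rcases le_total 0 W with h | h
    · linarith
    · have : K * W ≤ 0 := mul_nonpos_of_nonneg_of_nonpos hK h
      have s7 : 0 ≤ p * ((K + 1) * (16 * R) / κ ^ 2) := by positivity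
      linarith
  · have h1 : (C₂ * κ + 1) / r ^ 2 * D ^ 2 ≤ C₂ * κ := by linarith
    have h2 : (C₂ * κ + 1) * D ^ 2 ≤ C₂ * κ * r ^ 2 := by
      rw [div_mul_eq_mul_div, div_le_iff₀ (by positivity)] at h1
      exact h1
    by_contra hc
    push Not at hc
    have h3 : r ^ 2 ≤ D ^ 2 := by gcongr
    have h4 : 0 < r ^ 2 := by positivity
    have h5 : C₂ * κ * r ^ 2 ≤ C₂ * κ * D ^ 2 := by gcongr
    linarith

end Comparison

/-! ### The comparison principle. -/

section ComparisonPrinciple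

variable {d : ℕ} {τ T K : ℝ} [hτ : Fact (0 < τ)] {U : Type*} {P : Coefficients d U}

theorem penalty_self (B : E d →L[ℝ] E d) (x : PathSpace d τ) : penalty B x x = 0 := by
  rw [penalty, gap, ← toHL_apply, ← toHL_apply]
  simp only [sub_self, map_zero]
  rw [← evL_apply]
  simp

theorem IsLocalModulus.exists_le {ρ : ℝ → ℝ → ℝ} (hρ : IsLocalModulus ρ) {R κ : ℝ} (hR : 0 ≤ R)
    (hκ : 0 < κ) : ∃ r > 0, ∀ D, 0 ≤ D → D < r → ρ D R ≤ κ := by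
  obtain ⟨r, hr, h⟩ := mem_nhdsGT_iff_exists_Ioo_subset.1
    ((hρ.tendsto R hR).eventually (Iio_mem_nhds hκ))
  refine ⟨r, hr, fun D hD hDr => ?_⟩
  rcases hD.eq_or_lt with rfl | hD
  · rw [hρ.zero R hR]; exact hκ.le
  · exact (h ⟨hD, hDr⟩ : ρ D R < κ).le

/-- The bounds of the uniqueness class on paths with values in a ball. -/
theorem InUniquenessClass.exists_bounds {w : ℝ → PathSpace d τ → ℝ} (hw : InUniquenessClass T w) :
    ∃ Λ > 0, (∀ t ∈ Icc 0 T, ∀ x, |w t x| ≤ Λ * (1 + ‖x.ev 0‖ + ‖x.toH‖)) ∧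
      ∀ R ≥ 0, ∀ t ∈ Icc 0 T, ∀ s ∈ Icc 0 T, ∀ x ∈ pathsIn (Metric.closedBall 0 R),
        ∀ y ∈ pathsIn (Metric.closedBall 0 R), |w t x - w s y| ≤ Λ * (1 + 2 * (R + √τ * R)) *
          (‖x.ev 0 - y.ev 0‖ + √|t - s| + ‖primitiveL (x - y).toH‖) := by
  obtain ⟨Λ, hΛ, hw⟩ := hw
  refine ⟨Λ, hΛ, fun t ht x => (hw t ht t ht x x).1, fun R hR t ht s hs x hx y hy => ?_⟩
  have hx' : ∀ θ ∈ Icc (-τ) 0, ‖x.ev θ‖ ≤ R := fun θ hθ => mem_closedBall_zero_iff.1 (hx θ hθ)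
  have hy' : ∀ θ ∈ Icc (-τ) 0, ‖y.ev θ‖ ≤ R := fun θ hθ => mem_closedBall_zero_iff.1 (hy θ hθ)
  refine (hw t ht s hs x y).2.trans ?_
  rw [abs_sub_comm s t]
  have b1 := hx' 0 mem_zero
  have b2 := hy' 0 mem_zero
  have b3 := norm_toH_le x hx'
  have b4 := norm_toH_le y hy'
  have b5 := weakDist_le_norm_primitiveL x y
  have b6 := weakDist_nonneg x y
  refine mul_le_mul (mul_le_mul_of_nonneg_left ?_ hΛ.le) (add_le_add_right b5 _)
    (add_nonneg (by positivity) b6) (by positivity)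
  linarith only [b1, b2, b3, b4]

theorem growth_lower {μ : ℝ} (hμ : 0 ≤ μ) {t : ℝ} (ht : t ≤ T) (x : PathSpace d τ) :
    1 + ‖x.ev 0‖ ^ 2 + ‖x.toH‖ ^ 2 ≤ growth T μ t x := by
  have he : 1 ≤ Real.exp (μ * (T - t)) := Real.one_le_exp (mul_nonneg hμ (sub_nonneg.2 ht))
  exact le_mul_of_one_le_left (by positivity) he

/-- Quadratic growth beats linear growth. The bound involves no radius, so the ball of the
localization can be chosen after `β` with the end values in its interior. -/
theorem coercivity {β Λ a n a' n' : ℝ} (hβ : 0 < β)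
    (h : β * (1 + a ^ 2 + n ^ 2) + β * (1 + a' ^ 2 + n' ^ 2)
      ≤ Λ * (1 + a + n) + Λ * (1 + a' + n')) :
    a ^ 2 ≤ 4 * (Λ / β) + 4 * (Λ / β) ^ 2 := by
  have e : Λ = (Λ / β) * β := by field_simp
  generalize Λ / β = c at e
  subst e
  have h' : β * ((1 + a ^ 2 + n ^ 2) + (1 + a' ^ 2 + n' ^ 2))
      ≤ β * (c * (1 + a + n) + c * (1 + a' + n')) := by linarith
  have h'' := le_of_mul_le_mul_left h' hβ
  nlinarith only [h'', sq_nonneg (a - c), sq_nonneg (n - c), sq_nonneg (a' - c), sq_nonneg (n' - c),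
    sq_nonneg n, sq_nonneg a', sq_nonneg n']

set_option maxHeartbeats 1000000 in
/-- The comparison principle in the uniqueness class. -/
theorem comparison [MeasurableSpace U] [Nonempty U] (hT : 0 < T) (hcost : CostHyp P T)
    (hP : CoefBound P τ T K) {w₁ w₂ : ℝ → PathSpace d τ → ℝ} (h₁ : IsSubsolution P T w₁)
    (h₂ : IsSupersolution P T w₂) (c₁ : InUniquenessClass T w₁) (c₂ : InUniquenessClass T w₂)
    {t : ℝ} (ht : t ∈ Icc 0 T) (x : PathSpace d τ) : w₁ t x ≤ w₂ t x := by
  by_contra hlt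
  push Not at hlt
  have hK := zero_le_one.trans hP.one_le
  have hτ0 := hτ.out.le
  obtain ⟨L, hL, ρ, hρ, hq⟩ := hcost.cont
  obtain ⟨μ, hμ0, hμ⟩ := exists_growth_decay hP
  obtain ⟨Λ₁, hΛ₁, g₁, b₁⟩ := c₁.exists_bounds
  obtain ⟨Λ₂, hΛ₂, g₂, b₂⟩ := c₂.exists_bounds
  set Λ := Λ₁ + Λ₂ with hΛ
  set m := w₁ t x - w₂ t x with hm
  have hm0 : 0 < m := sub_pos.2 hlt
  have hgr : 0 < growth T μ t x :=
    lt_of_lt_of_le (by positivity) (growth_lower hμ0 ht.2 x)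
  -- With this `β` the doubled functional equals `m / 2` at the diagonal starting point.
  set β := m / (4 * growth T μ t x) with hβd
  have hβ : 0 < β := by positivity
  have hβm : 2 * (β * growth T μ t x) = m / 2 := by rw [hβd]; field_simp; norm_num
  have hΛβ : 0 ≤ Λ / β := by positivity
  -- Large enough for `x` to lie in the ball and for the bound of `coercivity` to keep end values
  -- strictly inside.
  set R := ‖x‖ + 1 + (4 * (Λ / β) + 4 * (Λ / β) ^ 2) with hRd
  have hR0 : 0 < R := by positivity
  clear_value β
  have hxR : x ∈ pathsIn (Metric.closedBall (0 : E d) R) := fun θ _ => by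
    rw [mem_closedBall_zero_iff]
    refine (x.norm_ev_le θ).trans ?_
    have : 0 ≤ 1 + (4 * (Λ / β) + 4 * (Λ / β) ^ 2) := by positivity
    linarith
  clear_value R m
  set C := Λ * (1 + 2 * (R + √τ * R)) with hC
  have hC0 : 0 ≤ C := by positivity
  clear_value C
  set C₂ := 2 * C * (K + 3) + 2 with hC₂
  have hC₂0 : 0 ≤ C₂ := by positivity
  have hpc : 0 ≤ penaltyConst K τ := by unfold penaltyConst; positivity
  -- `M₁ * κ` collects all errors in the viscosity inequality, to be beaten by `2 * β`; `M₂ * κ`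
  -- collects those that exclude the terminal time, to be beaten by `m / 2`.
  set M₁ := penaltyConst K τ * C₂ + 2 * K ^ 2 * (1 + R) ^ 2 * C₂ + 8 * K ^ 2 * R ^ 2
    + L * (K + 2 + C₂) + 1 with hM₁
  have hM₁0 : 0 < M₁ := by positivity
  set M₂ := 1 + K * (K + 2 + C₂) + C * (1 + C₂) with hM₂
  have hM₂0 : 0 < M₂ := by positivity
  clear_value M₁ M₂
  obtain ⟨κ, hκ, hκ1, hκM₁, hκM₂⟩ : ∃ κ > 0, κ ≤ 1 ∧ M₁ * κ < 2 * β ∧ M₂ * κ < m / 2 := by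
    refine ⟨min 1 (min (β / M₁) (m / (4 * M₂))), by positivity, min_le_left _ _, ?_, ?_⟩
    · calc _ ≤ M₁ * (β / M₁) := by
            gcongr; exact (min_le_right _ _).trans (min_le_left _ _)
        _ = β := by field_simp
        _ < 2 * β := by linarith
    · calc _ ≤ M₂ * (m / (4 * M₂)) := by
            gcongr; exact (min_le_right _ _).trans (min_le_right _ _)
        _ = m / 4 := by field_simp
        _ < m / 2 := by linarith
  have hpen := fun r hr => exists_penalization (r := r) hC0 hK hR0.le hκ hκ1 hr
  rw [← hC₂] at hpen
  clear_value C₂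
  obtain ⟨r, hr, hρr⟩ := hρ.exists_le hR0.le hκ
  obtain ⟨α, γ, η, hα, hγ, hη, hαη, hpen⟩ := hpen r hr
  obtain ⟨B, hB, hBK, hBK', hBb⟩ := exists_smooth_approx hT.le hK hη hP.b_le hP.b_lip
  obtain ⟨⟨s, z⟩, ⟨s', z'⟩, hs, hs', hz, hz', hqc, hqc', hmax, hnear⟩ :=
    exists_maximal_doubled (μ := μ) (p₀ := (t, x)) hα.le hγ.le hβ.le hB.continuous c₁ c₂ ht hxR hκ
  simp only at hs hs' hz hz'
  have hstart := hnear (t, x) (t, x) (Continues.refl _) (Continues.refl _) ht.2 ht.2 hxR hxR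
  -- The diagonal pairs continue the starting point but need not continue the maximal pair, so
  -- near-maximality is used here. In the sum of the two comparisons the growth terms cancel, which
  -- leaves twice the penalty.
  have hdiag := hnear (s, z) (s, z) hqc hqc hs.2 hs.2 hz hz
  have hdiag' := hnear (s', z') (s', z') hqc' hqc' hs'.2 hs'.2 hz' hz'
  simp only [doubled, penalty_self, sub_self] at hstart hdiag hdiag'
  set p := penalty (B s) z z' with hp
  set D := |s - s'| with hD
  set W := ‖primitiveL (z - z').toH‖ with hW
  set g := ‖z.ev 0 - z'.ev 0‖ with hg
  have hp0 : 0 ≤ p := penalty_nonneg _ _ _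
  have hD0 : 0 ≤ D := abs_nonneg _
  have hDsq : (s - s') ^ 2 = D ^ 2 := (sq_abs _).symm
  rw [hDsq] at hstart hdiag hdiag'
  have hG := growth_lower hμ0 hs.2 z
  have hG' := growth_lower hμ0 hs'.2 z'
  have hαp : 0 ≤ α * p := by positivity
  have hγD : 0 ≤ γ * D ^ 2 := by positivity
  have hβG := mul_le_mul_of_nonneg_left hG hβ.le
  have hβG' := mul_le_mul_of_nonneg_left hG' hβ.le
  have hWp : W ≤ κ + 16 * R * p / κ ^ 2 := by
    have hb : ∀ θ ∈ Icc (-τ) 0, ‖(z - z').ev θ‖ ≤ 2 * R := fun θ hθ => by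
      have e1 := mem_closedBall_zero_iff.1 (hz θ hθ)
      have e2 := mem_closedBall_zero_iff.1 (hz' θ hθ)
      rw [two_mul]
      exact (norm_sub_le _ _).trans (add_le_add e1 e2)
    refine (norm_primitiveL_le hκ (z - z') hb).trans ?_
    gcongr
    rw [hp, penalty]
    exact le_add_of_nonneg_left (sq_nonneg _)
  have hgp : g ≤ √p + K * W := by
    refine (norm_value_le_gap (hBK s) z z').trans (add_le_add ?_ ?_)
    · refine Real.le_sqrt_of_sq_le ?_
      rw [hp, penalty]
      exact le_add_of_nonneg_right (sq_nonneg _)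
    · gcongr
      exact PathSpace.norm_ev_le _ _
  have hd₁ := b₁ R hR0.le s hs s' hs' z hz z' hz'
  have hd₂ := b₂ R hR0.le s hs s' hs' z hz z' hz'
  have hCsplit : C * (g + √D + W) = Λ₁ * (1 + 2 * (R + √τ * R)) * (g + √D + W)
      + Λ₂ * (1 + 2 * (R + √τ * R)) * (g + √D + W) := by rw [hC, hΛ]; ring
  have hmain : α * p + γ * D ^ 2 ≤ C * (g + √D + W) + κ := by
    have e1 := (abs_le.1 hd₁).2
    have e2 := (abs_le.1 hd₂).2
    have e3 : 0 ≤ C * (g + √D + W) := mul_nonneg hC0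
      (add_nonneg (add_nonneg (norm_nonneg _) (Real.sqrt_nonneg _)) (norm_nonneg _))
    linarith only [hdiag, hdiag', e1, e2, e3, hCsplit]
  obtain ⟨k1, k2, k3, k4, k5⟩ := hpen p D W g hp0 hD0 hWp hgp hmain
  have hκM₂' : κ + (K * (K + 2 + C₂) + C * (1 + C₂)) * κ < m / 2 := by
    rw [hM₂] at hκM₂; linarith only [hκM₂]
  have hrest : 0 ≤ (K * (K + 2 + C₂) + C * (1 + C₂)) * κ := by positivity
  have hβm' : w₁ t x - w₂ t x - 2 * (β * growth T μ t x) = m / 2 := by rw [hβm, ← hm]; ring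
  have hβp : 0 < β * (1 + ‖z.ev 0‖ ^ 2 + ‖z.toH‖ ^ 2) := by positivity
  have hβp' : 0 < β * (1 + ‖z'.ev 0‖ ^ 2 + ‖z'.toH‖ ^ 2) := by positivity
  have hww : β * (1 + ‖z.ev 0‖ ^ 2 + ‖z.toH‖ ^ 2) + β * (1 + ‖z'.ev 0‖ ^ 2 + ‖z'.toH‖ ^ 2)
      + (m / 2 - κ) ≤ w₁ s z - w₂ s' z' := by
    linarith only [hstart, hβm', hβG, hβG', hαp, hγD]
  have hco : β * (1 + ‖z.ev 0‖ ^ 2 + ‖z.toH‖ ^ 2) + β * (1 + ‖z'.ev 0‖ ^ 2 + ‖z'.toH‖ ^ 2)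
      ≤ Λ * (1 + ‖z.ev 0‖ + ‖z.toH‖) + Λ * (1 + ‖z'.ev 0‖ + ‖z'.toH‖) := by
    have e1 := (le_abs_self _).trans (g₁ s hs z)
    have e2 := (neg_le_abs _).trans (g₂ s' hs' z')
    have e3 : Λ₁ * (1 + ‖z.ev 0‖ + ‖z.toH‖) ≤ Λ * (1 + ‖z.ev 0‖ + ‖z.toH‖) := by
      gcongr; rw [hΛ]; linarith only [hΛ₂]
    have e4 : Λ₂ * (1 + ‖z'.ev 0‖ + ‖z'.toH‖) ≤ Λ * (1 + ‖z'.ev 0‖ + ‖z'.toH‖) := by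
      gcongr; rw [hΛ]; linarith only [hΛ₁]
    linarith only [hww, hκM₂', hrest, e1, e2, e3, e4]
  have hval : ∀ a : ℝ, a ^ 2 ≤ 4 * (Λ / β) + 4 * (Λ / β) ^ 2 → a < R := fun a ha => by
    have hx0 := norm_nonneg x
    generalize 4 * (Λ / β) + 4 * (Λ / β) ^ 2 = c at *
    nlinarith only [sq_nonneg (a - 1), ha, hx0, hRd, sq_nonneg a]
  have hz0 := hval _ (coercivity hβ hco)
  have hz0' := hval _ (coercivity hβ (by linarith only [hco] :
    β * (1 + ‖z'.ev 0‖ ^ 2 + ‖z'.toH‖ ^ 2) + β * (1 + ‖z.ev 0‖ ^ 2 + ‖z.toH‖ ^ 2)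
      ≤ Λ * (1 + ‖z'.ev 0‖ + ‖z'.toH‖) + Λ * (1 + ‖z.ev 0‖ + ‖z.toH‖)))
  -- If one of the times were `T`, the terminal inequalities, the Lipschitz bound on `φ` and the
  -- time regularity of the other function would give this estimate, against the lower bound of
  -- about `m / 2`.
  have hterm : ¬ (w₁ s z - w₂ s' z' ≤ K * g + C * √D) := by
    intro h
    have e1 : K * g ≤ K * ((K + 2 + C₂) * κ) := mul_le_mul_of_nonneg_left k3 hK
    have e2 : C * √D ≤ C * ((1 + C₂) * κ) := mul_le_mul_of_nonneg_left k4 hC0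
    linarith only [h, hww, hβp, hβp', hκM₂', e1, e2]
  have hφ := (le_abs_self _).trans (hP.φ_lip (z.ev 0) (z'.ev 0))
  have hzero : ∀ y : PathSpace d τ, ‖y.ev 0 - y.ev 0‖ + √D + ‖primitiveL (y - y).toH‖ = √D := by
    intro y
    rw [sub_self, norm_zero, toH_sub, sub_self, map_zero, norm_zero, zero_add, add_zero]
  have hT' : T ∈ Icc 0 T := ⟨hT.le, le_rfl⟩
  have hsT : s ∈ Ico 0 T := by
    refine ⟨hs.1, lt_of_le_of_ne hs.2 fun hsT => hterm ?_⟩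
    have e1 := h₁.terminal z
    have e2 := h₂.terminal z'
    have e3 := (abs_le.1 (b₂ R hR0.le T hT' s' hs' z' hz' z' hz')).2
    rw [← hsT, ← hD, hzero] at e3
    rw [← hsT] at e1 e2
    have e4 : Λ₂ * (1 + 2 * (R + √τ * R)) * √D ≤ C * √D := by
      rw [hC]; gcongr; rw [hΛ]; linarith only [hΛ₁]
    linarith only [e1, e2, e3, e4, hφ]
  have hsT' : s' ∈ Ico 0 T := by
    refine ⟨hs'.1, lt_of_le_of_ne hs'.2 fun hsT => hterm ?_⟩
    have e1 := h₁.terminal z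
    have e2 := h₂.terminal z'
    have e3 := (abs_le.1 (b₁ R hR0.le s hs T hT' z hz z hz)).2
    rw [← hsT, ← hD, hzero] at e3
    rw [← hsT] at e1 e2
    have e4 : Λ₁ * (1 + 2 * (R + √τ * R)) * √D ≤ C * √D := by
      rw [hC]; gcongr; rw [hΛ]; linarith only [hΛ₂]
    linarith only [e1, e2, e3, e4, hφ]
  have key := doubled_estimate hT hP hρ hq hμ hα.le hβ.le hB hBK hBK' hBb h₁ h₂ hsT hsT' hz hz' hz0
    hz0' hmax
  rw [← hp, ← hD, ← hg] at key
  have f1 := hρr D hD0 k5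
  have f2 : L * g ≤ L * ((K + 2 + C₂) * κ) := mul_le_mul_of_nonneg_left k3 hL.le
  have f3 : penaltyConst K τ * (α * p) ≤ penaltyConst K τ * (C₂ * κ) :=
    mul_le_mul_of_nonneg_left k1 hpc
  have f4 : 2 * K ^ 2 * (1 + R) ^ 2 * (α * D ^ 2) ≤ 2 * K ^ 2 * (1 + R) ^ 2 * (C₂ * κ) := by
    gcongr
  have f5 : 8 * K ^ 2 * R ^ 2 * (α * η ^ 2) ≤ 8 * K ^ 2 * R ^ 2 * κ := by gcongr
  -- Splitting the square leaves `α * D ^ 2` and `α * η ^ 2`, both of order `κ` by the choice of `γ`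
  -- and `η`.
  have f6 : α * (K * ((1 + R) * D + 2 * R * η)) ^ 2
      ≤ 2 * K ^ 2 * (1 + R) ^ 2 * (α * D ^ 2) + 8 * K ^ 2 * R ^ 2 * (α * η ^ 2) := by
    have : 0 ≤ α * K ^ 2 * ((1 + R) * D - 2 * R * η) ^ 2 := by positivity
    linarith only [this]
  have hκM₁' : penaltyConst K τ * (C₂ * κ) + 2 * K ^ 2 * (1 + R) ^ 2 * (C₂ * κ)
      + 8 * K ^ 2 * R ^ 2 * κ + L * ((K + 2 + C₂) * κ) + κ < 2 * β := by
    rw [hM₁] at hκM₁; linarith only [hκM₁]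
  linarith only [key, f1, f2, f3, f4, f5, f6, hκM₁']

end ComparisonPrinciple

end DelayHJB

end

theorem theorem5p2 {d : ℕ} {τ T : ℝ} [Fact (0 < τ)] (hT : 0 < T)
    {U : Type*} [MetricSpace U] [Nonempty U] [MeasurableSpace U] [BorelSpace U]
    (P : DelayHJB.Coefficients d U)
    (hstate : DelayHJB.StateHyp P τ T) (hcost : DelayHJB.CostHyp P T) :
    (∀ t ∈ Set.Icc 0 T, ∀ x : DelayHJB.PathSpace d τ,
      IsGLB (DelayHJB.costs P T t x) (DelayHJB.valueFunction P T t x)) ∧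
    DelayHJB.InUniquenessClass T (DelayHJB.valueFunction (τ := τ) P T) ∧
    DelayHJB.IsViscositySolution P T (DelayHJB.valueFunction (τ := τ) P T) ∧
    ∀ w : ℝ → DelayHJB.PathSpace d τ → ℝ,
      DelayHJB.InUniquenessClass T w → DelayHJB.IsViscositySolution P T w →
        ∀ t ∈ Set.Icc 0 T, ∀ x, w t x = DelayHJB.valueFunction P T t x := by
  obtain ⟨K, hP⟩ := DelayHJB.exists_coefBound hT hstate hcost
  have hV := DelayHJB.valueFunction_mem_class hT hstate hcost hP
  have hsub := DelayHJB.isSubsolution_valueFunction hT hstate hcost hP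
  have hsup := DelayHJB.isSupersolution_valueFunction hT hstate hcost hP
  exact ⟨fun t ht x => DelayHJB.isGLB_valueFunction hT hstate hP ht x, hV, ⟨hsub, hsup⟩,
    fun w hwc hw t ht x => le_antisymm (DelayHJB.comparison hT hcost hP hw.1 hsup hwc hV ht x)
      (DelayHJB.comparison hT hcost hP hsub hw.2 hV hwc ht x)⟩
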